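/- Fix $\alpha\in(\tfrac12,2]$ and write $\mathbb T=\mathbb R/2\pi\mathbb Z$. All functions are real-valued and $2\pi$-periodic; $\widehat u(n)=\frac1{2\pi}\int_{-\pi}^{\pi}u(x)e^{-inx}\,dx$, $\;\widehat{D^{s}u}(n)=|n|^{s}\widehat u(n)$ for $n\in\mathbb Z$, and $H^s_{\rm per}$ is the space of $u\in L^2(\mathbb T)$ with $\|u\|_{H^s_{\rm per}}^2=\sum_{n\in\mathbb Z}(1+n^2)^s|\widehat u(n)|^2<\infty$. For $c>-1$ put $$\mathcal B_c(u)=\frac12\int_{-\pi}^{\pi}\big[(D^{\alpha/2}u)^2+c\,u^2\big]dx,\qquad Y_0=\Big\{u\in H^{\alpha/2}_{\rm per}:\ \int_{-\pi}^{\pi}u^3dx=1,\ \int_{-\pi}^{\pi}u\,dx=0\Big\}.$$ A ground state at $c$ is a minimizer $\phi$ of $\mathcal B_c$ over $Y_0$. A continuous function on $\mathbb T$ is called single-lobe if it has exactly one point of local maximum on $\mathbb T$, placed at $x=0$, and exactly one point of local minimum on $\mathbb T$. A minimizer wave at $c$ is an even, single-lobe, continuous function $\psi$ such that $\psi=2\mathcal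 B_c(\phi)\,\phi$ almost everywhere for some ground state $\phi$ at $c$. Then there exist $c_0\in(-1,\infty)$, $a_0>0$, $K$ (depending only on $\alpha$), a bijection $a\mapsto c(a)$ from $(0,a_0)$ onto $(-1,c_0)$, and functions $\psi_a$, $a\in(0,a_0)$, such that for every $a\in(0,a_0)$, with $c=c(a)$: 1. $\psi_a\in H^\alpha_{\rm per}$ has zero mean and solves $D^\alpha\psi_a+c\psi_a=\psi_a^2-b$ with $b=\frac1{2\pi}\int_{-\pi}^{\pi}\psi_a^2\,dx$; 2. $\psi_a$ is the one and only minimizer wave at $c$ (so for every $c\in(-1,c_0)$ there is exactly one minimizer wave, and the minimizer waves with $c\in(-1,c_0)$ are exactly the functions $\psi_a$); 3. $\frac1\pi\int_{-\pi}^{\pi}\psi_a(x)\cos x\,dx=a$, and the Stokes expansion $$\psi_a=a\cos x+\frac{a^2}{2(2^\alpha-1)}\cos 2x+\frac{a^3}{2(2^\alpha-1)(3^\alpha-1)}\cos 3x+\mathcal O(a^4)\quad\text{in }H^\alpha_{\rm per},$$ $$c=-1+\frac{a^2}{2(2^\alpha-1)}+\mathcal O(a^4),\qquad b=\frac{a^2}{2}+\mathcal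 O(a^4)$$ holds, where each $\mathcal O(a^4)$ is bounded by $Ka^4$ (in the norm of $H^\alpha_{\rm per}$ for the first expansion, in absolute value for the other two). -/

import Mathlib

open MeasureTheory Set

namespace FracKdV

noncomputable section

/-- The Fourier coefficient `û(n) = (1/2π) ∫_{-π}^{π} u(x) e^{-inx} dx`. -/
def coef (u : ℝ → ℝ) (n : ℤ) : ℂ :=
  fourierCoeffOn (neg_lt_self Real.pi_pos) (fun x => (u x : ℂ)) n

/-- Real `2π`-periodic functions that are square integrable over a period. -/
def MemL2per (u : ℝ → ℝ) : Prop :=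
  Function.Periodic u (2 * Real.pi) ∧
    MemLp u 2 (volume.restrict (Ioc (-Real.pi) Real.pi))

/-- The periodic Sobolev space `H^s_per` (for `s ≥ 0`). -/
def MemHper (s : ℝ) (u : ℝ → ℝ) : Prop :=
  MemL2per u ∧ Summable fun n : ℤ => (1 + (n : ℝ) ^ 2) ^ s * ‖coef u n‖ ^ 2

/-- The norm of `H^s_per`. -/
def hperNorm (s : ℝ) (u : ℝ → ℝ) : ℝ :=
  Real.sqrt (∑' n : ℤ, (1 + (n : ℝ) ^ 2) ^ s * ‖coef u n‖ ^ 2)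

/-- `v` represents `D^s u` in `L²_per`: its Fourier coefficients are `|n|^s û(n)`. -/
def IsFracDeriv (s : ℝ) (u v : ℝ → ℝ) : Prop :=
  MemL2per v ∧ ∀ n : ℤ, coef v n = ((|(n : ℝ)| ^ s : ℝ) : ℂ) * coef u n

/-- The fractional derivative `D^s u`, a representative of an element of `L²_per` (unique up to a
null set); meaningful for `u ∈ H^s_per`, see `fracDeriv_spec`. -/
def fracDeriv (s : ℝ) (u : ℝ → ℝ) : ℝ → ℝ :=
  Classical.epsilon (IsFracDeriv s u)

/-- The mean value over a period. -/
def mean (u : ℝ → ℝ) : ℝ := (2 * Real.pi)⁻¹ * ∫ x in (-Real.pi)..Real.pi, u x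

/-- The boundary-value problem `D^α ψ + c ψ = Π₀ ψ²`, `ψ ∈ H^α_per`, for zero-mean `ψ`. -/
def IsSolution (α c : ℝ) (ψ : ℝ → ℝ) : Prop :=
  MemHper α ψ ∧ mean ψ = 0 ∧
    ∀ᵐ x : ℝ, fracDeriv α ψ x + c * ψ x = ψ x ^ 2 - mean (fun y => ψ y ^ 2)

/-- The quadratic functional `B_c(u) = ½ ∫_{-π}^{π} [(D^{α/2} u)² + c u²] dx`. -/
def quadForm (α c : ℝ) (u : ℝ → ℝ) : ℝ :=
  (1 / 2) * ∫ x in (-Real.pi)..Real.pi, (fracDeriv (α / 2) u x ^ 2 + c * u x ^ 2)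

/-- The constraint set `Y₀ = {u ∈ H^{α/2}_per : ∫ u³ = 1, ∫ u = 0}`. -/
def constraintSet (α : ℝ) : Set (ℝ → ℝ) :=
  {u | MemHper (α / 2) u ∧ (∫ x in (-Real.pi)..Real.pi, u x ^ 3) = 1 ∧
    (∫ x in (-Real.pi)..Real.pi, u x) = 0}

/-- `φ` minimizes `B_c` over the constraint set. -/
def IsGroundState (α c : ℝ) (φ : ℝ → ℝ) : Prop :=
  φ ∈ constraintSet α ∧ IsMinOn (quadForm α c) (constraintSet α) φ

/-- Modulo `2π` there is exactly one point of local maximum, namely `0`, and exactly one point of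
local minimum. -/
def IsSingleLobe (ψ : ℝ → ℝ) : Prop :=
  (∀ x, IsLocalMax ψ x ↔ ∃ n : ℤ, x = 2 * Real.pi * n) ∧
    ∃ y, ∀ x, IsLocalMin ψ x ↔ ∃ n : ℤ, x = y + 2 * Real.pi * n

/-- `ψ` is an even, single-lobe wave (taken as a continuous function) of the form
`ψ = 2 B_c(φ) φ` with a ground state `φ`. -/
structure IsMinimizerWave (α c : ℝ) (ψ : ℝ → ℝ) : Prop where
  cont : Continuous ψ
  even : Function.Even ψ
  lobe : IsSingleLobe ψ
  minimizer : ∃ φ, IsGroundState α c φ ∧ ∀ᵐ x : ℝ, ψ x = 2 * quadForm α c φ * φ x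

/-- The third-order Stokes polynomial. -/
def stokes (α a : ℝ) (x : ℝ) : ℝ :=
  a * Real.cos x + a ^ 2 / (2 * (2 ^ α - 1)) * Real.cos (2 * x)
    + a ^ 3 / (2 * (2 ^ α - 1) * (3 ^ α - 1)) * Real.cos (3 * x)

/-! ### `D^s` is well defined on `H^s_per` -/

local instance factPeriod : Fact (0 < Real.pi - -Real.pi) := ⟨by linarith [Real.pi_pos]⟩

lemma coef_neg (u : ℝ → ℝ) (n : ℤ) : coef u (-n) = (starRingEnd ℂ) (coef u n) := by
  unfold coef
  rw [fourierCoeffOn_eq_integral, fourierCoeffOn_eq_integral, Complex.real_smul,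
    Complex.real_smul, map_mul, Complex.conj_ofReal, intervalIntegral.integral_of_le
    (by linarith [Real.pi_pos]), intervalIntegral.integral_of_le
    (by linarith [Real.pi_pos]), ← integral_conj]
  congr 1
  refine integral_congr_ae (Filter.Eventually.of_forall fun x => ?_)
  simp [smul_eq_mul]

lemma memL2_iff_circle (f : AddCircle (Real.pi - -Real.pi) → ℂ)
    (hf : MemLp f 2 AddCircle.haarAddCircle) :
    MemLp (fun x : ℝ => f x) 2 (volume.restrict (Ioc (-Real.pi) Real.pi)) := by
  rw [memLp_haarAddCircle_iff] at hf
  have h := AddCircle.measurePreserving_mk (Real.pi - -Real.pi) (-Real.pi)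
  have := hf.comp_measurePreserving h
  simpa [Function.comp_def] using this

lemma exists_isFracDeriv {s : ℝ} (hs : 0 ≤ s) {u : ℝ → ℝ} (hu : MemHper s u) :
    ∃ v, IsFracDeriv s u v := by
  set c : ℤ → ℂ := fun n => ((|(n : ℝ)| ^ s : ℝ) : ℂ) * coef u n with hc
  have hsum : Memℓp c 2 := by
    rw [memℓp_gen_iff (by norm_num)]
    refine Summable.of_nonneg_of_le (fun n => by positivity) (fun n => ?_) hu.2
    have h1 : (|(n : ℝ)| ^ s) ^ 2 ≤ (1 + (n : ℝ) ^ 2) ^ s := by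
      rw [← Real.rpow_natCast, ← Real.rpow_mul (abs_nonneg _), mul_comm s,
        Real.rpow_mul (abs_nonneg _), Real.rpow_natCast, sq_abs]
      exact Real.rpow_le_rpow (sq_nonneg _) (by linarith) hs
    have h2 : ‖c n‖ ^ 2 = (|(n : ℝ)| ^ s) ^ 2 * ‖coef u n‖ ^ 2 := by
      simp only [hc, norm_mul, mul_pow, Complex.norm_real, Real.norm_eq_abs, sq_abs]
    simp only [ENNReal.toReal_ofNat, Real.rpow_ofNat]
    rw [h2]
    gcongr
  set g : Lp ℂ 2 (@AddCircle.haarAddCircle (Real.pi - -Real.pi) factPeriod) :=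
    fourierBasis.repr.symm ⟨c, hsum⟩ with hg
  have hgc : ∀ n, fourierCoeff g n = c n := by
    intro n
    rw [← fourierBasis_repr, hg, LinearIsometryEquiv.apply_symm_apply]
  have hcneg : ∀ n, (starRingEnd ℂ) (c (-n)) = c n := by
    intro n
    simp [hc, coef_neg]
  have hgm : MemLp g 2 (@AddCircle.haarAddCircle (Real.pi - -Real.pi) factPeriod) := Lp.memLp g
  refine ⟨fun x => (g (x : AddCircle (Real.pi - -Real.pi))).re, ⟨?_, ?_⟩, fun n => ?_⟩
  · intro x
    have h : ((x + 2 * Real.pi : ℝ) : AddCircle (Real.pi - -Real.pi)) = x := by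
      have h2 : (2 * Real.pi : ℝ) = Real.pi - -Real.pi := by ring
      rw [h2, AddCircle.coe_add_period]
    simp only [h]
  · exact (memL2_iff_circle g hgm).re
  · have hint : Integrable g (@AddCircle.haarAddCircle (Real.pi - -Real.pi) factPeriod) :=
      hgm.integrable (by norm_num)
    have key : fourierCoeff (fun t => ((g t).re : ℂ)) n = c n := by
      have hconj : fourierCoeff (fun t => (starRingEnd ℂ) (g t)) n = c n := by
        rw [← hcneg n, ← hgc (-n)]
        unfold fourierCoeff
        rw [← integral_conj]
        refine integral_congr_ae (Filter.Eventually.of_forall fun x => ?_)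
        simp [smul_eq_mul]
      have hic : Integrable (fun t => (starRingEnd ℂ) (g t))
          (@AddCircle.haarAddCircle (Real.pi - -Real.pi) factPeriod) :=
        (LinearIsometryEquiv.integrable_comp_iff Complex.conjLIE).2 hint
      have hre : (fun t => ((g t).re : ℂ))
          = (1 / 2 : ℂ) • ((g : AddCircle (Real.pi - -Real.pi) → ℂ)
            + fun t => (starRingEnd ℂ) (g t)) := by
        funext t
        simp only [Pi.smul_apply, Pi.add_apply, smul_eq_mul, Complex.add_conj]
        push_cast
        ring
      rw [hre, fourierCoeff.const_smul, fourierCoeff.add hint hic, Pi.add_apply, hconj, hgc,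
        smul_eq_mul]
      ring
    change coef _ n = c n
    rw [← key]
    unfold coef
    rw [fourierCoeffOn_eq_integral, fourierCoeff_eq_intervalIntegral _ _ (-Real.pi)]
    congr 2
    ring

/-- On `H^s_per` the function `fracDeriv s u` is in `L²_per` and has the Fourier coefficients
`|n|^s û(n)`. -/
lemma fracDeriv_spec {s : ℝ} (hs : 0 ≤ s) {u : ℝ → ℝ} (hu : MemHper s u) :
    IsFracDeriv s u (fracDeriv s u) :=
  Classical.epsilon_spec (exists_isFracDeriv hs hu)

end

end FracKdV

namespace FracKdV

noncomputable section

-- The whole argument lives on Fourier coefficients and uses inequalities only; no implicit function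
-- theorem is needed. The variational problem supplies existence for every speed, and a comparison
-- estimate supplies all the structure of the branch.
--
-- Existence and smallness. Since `α > 1/2`, the square of an `H^{α/2}` function is in `L²`
-- (`conv_weighted`), and the cubic functional is continuous on a compact energy ball of sequences.
-- Maximising it there and rescaling gives a ground state (`exists_isGroundState`). Perturbing a
-- single pair of modes gives the Euler-Lagrange equation, so the coefficients `f` of `2 B_c(φ) φ`
-- satisfy `(|n|^α + c) f n = (f * f) n` for `n ≠ 0`. The trial function `2 cos x + 2 √(1 + c) cos
-- 2x` bounds the energy of `f` by a multiple of `(1 + c)²`. The symbol of mode one is `1 + c`,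
-- whence the amplitude obeys `a² = O(1 + c)`, and the symbols of the higher modes stay away from
-- zero, so these modes are small too (`IsWaveSeq.exists_small`).
--
-- Rigidity. After a translation the wave is `a cos x` plus modes `r` with `|n| ≥ 2`. The equations
-- of those modes give `r = O(a²)` with Lipschitz dependence on `(a, c)`; the equation of mode one,
-- divided by `a`, ties `c` to `r 2`. For two small solutions, elimination of the difference of `r
-- 2` yields `(2^α + c)/2 * (c - c') = (a² - a'²)/4` up to an error `O(a) (|c - c'| + a² - a'²)`. So
-- `c` is an increasing bi-Lipschitz function of `a²` (`Reduced.exists_compare`). This one estimate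
-- gives uniqueness of `(a, r)` at a given speed, reality of `r` (its conjugate solves the same
-- system), and strict monotonicity and continuity of the amplitude. The intermediate value theorem
-- then makes speed and amplitude correspond bijectively (`IsBranch.bijOn`).
--
-- Shape and expansion. A bootstrap gives `n⁴ ‖r n‖ = O(a²)`, so for small `a` the wave is ordered
-- exactly as `cos x`; in particular it is single-lobe. Conversely, an even minimizer wave has a
-- real first coefficient. If it is nonnegative, uniqueness identifies the wave; if it is negative,
-- the half-period translate is the branch wave, and the original is ordered as `-cos x`, contrary
-- to the maximum at `0` (`IsMinimizerWave.eq_waveFun`). The Stokes coefficients are read off from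
-- modes one, two and three (`Reduced.exists_expansion`, `stokes_algebra`).

attribute [local instance] factPeriod

/-! ### Fourier coefficients, Parseval, uniqueness and Riesz-Fischer on a period. -/

/-- The Fourier coefficients over `(-π, π]` of a complex function. -/
def ccoef (f : ℝ → ℂ) (n : ℤ) : ℂ := fourierCoeffOn (neg_lt_self Real.pi_pos) f n

/-- Lebesgue measure on a period. -/
abbrev muPer : Measure ℝ := volume.restrict (Ioc (-Real.pi) Real.pi)

lemma coef_eq_ccoef (u : ℝ → ℝ) : coef u = ccoef fun x => (u x : ℂ) := rfl

lemma intervalIntegral_eq_muPer {E : Type*} [NormedAddCommGroup E] [NormedSpace ℝ E] (f : ℝ → E) :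
    ∫ x in (-Real.pi)..Real.pi, f x = ∫ x, f x ∂muPer := by
  rw [intervalIntegral.integral_of_le (by linarith [Real.pi_pos])]

lemma ccoef_eq (f : ℝ → ℂ) (n : ℤ) :
    ccoef f n = (2 * Real.pi : ℂ)⁻¹ * ∫ x, Complex.exp (-(n * x * Complex.I)) * f x ∂muPer := by
  unfold ccoef
  rw [fourierCoeffOn_eq_integral, Complex.real_smul, intervalIntegral_eq_muPer]
  congr 1
  · push_cast; rw [one_div]; congr 1; ring
  · refine integral_congr_ae (Filter.Eventually.of_forall fun x => ?_)
    simp only [smul_eq_mul]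
    rw [fourier_coe_apply]
    congr 2
    have : (Real.pi : ℂ) ≠ 0 := by exact_mod_cast Real.pi_ne_zero
    push_cast
    field_simp
    ring

lemma hasSum_conj_mul {f g : ℝ → ℂ} (hf : MemLp f 2 muPer) (hg : MemLp g 2 muPer) :
    HasSum (fun n : ℤ => (starRingEnd ℂ) (ccoef f n) * ccoef g n)
      ((2 * Real.pi : ℂ)⁻¹ * ∫ x, (starRingEnd ℂ) (f x) * g x ∂muPer) := by
  have e : -Real.pi + (Real.pi - -Real.pi) = Real.pi := by ring
  have hf' : MemLp f 2 (volume.restrict (Ioc (-Real.pi) (-Real.pi + (Real.pi - -Real.pi)))) := by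
    rwa [e]
  have hg' : MemLp g 2 (volume.restrict (Ioc (-Real.pi) (-Real.pi + (Real.pi - -Real.pi)))) := by
    rwa [e]
  have h1 := (hf'.memLp_liftIoc).haarAddCircle
  have h2 := (hg'.memLp_liftIoc).haarAddCircle
  have key := (fourierBasis (T := Real.pi - -Real.pi)).hasSum_inner_mul_inner h1.toLp h2.toLp
  have e1 : (fun n : ℤ => (starRingEnd ℂ) (ccoef f n) * ccoef g n) = fun i =>
      inner ℂ h1.toLp (fourierBasis (T := Real.pi - -Real.pi) i) *
        inner ℂ (fourierBasis (T := Real.pi - -Real.pi) i) h2.toLp := by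
    funext n
    rw [← inner_conj_symm, ← HilbertBasis.repr_apply_apply, ← HilbertBasis.repr_apply_apply,
      fourierBasis_repr, fourierBasis_repr, fourierCoeff_congr_ae h1.coeFn_toLp,
      fourierCoeff_congr_ae h2.coeFn_toLp]
    rfl
  have e2 : (2 * Real.pi : ℂ)⁻¹ * ∫ x, (starRingEnd ℂ) (f x) * g x ∂muPer
      = inner ℂ h1.toLp h2.toLp := by
    rw [L2.inner_def]
    have h3 : ∫ a, inner ℂ ((h1.toLp) a) ((h2.toLp) a) ∂AddCircle.haarAddCircle
        = ∫ a, AddCircle.liftIoc (Real.pi - -Real.pi) (-Real.pi)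
            (fun x => (starRingEnd ℂ) (f x) * g x) a ∂AddCircle.haarAddCircle := by
      refine integral_congr_ae ?_
      filter_upwards [h1.coeFn_toLp, h2.coeFn_toLp] with x hx hy
      rw [hx, hy]
      simp only [RCLike.inner_apply, AddCircle.liftIoc, Function.comp_apply, Set.domRestrict_apply]
      rw [mul_comm]
    rw [h3, AddCircle.integral_haarAddCircle, AddCircle.integral_liftIoc_eq_intervalIntegral, e,
      intervalIntegral_eq_muPer, Complex.real_smul]
    push_cast
    congr 2; ring
  rw [e1, e2]
  exact key


/-- The functional `G ↦ ∫ G f` is continuous on `C(circle)` and vanishes on trigonometric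
polynomials, which are dense, hence on every test function. Only integrability is assumed because
the result is applied to `u²` before that is known to be in `L²`. -/
lemma ae_eq_zero_of_ccoef_eq_zero {f : ℝ → ℂ} (hf : Integrable f muPer)
    (h : ∀ n, ccoef f n = 0) : f =ᵐ[muPer] 0 := by
  let T : C(AddCircle (Real.pi - -Real.pi), ℂ) →ₗ[ℂ] ℂ :=
    { toFun := fun G => ∫ x, G (x : AddCircle (Real.pi - -Real.pi)) * f x ∂muPer
      map_add' := by
        intro G H
        have hi : ∀ G : C(AddCircle (Real.pi - -Real.pi), ℂ),
            Integrable (fun x : ℝ => G (x : AddCircle (Real.pi - -Real.pi)) * f x) muPer := by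
          intro G
          refine hf.bdd_mul (c := ‖G‖) ?_ (Filter.Eventually.of_forall fun x => G.norm_coe_le_norm _)
          exact (G.continuous.comp (AddCircle.continuous_mk' _)).aestronglyMeasurable
        rw [← integral_add (hi G) (hi H)]
        simp [add_mul]
      map_smul' := by
        intro c G
        rw [RingHom.id_apply, smul_eq_mul, ← integral_const_mul]
        simp [mul_assoc] }
  have hTb : ∀ G, ‖T G‖ ≤ (∫ x, ‖f x‖ ∂muPer) * ‖G‖ := by
    intro G
    calc ‖T G‖ ≤ ∫ x, ‖G (x : AddCircle (Real.pi - -Real.pi)) * f x‖ ∂muPer :=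
          norm_integral_le_integral_norm _
      _ ≤ ∫ x, ‖G‖ * ‖f x‖ ∂muPer := by
          refine integral_mono_of_nonneg (Filter.Eventually.of_forall fun x => norm_nonneg _)
            (hf.norm.const_mul _) (Filter.Eventually.of_forall fun x => ?_)
          simp only [norm_mul]
          gcongr
          exact G.norm_coe_le_norm _
      _ = _ := by rw [integral_const_mul, mul_comm]
  let T' := T.mkContinuous _ hTb
  have hker : ∀ G, T' G = 0 := by
    intro G
    have h1 : (Submodule.span ℂ (range <| @fourier (Real.pi - -Real.pi))).topologicalClosure
        ≤ LinearMap.ker (T' : C(AddCircle (Real.pi - -Real.pi), ℂ) →ₗ[ℂ] ℂ) := by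
      refine Submodule.topologicalClosure_minimal _ ?_ T'.isClosed_ker
      rw [Submodule.span_le]
      rintro _ ⟨n, rfl⟩
      have h2 := h (-n)
      unfold ccoef at h2
      rw [fourierCoeffOn_eq_integral, neg_neg, intervalIntegral_eq_muPer] at h2
      have h3 : (1 / (Real.pi - -Real.pi)) ≠ 0 := by
        have := Real.pi_pos
        rw [sub_neg_eq_add]
        positivity
      have h4 := (smul_eq_zero.1 h2).resolve_left h3
      simpa [T', T] using h4
    rw [span_fourier_closure_eq_top] at h1
    exact h1 (Submodule.mem_top (x := G))
  -- Test functions supported in the open interval vanish at both endpoints, so they descend to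
  -- continuous functions on the circle. The endpoint `π` is a null set.
  have hU : ∀ᵐ x ∂muPer, x ∈ Ioo (-Real.pi) Real.pi → f x = 0 := by
    refine isOpen_Ioo.ae_eq_zero_of_integral_contDiff_smul_eq_zero
      (hf.locallyIntegrable.locallyIntegrableOn _) fun g hg _ hgs => ?_
    have hz : ∀ x, x ∉ Ioo (-Real.pi) Real.pi → g x = 0 := fun x hx =>
      image_eq_zero_of_notMem_tsupport fun hx' => hx (hgs hx')
    have hgc : Continuous (AddCircle.liftIoc (Real.pi - -Real.pi) (-Real.pi)
        (fun x => (g x : ℂ))) := by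
      refine AddCircle.liftIoc_continuous ?_ ?_
      · rw [hz _ (by simp), hz _ (by simp)]
      · exact (Complex.continuous_ofReal.comp hg.continuous).continuousOn
    have := hker ⟨_, hgc⟩
    rw [← this]
    change _ = ∫ x, _ ∂muPer
    refine setIntegral_congr_fun measurableSet_Ioc fun x hx => ?_
    simp only [ContinuousMap.coe_mk]
    rw [AddCircle.liftIoc_coe_apply (by simpa using hx), Complex.real_smul]
  have hne : ∀ᵐ x ∂muPer, x ≠ Real.pi := by
    rw [ae_iff]; simp only [ne_eq, not_not, Set.ofPred_eq_eq_singleton]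
    exact nonpos_iff_eq_zero.1 ((Measure.restrict_apply_le _ _).trans (by simp))
  filter_upwards [hU, hne, ae_restrict_mem measurableSet_Ioc] with x h1 h2 h3
  exact h1 ⟨h3.1, lt_of_le_of_ne h3.2 h2⟩

lemma ccoef_add {f g : ℝ → ℂ} (hf : Integrable f muPer) (hg : Integrable g muPer) (n : ℤ) :
    ccoef (fun x => f x + g x) n = ccoef f n + ccoef g n := by
  have hi : ∀ {f : ℝ → ℂ}, Integrable f muPer →
      Integrable (fun x : ℝ => Complex.exp (-(n * x * Complex.I)) * f x) muPer := by
    intro f hf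
    refine hf.bdd_mul (c := 1) ?_ (Filter.Eventually.of_forall fun x => ?_)
    · exact (by fun_prop : Continuous fun x : ℝ =>
        Complex.exp (-(n * x * Complex.I))).aestronglyMeasurable
    · rw [show -((n : ℂ) * x * Complex.I) = ((-(n * x) : ℝ) : ℂ) * Complex.I by push_cast; ring,
        Complex.norm_exp_ofReal_mul_I]
  rw [ccoef_eq, ccoef_eq, ccoef_eq, ← mul_add, ← integral_add (hi hf) (hi hg)]
  simp only [mul_add]

lemma ccoef_const_mul (c : ℂ) (f : ℝ → ℂ) (n : ℤ) :
    ccoef (fun x => c * f x) n = c * ccoef f n :=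
  fourierCoeffOn.const_mul f c n _

lemma ccoef_congr {f g : ℝ → ℂ} (h : f =ᵐ[muPer] g) : ccoef f = ccoef g :=
  fourierCoeffOn_congr_ae (neg_lt_self Real.pi_pos) h

lemma coef_congr {u v : ℝ → ℝ} (h : u =ᵐ[muPer] v) : coef u = coef v := by
  rw [coef_eq_ccoef, coef_eq_ccoef]
  exact ccoef_congr (h.mono fun x hx => by simp [hx])

lemma coef_add {u v : ℝ → ℝ} (hu : Integrable u muPer) (hv : Integrable v muPer) (n : ℤ) :
    coef (fun x => u x + v x) n = coef u n + coef v n := by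
  simpa only [coef_eq_ccoef, Complex.ofReal_add] using
    ccoef_add (f := fun x => (u x : ℂ)) (g := fun x => (v x : ℂ)) hu.ofReal hv.ofReal n

lemma coef_const_mul (c : ℝ) (u : ℝ → ℝ) (n : ℤ) :
    coef (fun x => c * u x) n = c * coef u n := by
  simpa only [coef_eq_ccoef, Complex.ofReal_mul] using ccoef_const_mul c (fun x => (u x : ℂ)) n

lemma coef_sub {u v : ℝ → ℝ} (hu : Integrable u muPer) (hv : Integrable v muPer) (n : ℤ) :
    coef (fun x => u x - v x) n = coef u n - coef v n := by
  have h := coef_add hu (hv.const_mul (-1)) n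
  rw [coef_const_mul] at h
  rw [show (fun x => u x - v x) = fun x => u x + -1 * v x by funext x; ring, h]
  push_cast; ring

lemma coef_zero_eq (u : ℝ → ℝ) :
    coef u 0 = (((2 * Real.pi)⁻¹ * ∫ x in (-Real.pi)..Real.pi, u x : ℝ) : ℂ) := by
  rw [coef_eq_ccoef, ccoef_eq, intervalIntegral_eq_muPer]
  push_cast
  rw [← integral_complex_ofReal]
  simp

lemma ae_eq_of_coef_eq {u v : ℝ → ℝ} (hu : Integrable u muPer) (hv : Integrable v muPer)
    (h : coef u = coef v) : u =ᵐ[muPer] v := by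
  have h1 := ae_eq_zero_of_ccoef_eq_zero (f := fun x => ((u x - v x : ℝ) : ℂ)) (hu.sub hv).ofReal
    (fun n => by
      have := coef_sub hu hv n
      rw [h, sub_self] at this
      exact this)
  filter_upwards [h1] with x hx
  simp only [Pi.zero_apply, Complex.ofReal_eq_zero] at hx
  linarith

lemma ae_of_ae_muPer {p : ℝ → Prop} (hp : ∀ x, p (x + 2 * Real.pi) ↔ p x)
    (h : ∀ᵐ x ∂muPer, p x) : ∀ᵐ x : ℝ, p x := by
  rw [ae_restrict_iff' measurableSet_Ioc] at h
  have hz : ∀ (n : ℤ) x, p (x + n * (2 * Real.pi)) ↔ p x := by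
    intro n
    induction n using Int.induction_on with
    | zero => simp
    | succ k ih => intro x; rw [← ih x, ← hp (x + (k : ℤ) * _)]; push_cast; ring_nf
    | pred k ih => intro x; rw [← ih x, ← hp (x + ((-(k : ℤ) - 1 : ℤ) : ℝ) * _)]; push_cast; ring_nf
  have h2 : ∀ n : ℤ, ∀ᵐ x : ℝ, x + n * (2 * Real.pi) ∈ Ioc (-Real.pi) Real.pi → p x := by
    intro n
    have := (measurePreserving_add_right volume ((n : ℝ) * (2 * Real.pi))).quasiMeasurePreserving.ae h
    filter_upwards [this] with x hx hx'
    exact (hz n x).1 (hx hx')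
  filter_upwards [ae_all_iff.2 h2] with x hx
  obtain ⟨n, hn, -⟩ := existsUnique_add_zsmul_mem_Ioc Real.two_pi_pos x (-Real.pi)
  refine hx n ?_
  rwa [zsmul_eq_mul, show -Real.pi + 2 * Real.pi = Real.pi by ring] at hn

lemma MemL2per.integrable {u : ℝ → ℝ} (hu : MemL2per u) : Integrable u muPer :=
  hu.2.integrable (by norm_num)

lemma MemL2per.ofReal {u : ℝ → ℝ} (hu : MemL2per u) : MemLp (fun x => (u x : ℂ)) 2 muPer :=
  hu.2.ofReal

lemma MemL2per.ae_eq {u v : ℝ → ℝ} (hu : MemL2per u) (hv : MemL2per v) (h : coef u = coef v) :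
    ∀ᵐ x : ℝ, u x = v x :=
  ae_of_ae_muPer (fun x => by rw [hu.1, hv.1]) (ae_eq_of_coef_eq hu.integrable hv.integrable h)

lemma MemL2per.add {u v : ℝ → ℝ} (hu : MemL2per u) (hv : MemL2per v) :
    MemL2per fun x => u x + v x :=
  ⟨fun x => by simp only [hu.1 x, hv.1 x], hu.2.add hv.2⟩

lemma MemL2per.const_mul {u : ℝ → ℝ} (c : ℝ) (hu : MemL2per u) : MemL2per fun x => c * u x :=
  ⟨fun x => by simp only [hu.1 x], hu.2.const_mul c⟩

lemma MemL2per.of_continuous {u : ℝ → ℝ} (hp : Function.Periodic u (2 * Real.pi))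
    (hc : Continuous u) : MemL2per u := by
  refine ⟨hp, ?_⟩
  obtain ⟨C, hC⟩ := isCompact_Icc.exists_bound_of_continuousOn
    (s := Icc (-Real.pi) Real.pi) hc.continuousOn
  exact MemLp.of_bound hc.aestronglyMeasurable C ((ae_restrict_mem measurableSet_Ioc).mono
    fun x hx => hC x (Ioc_subset_Icc_self hx))

/-- Parseval's identity for real functions. -/
lemma hasSum_parseval {u v : ℝ → ℝ} (hu : MemLp u 2 muPer) (hv : MemLp v 2 muPer) :
    HasSum (fun n : ℤ => (coef u n * (starRingEnd ℂ) (coef v n)).re)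
      ((2 * Real.pi)⁻¹ * ∫ x in (-Real.pi)..Real.pi, u x * v x) := by
  have h := Complex.hasSum_re (hasSum_conj_mul (f := fun x => (v x : ℂ)) (g := fun x => (u x : ℂ))
    hv.ofReal hu.ofReal)
  rw [intervalIntegral_eq_muPer]
  convert h using 1
  · funext n; rw [mul_comm]; rfl
  · have : ∀ x, (starRingEnd ℂ) (v x : ℂ) * (u x : ℂ) = ((u x * v x : ℝ) : ℂ) := by
      intro x; rw [Complex.conj_ofReal]; push_cast; ring
    simp only [this]
    rw [integral_complex_ofReal]
    norm_cast


/-- Convolution of sequences on `ℤ`. -/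
def conv (f g : ℤ → ℂ) (n : ℤ) : ℂ := ∑' k, f k * g (n - k)

/-- The coefficients of a product of two square integrable functions. -/
lemma coef_mul {u v : ℝ → ℝ} (hu : MemLp u 2 muPer) (hv : MemLp v 2 muPer) (n : ℤ) :
    coef (fun x => u x * v x) n = conv (coef u) (coef v) n := by
  have hw : MemLp (fun x : ℝ => Complex.exp (-(n * x * Complex.I)) * (v x : ℂ)) 2 muPer := by
    have h1 : MemLp (fun x => (v x : ℂ)) 2 muPer := hv.ofReal
    refine h1.of_le ?_ (Filter.Eventually.of_forall fun x => ?_)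
    · exact (by fun_prop : Continuous fun x : ℝ =>
        Complex.exp (-(n * x * Complex.I))).aestronglyMeasurable.mul h1.1
    · rw [norm_mul, show -((n : ℂ) * x * Complex.I) = ((-(n * x) : ℝ) : ℂ) * Complex.I by
        push_cast; ring, Complex.norm_exp_ofReal_mul_I, one_mul]
  have h := hasSum_conj_mul (f := fun x => (u x : ℂ)) hu.ofReal hw
  have e1 : ∀ k : ℤ, ccoef (fun x : ℝ => Complex.exp (-(n * x * Complex.I)) * (v x : ℂ)) k
      = coef v (n + k) := by
    intro k
    rw [coef_eq_ccoef, ccoef_eq, ccoef_eq]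
    congr 1
    refine integral_congr_ae (Filter.Eventually.of_forall fun x => ?_)
    simp only
    rw [← mul_assoc, ← Complex.exp_add]
    push_cast
    ring_nf
  have e2 : ∀ k : ℤ, (starRingEnd ℂ) (ccoef (fun x => (u x : ℂ)) k) = coef u (-k) :=
    fun k => (coef_neg u k).symm
  simp only [e1, e2] at h
  rw [conv, ← (Equiv.neg ℤ).tsum_eq]
  -- The product coefficient is the pairing of `u` with `e^{-inx} v`, whose coefficients are those
  -- of `v` shifted by `n`; Parseval turns it into the convolution sum.
  simp only [Equiv.neg_apply, sub_neg_eq_add]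
  rw [h.tsum_eq, coef_eq_ccoef, ccoef_eq]
  congr 1
  refine integral_congr_ae (Filter.Eventually.of_forall fun x => ?_)
  simp only [Complex.conj_ofReal]
  push_cast
  ring

lemma MemL2per.summable {u : ℝ → ℝ} (hu : MemL2per u) : Summable fun n => ‖coef u n‖ ^ 2 :=
  (hasSum_sq_fourierCoeffOn (neg_lt_self Real.pi_pos) hu.ofReal).summable

/-- Every square summable Hermitian sequence is the coefficient sequence of a real function. -/
lemma exists_coef_eq {c : ℤ → ℂ} (hc : Summable fun n => ‖c n‖ ^ 2)
    (hneg : ∀ n, c (-n) = (starRingEnd ℂ) (c n)) : ∃ u, MemL2per u ∧ coef u = c := by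
  have hsum : Memℓp c 2 := by
    rw [memℓp_gen_iff (by norm_num)]
    simpa using hc
  set g : Lp ℂ 2 (@AddCircle.haarAddCircle (Real.pi - -Real.pi) factPeriod) :=
    fourierBasis.repr.symm ⟨c, hsum⟩ with hg
  have hgm : MemLp g 2 (@AddCircle.haarAddCircle (Real.pi - -Real.pi) factPeriod) := Lp.memLp g
  have hgL := memL2_iff_circle g hgm
  have hcc : ccoef (fun x : ℝ => g (x : AddCircle (Real.pi - -Real.pi))) = c := by
    funext n
    have : fourierCoeff g n = c n := by
      rw [← fourierBasis_repr, hg, LinearIsometryEquiv.apply_symm_apply]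
    rw [← this]
    unfold ccoef
    rw [fourierCoeffOn_eq_integral, fourierCoeff_eq_intervalIntegral _ _ (-Real.pi)]
    congr 2
    ring
  set G : ℝ → ℂ := fun x => g (x : AddCircle (Real.pi - -Real.pi)) with hG
  -- By Hermitian symmetry `G` and its conjugate have the same coefficients, so the real part of `G`
  -- keeps them.
  have hGc : ∀ n, ccoef (fun x => (starRingEnd ℂ) (G x)) n = c n := by
    intro n
    have e : c n = (starRingEnd ℂ) (ccoef G (-n)) := by rw [hcc, hneg, Complex.conj_conj]
    rw [e, ccoef_eq, ccoef_eq, map_mul, ← integral_conj]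
    congr 1
    · rw [map_inv₀, map_mul, Complex.conj_ofReal, map_ofNat]
    · refine integral_congr_ae (Filter.Eventually.of_forall fun x => ?_)
      simp [← Complex.exp_conj]
  have hGi : Integrable G muPer := hgL.integrable (by norm_num)
  have hGi' : Integrable (fun x => (starRingEnd ℂ) (G x)) muPer :=
    (LinearIsometryEquiv.integrable_comp_iff Complex.conjLIE).2 hGi
  refine ⟨fun x => (G x).re, ⟨?_, hgL.re⟩, ?_⟩
  · intro x
    have h : ((x + 2 * Real.pi : ℝ) : AddCircle (Real.pi - -Real.pi)) = x := by
      have h2 : (2 * Real.pi : ℝ) = Real.pi - -Real.pi := by ring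
      rw [h2, AddCircle.coe_add_period]
    simp only [hG, h]
  · funext n
    rw [coef_eq_ccoef]
    have hre : (fun x => ((G x).re : ℂ)) = fun x => (1 / 2 : ℂ) * (G x + (starRingEnd ℂ) (G x)) := by
      funext x
      rw [Complex.add_conj]
      push_cast
      ring
    rw [hre, ccoef_const_mul, ccoef_add hGi hGi', hGc, hcc]
    ring

/-! ### Square summable sequences and convolution estimates. -/

/-- Square summable sequences. -/
abbrev SqSummable (f : ℤ → ℂ) : Prop := Summable fun n => ‖f n‖ ^ 2

/-- The `ℓ²` norm. -/
def l2 (f : ℤ → ℂ) : ℝ := √(∑' n, ‖f n‖ ^ 2)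

lemma l2_nonneg (f : ℤ → ℂ) : 0 ≤ l2 f := Real.sqrt_nonneg _

lemma l2_sq (f : ℤ → ℂ) : l2 f ^ 2 = ∑' n, ‖f n‖ ^ 2 :=
  Real.sq_sqrt (tsum_nonneg fun _ => by positivity)

lemma summable_mul_of_sq {ι : Type*} {a b : ι → ℝ} (ha : Summable fun n => a n ^ 2)
    (hb : Summable fun n => b n ^ 2) : Summable fun n => a n * b n := by
  refine Summable.of_norm_bounded (ha.add hb) fun n => ?_
  rw [Real.norm_eq_abs, abs_le]
  constructor <;> nlinarith [sq_nonneg (a n + b n), sq_nonneg (a n - b n)]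

lemma tsum_mul_sq_le {ι : Type*} {a b : ι → ℝ} (ha : Summable fun n => a n ^ 2)
    (hb : Summable fun n => b n ^ 2) :
    (∑' n, a n * b n) ^ 2 ≤ (∑' n, a n ^ 2) * ∑' n, b n ^ 2 := by
  have h := summable_mul_of_sq ha hb
  refine le_of_tendsto_of_tendsto (h.hasSum.pow 2)
    (Filter.Tendsto.mul ha.hasSum hb.hasSum) (Filter.Eventually.of_forall fun s => ?_)
  exact Finset.sum_mul_sq_le_sq_mul_sq s a b

lemma SqSummable.summable_mul {f g : ℤ → ℂ} (hf : SqSummable f) (hg : SqSummable g) :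
    Summable fun k => ‖f k‖ * ‖g k‖ := summable_mul_of_sq hf hg

lemma tsum_norm_mul_le {f g : ℤ → ℂ} (hf : SqSummable f) (hg : SqSummable g) :
    ∑' k, ‖f k‖ * ‖g k‖ ≤ l2 f * l2 g := by
  refine abs_le_of_sq_le_sq' ?_ (mul_nonneg (l2_nonneg _) (l2_nonneg _)) |>.2
  rw [mul_pow, l2_sq, l2_sq]
  exact tsum_mul_sq_le hf hg

lemma SqSummable.reflect {g : ℤ → ℂ} (hg : SqSummable g) (n : ℤ) :
    SqSummable fun k => g (n - k) :=
  (Equiv.subLeft n).summable_iff.2 hg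

lemma l2_reflect (g : ℤ → ℂ) (n : ℤ) : l2 (fun k => g (n - k)) = l2 g := by
  unfold l2
  congr 1
  exact (Equiv.subLeft n).tsum_eq fun k => ‖g k‖ ^ 2

lemma norm_le_l2 {f : ℤ → ℂ} (hf : SqSummable f) (n : ℤ) : ‖f n‖ ≤ l2 f := by
  refine Real.le_sqrt_of_sq_le ?_
  exact hf.le_tsum n fun _ _ => by positivity

lemma SqSummable.summable_conv {f g : ℤ → ℂ} (hf : SqSummable f) (hg : SqSummable g) (n : ℤ) :
    Summable fun k => f k * g (n - k) := by
  refine Summable.of_norm ?_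
  simpa only [norm_mul] using hf.summable_mul (hg.reflect n)

lemma norm_conv_le {f g : ℤ → ℂ} (hf : SqSummable f) (hg : SqSummable g) (n : ℤ) :
    ‖conv f g n‖ ≤ l2 f * l2 g := by
  have h := tsum_norm_mul_le hf (hg.reflect n)
  rw [l2_reflect] at h
  refine le_trans ?_ h
  refine (norm_tsum_le_tsum_norm ?_).trans_eq (by simp only [norm_mul])
  simpa only [norm_mul] using hf.summable_mul (hg.reflect n)

lemma conv_comm (f g : ℤ → ℂ) (n : ℤ) : conv f g n = conv g f n := by
  unfold conv
  rw [← (Equiv.subLeft n).tsum_eq]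
  simp [mul_comm]

lemma SqSummable.add {f g : ℤ → ℂ} (hf : SqSummable f) (hg : SqSummable g) :
    SqSummable fun n => f n + g n := by
  refine Summable.of_nonneg_of_le (fun n => by positivity) (fun n => ?_)
    ((Summable.add hf hg).mul_left 2)
  have := norm_add_le (f n) (g n)
  nlinarith [sq_nonneg (‖f n‖ - ‖g n‖), norm_nonneg (f n + g n)]

lemma SqSummable.const_mul {f : ℤ → ℂ} (hf : SqSummable f) (c : ℂ) :
    SqSummable fun n => c * f n := by
  simpa only [SqSummable, norm_mul, mul_pow] using Summable.mul_left (‖c‖ ^ 2) hf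

lemma SqSummable.sub {f g : ℤ → ℂ} (hf : SqSummable f) (hg : SqSummable g) :
    SqSummable fun n => f n - g n := by
  simpa [sub_eq_add_neg] using hf.add (hg.const_mul (-1))

lemma l2_conj (f : ℤ → ℂ) : l2 (fun n => (starRingEnd ℂ) (f n)) = l2 f := by
  simp [l2]

lemma conv_add_left {f g h : ℤ → ℂ} (hf : SqSummable f) (hg : SqSummable g) (hh : SqSummable h)
    (n : ℤ) : conv (fun k => f k + g k) h n = conv f h n + conv g h n := by
  unfold conv
  rw [← (hf.summable_conv hh n).tsum_add (hg.summable_conv hh n)]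
  simp only [add_mul]

lemma conv_add_right {f g h : ℤ → ℂ} (hf : SqSummable f) (hg : SqSummable g) (hh : SqSummable h)
    (n : ℤ) : conv h (fun k => f k + g k) n = conv h f n + conv h g n := by
  rw [conv_comm, conv_add_left hf hg hh, conv_comm f, conv_comm g]

lemma conv_const_mul_left (c : ℂ) (f g : ℤ → ℂ) (n : ℤ) :
    conv (fun k => c * f k) g n = c * conv f g n := by
  unfold conv
  rw [← tsum_mul_left]
  simp only [mul_assoc]

lemma conv_const_mul_right (c : ℂ) (f g : ℤ → ℂ) (n : ℤ) :
    conv f (fun k => c * g k) n = c * conv f g n := by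
  rw [conv_comm, conv_const_mul_left, conv_comm]

lemma conv_conj (f g : ℤ → ℂ) (n : ℤ) :
    conv (fun k => (starRingEnd ℂ) (f k)) (fun k => (starRingEnd ℂ) (g k)) n
      = (starRingEnd ℂ) (conv f g n) := by
  unfold conv
  rw [Complex.conj_tsum]
  simp

lemma conv_self_sub {f g : ℤ → ℂ} (hf : SqSummable f) (hg : SqSummable g) (n : ℤ) :
    conv f f n - conv g g n = conv (fun k => f k - g k) f n + conv g (fun k => f k - g k) n := by
  have hd := hf.sub hg
  have h1 := conv_add_left hd hg hf n
  have h2 := conv_add_right hd hg hg n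
  simp only [sub_add_cancel] at h1 h2
  rw [h1, h2]; ring

lemma norm_conv_self_sub_le {f g : ℤ → ℂ} (hf : SqSummable f) (hg : SqSummable g) (n : ℤ) :
    ‖conv f f n - conv g g n‖ ≤ l2 (fun k => f k - g k) * (l2 f + l2 g) := by
  rw [conv_self_sub hf hg, mul_add, mul_comm (l2 fun k => f k - g k) (l2 g)]
  exact (norm_add_le _ _).trans (add_le_add (norm_conv_le (hf.sub hg) hf n)
    (norm_conv_le hg (hf.sub hg) n))

lemma sqSummable_of_le {f : ℤ → ℂ} {w : ℤ → ℝ} {M : ℝ} (hw : Summable fun n => w n ^ 2)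
    (h : ∀ n, ‖f n‖ ≤ M * w n) : SqSummable f := by
  refine Summable.of_nonneg_of_le (fun n => by positivity) (fun n => ?_) (hw.mul_left (M ^ 2))
  rw [← mul_pow]
  exact pow_le_pow_left₀ (norm_nonneg _) (h n) 2

lemma l2_le_of_le {f : ℤ → ℂ} {w : ℤ → ℝ} {M : ℝ} (hM : 0 ≤ M) (hw : Summable fun n => w n ^ 2)
    (h : ∀ n, ‖f n‖ ≤ M * w n) : l2 f ≤ M * √(∑' n, w n ^ 2) := by
  rw [l2, ← Real.sqrt_sq hM, ← Real.sqrt_mul (sq_nonneg M), ← tsum_mul_left]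
  refine Real.sqrt_le_sqrt ?_
  refine (sqSummable_of_le hw h).tsum_le_tsum (fun n => ?_) (hw.mul_left (M ^ 2))
  rw [← mul_pow]
  exact pow_le_pow_left₀ (norm_nonneg _) (h n) 2

lemma l2_le_mul {f g : ℤ → ℂ} (hg : SqSummable g) {M : ℝ} (hM : 0 ≤ M)
    (h : ∀ n, ‖f n‖ ≤ M * ‖g n‖) : l2 f ≤ M * l2 g :=
  l2_le_of_le hM hg h

/-! ### The `H^{α/2}` weight, the square map into `L²`, and the cubic functional. -/

/-- Products of functions with weighted square summable coefficients. -/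
lemma conv_weighted {w : ℤ → ℝ} (hw : ∀ n, 0 < w n) (hs : Summable fun n => (w n)⁻¹ ^ 2)
    {f g : ℤ → ℂ} (hf : Summable fun n => w n * ‖f n‖ ^ 2)
    (hg : Summable fun n => w n * ‖g n‖ ^ 2) :
    SqSummable (conv f g) ∧ ∑' n, ‖conv f g n‖ ^ 2 ≤
      (∑' n, (w n)⁻¹ ^ 2) * ((∑' n, w n * ‖f n‖ ^ 2) * ∑' n, w n * ‖g n‖ ^ 2) := by
  set A : ℤ → ℝ := fun n => w n * ‖f n‖ ^ 2 with hA
  set B : ℤ → ℝ := fun n => w n * ‖g n‖ ^ 2 with hB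
  have hA0 : ∀ n, 0 ≤ A n := fun n => mul_nonneg (hw n).le (by positivity)
  have hB0 : ∀ n, 0 ≤ B n := fun n => mul_nonneg (hw n).le (by positivity)
  have hAB : Summable fun p : ℤ × ℤ => A p.1 * B p.2 := hf.mul_of_nonneg hg hA0 hB0
  let e : ℤ × ℤ ≃ ℤ × ℤ :=
    { toFun := fun p => (p.2, p.1 - p.2)
      invFun := fun q => (q.1 + q.2, q.1)
      left_inv := fun p => by simp
      right_inv := fun q => by simp }
  have hAB' : Summable fun p : ℤ × ℤ => A p.2 * B (p.1 - p.2) := e.summable_iff.2 hAB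
  have hfib : ∀ n, Summable fun k => A k * B (n - k) := fun n => hAB'.prod_factor n
  have hsum : Summable fun n => ∑' k, A k * B (n - k) := hAB'.prod
  have htot : ∑' n, ∑' k, A k * B (n - k) = (∑' n, A n) * ∑' n, B n := by
    rw [hf.tsum_mul_tsum hg hAB, ← hAB'.tsum_prod]
    exact e.tsum_eq fun p : ℤ × ℤ => A p.1 * B p.2
  -- Cauchy-Schwarz after inserting `√(w k * w (n - k))` and its inverse. The inverse weights form a
  -- convolution bounded uniformly in `n` by a second Cauchy-Schwarz; the other factor sums over `n`
  -- to the product of the two weighted norms.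
  have hpt : ∀ n, ‖conv f g n‖ ^ 2 ≤ (∑' n, (w n)⁻¹ ^ 2) * ∑' k, A k * B (n - k) := by
    intro n
    have hsn : Summable fun k => (w (n - k))⁻¹ ^ 2 := ((Equiv.subLeft n).summable_iff (f := fun k => (w k)⁻¹ ^ 2)).2 hs
    have hr : Summable fun k => √((w k)⁻¹ * (w (n - k))⁻¹) ^ 2 := by
      refine (summable_mul_of_sq hs hsn).congr fun k => ?_
      rw [Real.sq_sqrt (mul_nonneg (inv_nonneg.2 (hw _).le) (inv_nonneg.2 (hw _).le))]
    have hl : Summable fun k => √(A k * B (n - k)) ^ 2 := by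
      refine (hfib n).congr fun k => ?_
      rw [Real.sq_sqrt (mul_nonneg (hA0 _) (hB0 _))]
    have hprod : ∀ k, √(A k * B (n - k)) * √((w k)⁻¹ * (w (n - k))⁻¹) = ‖f k * g (n - k)‖ := by
      intro k
      have h1 := (hw k).ne'
      have h2 := (hw (n - k)).ne'
      rw [← Real.sqrt_mul (mul_nonneg (hA0 _) (hB0 _)), norm_mul]
      refine Real.sqrt_eq_iff_mul_self_eq (mul_nonneg (mul_nonneg (hA0 _) (hB0 _))
        (mul_nonneg (inv_nonneg.2 (hw _).le) (inv_nonneg.2 (hw _).le))) (by positivity) |>.2 ?_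
      simp only [hA, hB]
      field_simp
    have hsm : Summable fun k => ‖f k * g (n - k)‖ :=
      (summable_mul_of_sq hl hr).congr hprod
    have h1 : ‖conv f g n‖ ^ 2 ≤ (∑' k, ‖f k * g (n - k)‖) ^ 2 :=
      pow_le_pow_left₀ (norm_nonneg _) (norm_tsum_le_tsum_norm hsm) 2
    have h2 := tsum_mul_sq_le hl hr
    simp only [hprod] at h2
    refine h1.trans (h2.trans ?_)
    rw [mul_comm]
    have h3 : ∑' k, √((w k)⁻¹ * (w (n - k))⁻¹) ^ 2 ≤ ∑' n, (w n)⁻¹ ^ 2 := by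
      have h4 : ∑' k, √((w k)⁻¹ * (w (n - k))⁻¹) ^ 2 = ∑' k, (w k)⁻¹ * (w (n - k))⁻¹ := by
        refine tsum_congr fun k => ?_
        rw [Real.sq_sqrt (mul_nonneg (inv_nonneg.2 (hw _).le) (inv_nonneg.2 (hw _).le))]
      rw [h4]
      have h5 := tsum_mul_sq_le hs hsn
      have h7 : ∑' k, (w (n - k))⁻¹ ^ 2 = ∑' k, (w k)⁻¹ ^ 2 :=
        (Equiv.subLeft n).tsum_eq fun k => (w k)⁻¹ ^ 2
      rw [h7, ← sq] at h5
      exact (abs_le_of_sq_le_sq' h5 (tsum_nonneg fun _ => by positivity)).2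
    have h6 : ∑' k, √(A k * B (n - k)) ^ 2 = ∑' k, A k * B (n - k) := by
      refine tsum_congr fun k => ?_
      rw [Real.sq_sqrt (mul_nonneg (hA0 _) (hB0 _))]
    rw [h6]
    exact mul_le_mul_of_nonneg_right h3 (tsum_nonneg fun k => mul_nonneg (hA0 _) (hB0 _))
  have hS : SqSummable (conv f g) :=
    Summable.of_nonneg_of_le (fun n => by positivity) hpt (hsum.mul_left _)
  refine ⟨hS, ?_⟩
  rw [← htot, ← tsum_mul_left]
  exact hS.tsum_le_tsum hpt (hsum.mul_left _)

/-- The weight of `H^{α/2}`. -/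
def wt (α : ℝ) (n : ℤ) : ℝ := (1 + (n : ℝ) ^ 2) ^ (α / 2)

lemma wt_pos (α : ℝ) (n : ℤ) : 0 < wt α n := Real.rpow_pos_of_pos (by positivity) _

lemma one_le_wt {α : ℝ} (hα : 0 ≤ α) (n : ℤ) : 1 ≤ wt α n :=
  Real.one_le_rpow (by nlinarith [sq_nonneg (n : ℝ)]) (by linarith)

lemma abs_rpow_le_wt {α : ℝ} (hα : 0 ≤ α) (n : ℤ) : |(n : ℝ)| ^ α ≤ wt α n := by
  have h : |(n : ℝ)| ^ α = ((n : ℝ) ^ 2) ^ (α / 2) := by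
    rw [← sq_abs, ← Real.rpow_natCast, ← Real.rpow_mul (abs_nonneg _)]
    congr 1; push_cast; ring
  rw [h]
  exact Real.rpow_le_rpow (sq_nonneg _) (by linarith) (by linarith)

lemma wt_le {α : ℝ} (hα : 0 ≤ α) {n : ℤ} (hn : n ≠ 0) :
    wt α n ≤ 2 ^ (α / 2) * |(n : ℝ)| ^ α := by
  have h : |(n : ℝ)| ^ α = ((n : ℝ) ^ 2) ^ (α / 2) := by
    rw [← sq_abs, ← Real.rpow_natCast, ← Real.rpow_mul (abs_nonneg _)]
    congr 1; push_cast; ring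
  rw [h, ← Real.mul_rpow (by norm_num) (sq_nonneg _)]
  refine Real.rpow_le_rpow (by positivity) ?_ (by linarith)
  have : (1 : ℝ) ≤ (n : ℝ) ^ 2 := by
    have : 0 < n ^ 2 := by positivity
    exact_mod_cast this
  linarith

lemma summable_abs_rpow_sq {β : ℝ} (hβ : 1 / 2 < β) :
    Summable fun n : ℤ => (|(n : ℝ)| ^ (-β)) ^ 2 := by
  refine (Real.summable_abs_int_rpow (b := 2 * β) (by linarith)).congr fun n => ?_
  rw [← Real.rpow_natCast, ← Real.rpow_mul (abs_nonneg _)]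
  congr 1; push_cast; ring

lemma one_le_abs_cast {n : ℤ} (hn : n ≠ 0) : (1 : ℝ) ≤ |(n : ℝ)| := by
  rw [← Int.cast_abs]
  exact_mod_cast Int.one_le_abs hn

/-- The terms decay like `|n|^{-2α}`; this is where the threshold `α > 1/2` comes from. -/
lemma summable_inv_wt {α : ℝ} (hα : 1 / 2 < α) : Summable fun n => (wt α n)⁻¹ ^ 2 := by
  have h0 : Summable fun n : ℤ => if n = 0 then (1 : ℝ) else 0 :=
    (hasSum_ite_eq (0 : ℤ) (1 : ℝ)).summable
  refine Summable.of_nonneg_of_le (fun n => by positivity) (fun n => ?_)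
    ((summable_abs_rpow_sq hα).add h0)
  by_cases hn : n = 0
  · subst hn
    have : wt α 0 = 1 := by simp [wt]
    rw [this]; simp; positivity
  · simp only [hn, if_false, add_zero]
    rw [Real.rpow_neg (abs_nonneg _)]
    have h1 : 0 < |(n : ℝ)| ^ α := Real.rpow_pos_of_pos (by linarith [one_le_abs_cast hn]) _
    have := abs_rpow_le_wt (by linarith : 0 ≤ α) n
    have h2 := inv_nonneg.2 (wt_pos α n).le
    gcongr

lemma MemHper.conv_summable {α : ℝ} (hα : 1 / 2 < α) {u : ℝ → ℝ} (hu : MemHper (α / 2) u) :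
    SqSummable (conv (coef u) (coef u)) :=
  (conv_weighted (wt_pos α) (summable_inv_wt hα) hu.2 hu.2).1

lemma conv_neg {f : ℤ → ℂ} (hf : ∀ n, f (-n) = (starRingEnd ℂ) (f n)) (n : ℤ) :
    conv f f (-n) = (starRingEnd ℂ) (conv f f n) := by
  unfold conv
  rw [Complex.conj_tsum, ← (Equiv.neg ℤ).tsum_eq]
  refine tsum_congr fun k => ?_
  rw [map_mul, ← hf, ← hf]
  simp only [Equiv.neg_apply]
  ring_nf

/-- The Sobolev embedding into `L⁴`: the self-convolution of the coefficients is square summable, so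
it belongs to some `L²` function, which equals the merely integrable `u²` by uniqueness of
coefficients. -/
lemma MemHper.sq_memLp {α : ℝ} (hα : 1 / 2 < α) {u : ℝ → ℝ} (hu : MemHper (α / 2) u) :
    MemLp (fun x => u x ^ 2) 2 muPer := by
  obtain ⟨g, hg, hgc⟩ := exists_coef_eq (hu.conv_summable hα) (conv_neg (coef_neg u))
  have h1 : Integrable (fun x => u x * u x) muPer := hu.1.2.integrable_mul hu.1.2
  have h2 : (fun x => u x * u x) =ᵐ[muPer] g := by
    refine ae_eq_of_coef_eq h1 hg.integrable ?_
    rw [hgc]; funext n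
    exact coef_mul hu.1.2 hu.1.2 n
  have h3 : (fun x => u x ^ 2) =ᵐ[muPer] g := by simpa only [sq] using h2
  exact hg.2.ae_eq h3.symm

/-- The cubic functional on sequences. -/
def cubeSeq (f : ℤ → ℂ) : ℝ := 2 * Real.pi * ∑' n, (conv f f n * (starRingEnd ℂ) (f n)).re

/-- The quadratic functional on sequences. -/
def quadSeq (α c : ℝ) (f : ℤ → ℂ) : ℝ := ∑' n : ℤ, (|(n : ℝ)| ^ α + c) * ‖f n‖ ^ 2

lemma coef_sq {u : ℝ → ℝ} (hu : MemLp u 2 muPer) (n : ℤ) :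
    coef (fun x => u x ^ 2) n = conv (coef u) (coef u) n := by
  simpa only [sq] using coef_mul hu hu n

lemma integral_cube {α : ℝ} (hα : 1 / 2 < α) {u : ℝ → ℝ} (hu : MemHper (α / 2) u) :
    ∫ x in (-Real.pi)..Real.pi, u x ^ 3 = cubeSeq (coef u) := by
  have h := (hasSum_parseval (hu.sq_memLp hα) hu.1.2).tsum_eq
  simp only [coef_sq hu.1.2] at h
  rw [cubeSeq, h, ← mul_assoc, mul_inv_cancel₀ (by have := Real.pi_pos; positivity), one_mul]
  rfl

lemma integral_sq {u : ℝ → ℝ} (hu : MemLp u 2 muPer) :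
    ∫ x, u x ^ 2 ∂muPer = 2 * Real.pi * ∑' n, ‖coef u n‖ ^ 2 := by
  have h := (hasSum_parseval hu hu).tsum_eq
  have e : ∀ n, (coef u n * (starRingEnd ℂ) (coef u n)).re = ‖coef u n‖ ^ 2 := by
    intro n
    rw [Complex.mul_conj, Complex.ofReal_re, Complex.normSq_eq_norm_sq]
  simp only [e] at h
  rw [h, ← mul_assoc, mul_inv_cancel₀ (by have := Real.pi_pos; positivity), one_mul,
    intervalIntegral_eq_muPer]
  congr 1; funext x; ring

lemma summable_quad {α c : ℝ} (hα : 0 ≤ α) {f : ℤ → ℂ}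
    (hf : Summable fun n => wt α n * ‖f n‖ ^ 2) :
    Summable fun n : ℤ => (|(n : ℝ)| ^ α + c) * ‖f n‖ ^ 2 := by
  have h1 : Summable fun n : ℤ => |(n : ℝ)| ^ α * ‖f n‖ ^ 2 :=
    Summable.of_nonneg_of_le (fun n => by positivity)
      (fun n => mul_le_mul_of_nonneg_right (abs_rpow_le_wt hα n) (by positivity)) hf
  have h2 : Summable fun n : ℤ => ‖f n‖ ^ 2 :=
    Summable.of_nonneg_of_le (fun n => by positivity)
      (fun n => by nlinarith [one_le_wt hα n, sq_nonneg ‖f n‖]) hf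
  simpa only [add_mul] using h1.add (h2.mul_left c)

lemma quadForm_eq {α c : ℝ} (hα : 0 ≤ α) {u : ℝ → ℝ} (hu : MemHper (α / 2) u) :
    quadForm α c u = Real.pi * quadSeq α c (coef u) := by
  obtain ⟨hd, hdc⟩ := fracDeriv_spec (s := α / 2) (by linarith) hu
  unfold quadForm
  rw [intervalIntegral_eq_muPer, integral_add hd.2.integrable_sq (hu.1.2.integrable_sq.const_mul c),
    integral_const_mul, integral_sq hd.2, integral_sq hu.1.2]
  have h1 : ∀ n, ‖coef (fracDeriv (α / 2) u) n‖ ^ 2 = |(n : ℝ)| ^ α * ‖coef u n‖ ^ 2 := by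
    intro n
    rw [hdc, norm_mul, mul_pow, Complex.norm_real, Real.norm_eq_abs, sq_abs, ← Real.rpow_natCast,
      ← Real.rpow_mul (abs_nonneg _)]
    congr 2; push_cast; ring
  have h2 := hd.summable
  simp only [h1] at h2 ⊢
  rw [quadSeq]
  simp only [add_mul]
  rw [h2.tsum_add (hu.1.summable.mul_left c), tsum_mul_left]
  ring

lemma MemHper.add {s : ℝ} {u v : ℝ → ℝ} (hu : MemHper s u) (hv : MemHper s v) :
    MemHper s fun x => u x + v x := by
  refine ⟨hu.1.add hv.1, ?_⟩
  refine Summable.of_nonneg_of_le (fun n => by positivity) (fun n => ?_)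
    ((hu.2.add hv.2).mul_left 2)
  rw [coef_add hu.1.integrable hv.1.integrable, ← mul_add, mul_left_comm]
  gcongr
  have := norm_add_le (coef u n) (coef v n)
  nlinarith [sq_nonneg (‖coef u n‖ - ‖coef v n‖), norm_nonneg (coef u n + coef v n)]

lemma MemHper.const_mul {s : ℝ} {u : ℝ → ℝ} (c : ℝ) (hu : MemHper s u) :
    MemHper s fun x => c * u x := by
  refine ⟨hu.1.const_mul c, ?_⟩
  refine (hu.2.mul_left (c ^ 2)).congr fun n => ?_
  rw [coef_const_mul, norm_mul, Complex.norm_real, mul_pow, Real.norm_eq_abs, sq_abs]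
  ring

lemma integrable_mul_sq {α : ℝ} (hα : 1 / 2 < α) {u v : ℝ → ℝ} (hu : MemHper (α / 2) u)
    (hv : MemHper (α / 2) v) : Integrable (fun x => u x ^ 2 * v x) muPer :=
  (hu.sq_memLp hα).integrable_mul hv.1.2

/-- The cubic functional is continuous in `L²` on bounded sets of `H^{α/2}`. -/
lemma abs_cube_sub_le {α : ℝ} (hα : 1 / 2 < α) {u v : ℝ → ℝ} (hu : MemHper (α / 2) u)
    (hv : MemHper (α / 2) v) {e : ℝ} (he : 0 < e) :
    |(∫ x in (-Real.pi)..Real.pi, u x ^ 3) - ∫ x in (-Real.pi)..Real.pi, v x ^ 3| ≤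
      e⁻¹ * (2 * Real.pi * ∑' n, ‖coef u n - coef v n‖ ^ 2)
      + 5 * e * (2 * Real.pi * ((∑' n, (wt α n)⁻¹ ^ 2) *
        ((∑' n, wt α n * ‖coef u n‖ ^ 2) ^ 2 + (∑' n, wt α n * ‖coef v n‖ ^ 2) ^ 2))) := by
  have hu2 := hu.sq_memLp hα
  have hv2 := hv.sq_memLp hα
  have hd : MemLp (fun x => u x - v x) 2 muPer := hu.1.2.sub hv.1.2
  have hu3 : Integrable (fun x => u x ^ 3) muPer := by
    simpa only [← pow_succ] using integrable_mul_sq hα hu hu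
  have hv3 : Integrable (fun x => v x ^ 3) muPer := by
    simpa only [← pow_succ] using integrable_mul_sq hα hv hv
  have h4 : ∀ {u : ℝ → ℝ}, MemHper (α / 2) u → ∫ x, (u x ^ 2) ^ 2 ∂muPer ≤
      2 * Real.pi * ((∑' n, (wt α n)⁻¹ ^ 2) * (∑' n, wt α n * ‖coef u n‖ ^ 2) ^ 2) := by
    intro u hu
    rw [integral_sq (hu.sq_memLp hα)]
    simp only [coef_sq hu.1.2]
    have := (conv_weighted (wt_pos α) (summable_inv_wt hα) hu.2 hu.2).2
    have hp := Real.pi_pos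
    rw [sq (∑' n, wt α n * ‖coef u n‖ ^ 2)]
    gcongr
  have hdc : ∫ x, (u x - v x) ^ 2 ∂muPer = 2 * Real.pi * ∑' n, ‖coef u n - coef v n‖ ^ 2 := by
    rw [integral_sq hd]
    simp only [coef_sub hu.1.integrable hv.1.integrable]
  rw [intervalIntegral_eq_muPer, intervalIntegral_eq_muPer, ← integral_sub hu3 hv3]
  have hi : Integrable (fun x => (u x ^ 2) ^ 2 + (v x ^ 2) ^ 2) muPer :=
    hu2.integrable_sq.add hv2.integrable_sq
  have hint := (hd.integrable_sq.const_mul e⁻¹).add (hi.const_mul (5 * e))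
  calc |∫ x, (u x ^ 3 - v x ^ 3) ∂muPer|
      ≤ ∫ x, |u x ^ 3 - v x ^ 3| ∂muPer := abs_integral_le_integral_abs
    _ ≤ ∫ x, (e⁻¹ * (u x - v x) ^ 2 + 5 * e * ((u x ^ 2) ^ 2 + (v x ^ 2) ^ 2)) ∂muPer := by
        refine integral_mono (hu3.sub hv3).abs hint fun x => ?_
        simp only
        set d := u x - v x
        -- Factor `u³ - v³ = d p` and split the product with the free parameter `e`: the factor `d`
        -- is measured in `L²`, while `p` needs only the `L⁴` bounds.
        set p := u x ^ 2 + u x * v x + v x ^ 2 with hp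
        have h1 : u x ^ 3 - v x ^ 3 = d * p := by simp only [d, hp]; ring
        have h2 : p ^ 2 ≤ 5 * ((u x ^ 2) ^ 2 + (v x ^ 2) ^ 2) := by
          have hp0 : p ≤ 3 / 2 * (u x ^ 2 + v x ^ 2) := by
            simp only [hp]; nlinarith [sq_nonneg (u x - v x)]
          have hp1 : 0 ≤ p := by
            simp only [hp]; nlinarith [sq_nonneg (u x + v x), sq_nonneg (u x), sq_nonneg (v x)]
          nlinarith [sq_nonneg (u x ^ 2 - v x ^ 2)]
        have h3 : |d * p| ≤ e⁻¹ * d ^ 2 + e * p ^ 2 := by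
          have hab : ∀ t : ℝ, t ^ 2 = (d * p) ^ 2 → t ≤ e⁻¹ * d ^ 2 + e * p ^ 2 := by
            intro t ht
            refine (abs_le_of_sq_le_sq' ?_ (by positivity)).2
            rw [ht]
            have : (e⁻¹ * d ^ 2 + e * p ^ 2) ^ 2
                = (e⁻¹ * d ^ 2 - e * p ^ 2) ^ 2 + 4 * (d * p) ^ 2 := by field_simp; ring
            rw [this]
            nlinarith [sq_nonneg (e⁻¹ * d ^ 2 - e * p ^ 2), sq_nonneg (d * p)]
          exact hab _ (sq_abs _)
        rw [h1]
        nlinarith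
    _ = e⁻¹ * ∫ x, (u x - v x) ^ 2 ∂muPer
        + 5 * e * (∫ x, (u x ^ 2) ^ 2 ∂muPer + ∫ x, (v x ^ 2) ^ 2 ∂muPer) := by
        rw [integral_add (hd.integrable_sq.const_mul e⁻¹) (hi.const_mul (5 * e)),
          integral_const_mul, integral_const_mul,
          integral_add hu2.integrable_sq hv2.integrable_sq]
    _ ≤ _ := by
        rw [hdc]
        have := add_le_add (h4 hu) (h4 hv)
        rw [← mul_add, ← mul_add] at this
        gcongr

/-! ### Compactness of the energy ball and existence of ground states. -/

/-- Hermitian mean-zero sequences with quadratic form at most `1`. -/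
def admSet (α c : ℝ) : Set (ℤ → ℂ) :=
  {f | (∀ n, f (-n) = (starRingEnd ℂ) (f n)) ∧ f 0 = 0 ∧
    ∀ s : Finset ℤ, ∑ n ∈ s, (|(n : ℝ)| ^ α + c) * ‖f n‖ ^ 2 ≤ 1}

lemma abs_rpow_le_symbol {α c : ℝ} (hα : 0 ≤ α) (hc : c ≤ 0) {n : ℤ} (hn : n ≠ 0) :
    (1 + c) * |(n : ℝ)| ^ α ≤ |(n : ℝ)| ^ α + c := by
  have : 1 ≤ |(n : ℝ)| ^ α := Real.one_le_rpow (one_le_abs_cast hn) hα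
  nlinarith

lemma symbol_pos {α c : ℝ} (hα : 0 ≤ α) (hc1 : -1 < c) {n : ℤ} (hn : n ≠ 0) :
    0 < |(n : ℝ)| ^ α + c := by
  have : 1 ≤ |(n : ℝ)| ^ α := Real.one_le_rpow (one_le_abs_cast hn) hα
  linarith

lemma symbol_mul_nonneg {α c : ℝ} (hα : 0 ≤ α) (hc1 : -1 < c) {f : ℤ → ℂ} (h0 : f 0 = 0) (n : ℤ) :
    0 ≤ (|(n : ℝ)| ^ α + c) * ‖f n‖ ^ 2 := by
  by_cases hn : n = 0
  · subst hn; simp [h0]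
  · exact mul_nonneg (symbol_pos hα hc1 hn).le (by positivity)

lemma wt_mul_le {α c : ℝ} (hα : 0 ≤ α) (hc1 : -1 < c) (hc : c ≤ 0) {f : ℤ → ℂ} (h0 : f 0 = 0)
    (n : ℤ) : wt α n * ‖f n‖ ^ 2 ≤
      2 ^ (α / 2) * (1 + c)⁻¹ * ((|(n : ℝ)| ^ α + c) * ‖f n‖ ^ 2) := by
  by_cases hn : n = 0
  · subst hn; simp [h0]
  · have h1 := wt_le hα hn
    have h2 := abs_rpow_le_symbol hα hc hn
    have h3 : |(n : ℝ)| ^ α ≤ (1 + c)⁻¹ * (|(n : ℝ)| ^ α + c) := by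
      rw [inv_mul_eq_div, le_div_iff₀ (by linarith)]; linarith
    rw [← mul_assoc]
    refine mul_le_mul_of_nonneg_right (h1.trans ?_) (by positivity)
    rw [mul_assoc]
    exact mul_le_mul_of_nonneg_left h3 (by positivity)

lemma admSet_bounds {α c : ℝ} (hα : 0 ≤ α) (hc1 : -1 < c) (hc : c ≤ 0) {f : ℤ → ℂ}
    (hf : f ∈ admSet α c) : (Summable fun n => wt α n * ‖f n‖ ^ 2) ∧
      ∑' n, wt α n * ‖f n‖ ^ 2 ≤ 2 ^ (α / 2) * (1 + c)⁻¹ ∧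
      (Summable fun n : ℤ => (|(n : ℝ)| ^ α + c) * ‖f n‖ ^ 2) ∧ quadSeq α c f ≤ 1 := by
  obtain ⟨-, h0, hs⟩ := hf
  have h1 : Summable fun n : ℤ => (|(n : ℝ)| ^ α + c) * ‖f n‖ ^ 2 :=
    summable_of_sum_le (symbol_mul_nonneg hα hc1 h0) hs
  have h2 : quadSeq α c f ≤ 1 := h1.tsum_le_of_sum_le hs
  have h3 : Summable fun n => wt α n * ‖f n‖ ^ 2 :=
    Summable.of_nonneg_of_le (fun n => mul_nonneg (wt_pos α n).le (by positivity))
      (wt_mul_le hα hc1 hc h0) (h1.mul_left _)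
  refine ⟨h3, ?_, h1, h2⟩
  refine (h3.tsum_le_tsum (wt_mul_le hα hc1 hc h0) (h1.mul_left _)).trans ?_
  rw [tsum_mul_left]
  have : 0 ≤ 2 ^ (α / 2) * (1 + c)⁻¹ :=
    mul_nonneg (by positivity) (inv_nonneg.2 (by linarith))
  exact (mul_le_mul_of_nonneg_left h2 this).trans_eq (mul_one _)

lemma mem_admSet {α c : ℝ} (hα : 0 ≤ α) (hc1 : -1 < c) {f : ℤ → ℂ}
    (hh : ∀ n, f (-n) = (starRingEnd ℂ) (f n)) (h0 : f 0 = 0)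
    (hw : Summable fun n => wt α n * ‖f n‖ ^ 2) (hq : quadSeq α c f ≤ 1) : f ∈ admSet α c :=
  ⟨hh, h0, fun s => ((summable_quad hα hw).sum_le_tsum s
    fun n _ => symbol_mul_nonneg hα hc1 h0 n).trans hq⟩

/-- Tychonoff: each coordinate is bounded by the energy, and an energy bound stated on finite
partial sums is a closed condition for pointwise convergence. -/
lemma isCompact_admSet {α c : ℝ} (hα : 0 ≤ α) (hc1 : -1 < c) : IsCompact (admSet α c) := by
  have hsub : admSet α c ⊆ Set.pi univ fun n : ℤ =>
      Metric.closedBall (0 : ℂ) (√((|(n : ℝ)| ^ α + c)⁻¹)) := by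
    intro f hf n _
    rw [mem_closedBall_zero_iff]
    by_cases hn : n = 0
    · subst hn; rw [hf.2.1]; simp
    · have h := hf.2.2 {n}
      rw [Finset.sum_singleton] at h
      refine Real.le_sqrt_of_sq_le ?_
      have hp := symbol_pos hα hc1 hn
      rw [← one_div, le_div_iff₀ hp]
      linarith
  refine (isCompact_univ_pi fun n => isCompact_closedBall _ _).of_isClosed_subset ?_ hsub
  have e : admSet α c = (⋂ n : ℤ, {f | f (-n) = (starRingEnd ℂ) (f n)}) ∩ ({f | f 0 = 0} ∩
      ⋂ s : Finset ℤ, {f : ℤ → ℂ | ∑ n ∈ s, (|(n : ℝ)| ^ α + c) * ‖f n‖ ^ 2 ≤ 1}) := by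
    ext f; simp [admSet]
  rw [e]
  refine IsClosed.inter (isClosed_iInter fun n => ?_) (IsClosed.inter ?_
    (isClosed_iInter fun s => ?_))
  · exact isClosed_eq (continuous_apply _) (Complex.continuous_conj.comp (continuous_apply _))
  · exact isClosed_eq (continuous_apply _) continuous_const
  · exact isClosed_le (by fun_prop) continuous_const

lemma exists_memHper {α : ℝ} (hα : 0 ≤ α) {f : ℤ → ℂ}
    (hh : ∀ n, f (-n) = (starRingEnd ℂ) (f n))
    (hw : Summable fun n => wt α n * ‖f n‖ ^ 2) : ∃ u, MemHper (α / 2) u ∧ coef u = f := by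
  have h2 : Summable fun n : ℤ => ‖f n‖ ^ 2 :=
    Summable.of_nonneg_of_le (fun n => by positivity)
      (fun n => by nlinarith [one_le_wt hα n, sq_nonneg ‖f n‖]) hw
  obtain ⟨u, hu, rfl⟩ := exists_coef_eq h2 hh
  exact ⟨u, ⟨hu, hw⟩, rfl⟩

lemma SqSummable.of_wt {α : ℝ} (hα : 0 ≤ α) {f : ℤ → ℂ}
    (hw : Summable fun n => wt α n * ‖f n‖ ^ 2) : SqSummable f :=
  Summable.of_nonneg_of_le (fun n => by positivity)
    (fun n => by nlinarith [one_le_wt hα n, sq_nonneg ‖f n‖]) hw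

/-- Rellich's theorem on sequences: the symbol tends to infinity, so bounded energy makes the tails
uniformly small and pointwise convergence becomes `ℓ²` convergence. -/
lemma tendsto_l2_admSet {α c : ℝ} (hα : 0 < α) (hc1 : -1 < c) (hc : c ≤ 0) {g : ℤ → ℂ}
    (hg : g ∈ admSet α c) {δ : ℝ} (hδ : 0 < δ) :
    ∀ᶠ f in nhdsWithin g (admSet α c), ∑' n, ‖f n - g n‖ ^ 2 < δ := by
  -- Beyond `N` the symbol is at least `8 / δ`. As both energies are at most one, the tail
  -- contributes at most `δ / 2`.
  obtain ⟨N, hN⟩ : ∃ N : ℕ, 8 / δ - c + 1 ≤ (N : ℝ) ^ α :=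
    ((tendsto_rpow_atTop hα).comp tendsto_natCast_atTop_atTop).eventually_ge_atTop _ |>.exists
  set s : Finset ℤ := Finset.Icc (-(N : ℤ)) N
  have hfin : ∀ᶠ f in nhdsWithin g (admSet α c), ∑ n ∈ s, ‖f n - g n‖ ^ 2 < δ / 2 := by
    have hc : Continuous fun f : ℤ → ℂ => ∑ n ∈ s, ‖f n - g n‖ ^ 2 := by fun_prop
    have h0 : (fun f : ℤ → ℂ => ∑ n ∈ s, ‖f n - g n‖ ^ 2) g < δ / 2 := by simp; linarith
    exact (hc.tendsto g).mono_left nhdsWithin_le_nhds |>.eventually_lt_const h0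
  filter_upwards [hfin, self_mem_nhdsWithin] with f hf hfK
  obtain ⟨hf1, -, hf2, hf3⟩ := admSet_bounds hα.le hc1 hc hfK
  obtain ⟨hg1, -, hg2, hg3⟩ := admSet_bounds hα.le hc1 hc hg
  have hsd := (SqSummable.of_wt hα.le hf1).sub (SqSummable.of_wt hα.le hg1)
  have hb : ∀ n : ℤ, ‖f n - g n‖ ^ 2 ≤ (if n ∈ s then ‖f n - g n‖ ^ 2 else 0)
      + δ / 4 * ((|(n : ℝ)| ^ α + c) * ‖f n‖ ^ 2 + (|(n : ℝ)| ^ α + c) * ‖g n‖ ^ 2) := by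
    intro n
    have e1 := symbol_mul_nonneg hα.le hc1 hfK.2.1 n
    have e2 := symbol_mul_nonneg hα.le hc1 hg.2.1 n
    split_ifs with hn
    · have : 0 ≤ δ / 4 * ((|(n : ℝ)| ^ α + c) * ‖f n‖ ^ 2 + (|(n : ℝ)| ^ α + c) * ‖g n‖ ^ 2) := by
        positivity
      linarith
    · have hnN : (N : ℝ) ≤ |(n : ℝ)| := by
        have : (N : ℤ) ≤ |n| := by
          by_contra hlt
          push Not at hlt
          exact hn (Finset.mem_Icc.2 ⟨by linarith [neg_abs_le n], by linarith [le_abs_self n]⟩)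
        rw [← Int.cast_abs]; exact_mod_cast this
      have h1 : (N : ℝ) ^ α ≤ |(n : ℝ)| ^ α := Real.rpow_le_rpow (by positivity) hnN hα.le
      have h2 : 8 / δ ≤ |(n : ℝ)| ^ α + c := by linarith
      have h3 : 2 ≤ δ / 4 * (|(n : ℝ)| ^ α + c) := by
        calc (2 : ℝ) = δ / 4 * (8 / δ) := by field_simp; norm_num
          _ ≤ _ := mul_le_mul_of_nonneg_left h2 (by linarith)
      have h4 : ‖f n - g n‖ ^ 2 ≤ 2 * (‖f n‖ ^ 2 + ‖g n‖ ^ 2) := by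
        have := norm_sub_le (f n) (g n)
        nlinarith [sq_nonneg (‖f n‖ - ‖g n‖), norm_nonneg (f n - g n)]
      have h5 := mul_le_mul_of_nonneg_right h3 (by positivity : 0 ≤ ‖f n‖ ^ 2 + ‖g n‖ ^ 2)
      nlinarith
  have hite : HasSum (fun n : ℤ => if n ∈ s then ‖f n - g n‖ ^ 2 else 0)
      (∑ n ∈ s, ‖f n - g n‖ ^ 2) := by
    have h := hasSum_sum_of_ne_finset_zero (s := s) (L := .unconditional ℤ)
      (f := fun n : ℤ => if n ∈ s then ‖f n - g n‖ ^ 2 else 0) (fun n hn => if_neg hn)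
    rwa [Finset.sum_congr rfl fun n hn => if_pos hn] at h
  have hR := hite.add ((hf2.hasSum.add hg2.hasSum).mul_left (δ / 4))
  have := hsd.tsum_le_tsum hb hR.summable
  rw [hR.tsum_eq] at this
  unfold quadSeq at hf3 hg3
  nlinarith

lemma continuousOn_cubeSeq {α c : ℝ} (hα : 1 / 2 < α) (hc1 : -1 < c) (hc : c ≤ 0) :
    ContinuousOn cubeSeq (admSet α c) := by
  have hα0 : 0 < α := by linarith
  intro g hg
  rw [ContinuousWithinAt, Metric.tendsto_nhds]
  intro η hη
  obtain ⟨hg1, hg2, -, -⟩ := admSet_bounds hα0.le hc1 hc hg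
  obtain ⟨v, hv, rfl⟩ := exists_memHper hα0.le hg.1 hg1
  set D := 2 ^ (α / 2) * (1 + c)⁻¹ with hD
  have hD0 : 0 ≤ D := mul_nonneg (by positivity) (inv_nonneg.2 (by linarith))
  set S := ∑' n, (wt α n)⁻¹ ^ 2
  have hS : 0 ≤ S := tsum_nonneg fun _ => by positivity
  have hp := Real.pi_pos
  set C := 5 * (2 * Real.pi * (S * (D ^ 2 + D ^ 2))) with hC
  have hC0 : 0 ≤ C := by positivity
  -- `e` is fixed first, so that the `L⁴` term of `abs_cube_sub_le` is below `η / 2` on the whole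
  -- ball; the neighbourhood is then shrunk to control the `e⁻¹` term.
  set e := η / (2 * (C + 1)) with he
  have he0 : 0 < e := by positivity
  have heC : e * C < η / 2 := by
    rw [he, div_mul_eq_mul_div, div_lt_iff₀ (by positivity)]; nlinarith
  have hδ : 0 < e * η / (4 * Real.pi) := by positivity
  filter_upwards [tendsto_l2_admSet hα0 hc1 hc hg hδ, self_mem_nhdsWithin] with f hf hfK
  obtain ⟨hf1, hf2, -, -⟩ := admSet_bounds hα0.le hc1 hc hfK
  obtain ⟨u, hu, rfl⟩ := exists_memHper hα0.le hfK.1 hf1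
  have key := abs_cube_sub_le hα hu hv he0
  rw [integral_cube hα hu, integral_cube hα hv] at key
  rw [Real.dist_eq]
  refine key.trans_lt ?_
  have h1 : e⁻¹ * (2 * Real.pi * ∑' n, ‖coef u n - coef v n‖ ^ 2) < η / 2 := by
    calc _ < e⁻¹ * (2 * Real.pi * (e * η / (4 * Real.pi))) := by gcongr
      _ = η / 2 := by field_simp; norm_num
  have hu0 : 0 ≤ ∑' n, wt α n * ‖coef u n‖ ^ 2 :=
    tsum_nonneg fun n => mul_nonneg (wt_pos α n).le (by positivity)
  have hv0 : 0 ≤ ∑' n, wt α n * ‖coef v n‖ ^ 2 :=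
    tsum_nonneg fun n => mul_nonneg (wt_pos α n).le (by positivity)
  have h2 : 5 * e * (2 * Real.pi * (S * ((∑' n, wt α n * ‖coef u n‖ ^ 2) ^ 2
      + (∑' n, wt α n * ‖coef v n‖ ^ 2) ^ 2))) ≤ e * C := by
    calc _ ≤ 5 * e * (2 * Real.pi * (S * (D ^ 2 + D ^ 2))) := by gcongr
      _ = e * C := by rw [hC]; ring
  linarith

/-- The coefficients of `2 cos x + 2 e cos 2x`. -/
def trial (e : ℝ) (n : ℤ) : ℂ := if |n| = 1 then 1 else if |n| = 2 then (e : ℂ) else 0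

lemma trial_support (e : ℝ) {n : ℤ} (hn : n ∉ ({-2, -1, 1, 2} : Finset ℤ)) : trial e n = 0 := by
  have h : n ≠ -2 ∧ n ≠ -1 ∧ n ≠ 1 ∧ n ≠ 2 := by simpa using hn
  have h1 : ¬ |n| = 1 := by rw [abs_eq (by norm_num)]; omega
  have h2 : ¬ |n| = 2 := by rw [abs_eq (by norm_num)]; omega
  rw [trial, if_neg h1, if_neg h2]

lemma trial_neg (e : ℝ) (n : ℤ) : trial e (-n) = (starRingEnd ℂ) (trial e n) := by
  unfold trial
  rw [abs_neg]
  split_ifs <;> simp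

lemma quadSeq_trial (α c e : ℝ) :
    quadSeq α c (trial e) = 2 * (1 + c) + 2 * (2 ^ α + c) * e ^ 2 := by
  unfold quadSeq
  rw [tsum_eq_sum (s := ({-2, -1, 1, 2} : Finset ℤ)) fun n hn => by simp [trial_support e hn]]
  simp [trial]
  ring

lemma summable_wt_trial (α e : ℝ) : Summable fun n => wt α n * ‖trial e n‖ ^ 2 :=
  summable_of_ne_finset_zero (s := ({-2, -1, 1, 2} : Finset ℤ))
    fun n hn => by simp [trial_support e hn]

/-- The only resonances among the modes `±1, ±2` are `1 + 1 - 2 = 0` and its negative, in three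
orders each. -/
lemma cubeSeq_trial (e : ℝ) : cubeSeq (trial e) = 12 * Real.pi * e := by
  unfold cubeSeq
  rw [tsum_eq_sum (s := ({-2, -1, 1, 2} : Finset ℤ)) fun n hn => by simp [trial_support e hn]]
  have hc : ∀ n, conv (trial e) (trial e) n
      = ∑ k ∈ ({-2, -1, 1, 2} : Finset ℤ), trial e k * trial e (n - k) := fun n =>
    tsum_eq_sum fun k hk => by simp [trial_support e hk]
  simp only [hc]
  simp [trial]
  ring

lemma quadSeq_nonneg {α c : ℝ} (hα : 0 ≤ α) (hc1 : -1 < c) {f : ℤ → ℂ} (h0 : f 0 = 0) :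
    0 ≤ quadSeq α c f :=
  tsum_nonneg fun n => symbol_mul_nonneg hα hc1 h0 n

lemma quadSeq_const_mul (α c : ℝ) (t : ℝ) (f : ℤ → ℂ) :
    quadSeq α c (fun n => t * f n) = t ^ 2 * quadSeq α c f := by
  unfold quadSeq
  rw [← tsum_mul_left]
  refine tsum_congr fun n => ?_
  rw [norm_mul, mul_pow, Complex.norm_real, Real.norm_eq_abs, sq_abs]
  ring

lemma cubeSeq_const_mul (t : ℝ) (f : ℤ → ℂ) :
    cubeSeq (fun n => t * f n) = t ^ 3 * cubeSeq f := by
  unfold cubeSeq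
  have h : ∀ n, (conv (fun n => t * f n) (fun n => t * f n) n * (starRingEnd ℂ) (t * f n)).re
      = t ^ 3 * (conv f f n * (starRingEnd ℂ) (f n)).re := by
    intro n
    rw [conv_const_mul_left, conv_const_mul_right, map_mul, Complex.conj_ofReal,
      show (t : ℂ) * (t * conv f f n) * (t * (starRingEnd ℂ) (f n))
        = ((t ^ 3 : ℝ) : ℂ) * (conv f f n * (starRingEnd ℂ) (f n)) by push_cast; ring,
      Complex.re_ofReal_mul]
  simp only [h]
  rw [tsum_mul_left]
  ring

lemma coef_zero_of_integral {u : ℝ → ℝ} (h : ∫ x in (-Real.pi)..Real.pi, u x = 0) :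
    coef u 0 = 0 := by
  rw [coef_zero_eq, h]; simp

lemma integral_of_coef_zero {u : ℝ → ℝ} (h : coef u 0 = 0) :
    ∫ x in (-Real.pi)..Real.pi, u x = 0 := by
  rw [coef_zero_eq] at h
  have hp := Real.pi_pos
  have h2 : (2 * Real.pi)⁻¹ * ∫ x in (-Real.pi)..Real.pi, u x = 0 := by exact_mod_cast h
  exact (mul_eq_zero.1 h2).resolve_left (by positivity)

lemma eq_zero_of_quadSeq_nonpos {α c : ℝ} (hα : 0 ≤ α) (hc1 : -1 < c) {f : ℤ → ℂ} (h0 : f 0 = 0)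
    (hw : Summable fun n => wt α n * ‖f n‖ ^ 2) (hq : quadSeq α c f ≤ 0) : f = 0 := by
  funext n
  by_cases hn : n = 0
  · subst hn; simpa using h0
  · have h1 : (|(n : ℝ)| ^ α + c) * ‖f n‖ ^ 2 ≤ quadSeq α c f :=
      (summable_quad hα hw).le_tsum n fun k _ => symbol_mul_nonneg hα hc1 h0 k
    have h2 := symbol_pos hα hc1 hn
    have h3 : ‖f n‖ ^ 2 ≤ 0 := by
      by_contra h
      push Not at h
      nlinarith [mul_pos h2 h]
    have h4 : ‖f n‖ = 0 := by
      have := le_antisymm h3 (by positivity)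
      simpa using this
    simpa using h4

/-- The dual problem is solved: the cubic functional is maximised over the compact energy ball. The
degrees of homogeneity three and two then turn the maximiser, rescaled to cube one, into a minimiser
of the energy. -/
lemma exists_isGroundState {α c : ℝ} (hα : 1 / 2 < α) (hc1 : -1 < c) (hc : c ≤ 0) :
    ∃ φ, IsGroundState α c φ := by
  have hα0 : 0 < α := by linarith
  have hp := Real.pi_pos
  have htr : ∃ t : ℝ, 0 < t ∧ (fun n => (t : ℂ) * trial 1 n) ∈ admSet α c := by
    have hq : 0 < quadSeq α c (trial 1) := by
      rw [quadSeq_trial]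
      have : (1 : ℝ) ≤ 2 ^ α := Real.one_le_rpow (by norm_num) hα0.le
      nlinarith
    refine ⟨(√(quadSeq α c (trial 1)))⁻¹, by positivity, ?_⟩
    refine mem_admSet hα0.le hc1 (fun n => ?_) ?_ ?_ ?_
    · simp only [map_mul, Complex.conj_ofReal, trial_neg]
    · simp [trial]
    · refine ((summable_wt_trial α 1).mul_left ((√(quadSeq α c (trial 1)))⁻¹ ^ 2)).congr fun n => ?_
      rw [norm_mul, mul_pow, Complex.norm_real, Real.norm_eq_abs, sq_abs]; ring
    · rw [quadSeq_const_mul, inv_pow, Real.sq_sqrt hq.le, inv_mul_cancel₀ hq.ne']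
  obtain ⟨t₀, ht₀, htK⟩ := htr
  obtain ⟨F, hFK, hF⟩ := (isCompact_admSet hα0.le hc1).exists_isMaxOn ⟨_, htK⟩
    (continuousOn_cubeSeq hα hc1 hc)
  have hτ : 0 < cubeSeq F := by
    have : cubeSeq (fun n => (t₀ : ℂ) * trial 1 n) ≤ cubeSeq F := hF htK
    rw [cubeSeq_const_mul, cubeSeq_trial] at this
    have : 0 < t₀ ^ 3 * (12 * Real.pi * 1) := by positivity
    linarith
  set τ := cubeSeq F with hτd
  obtain ⟨hF1, -, -, hF3⟩ := admSet_bounds hα0.le hc1 hc hFK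
  obtain ⟨u, hu, huF⟩ := exists_memHper hα0.le hFK.1 hF1
  set t : ℝ := τ⁻¹ ^ ((3 : ℝ)⁻¹) with ht
  have ht0 : 0 < t := Real.rpow_pos_of_pos (inv_pos.2 hτ) _
  have ht3 : t ^ 3 = τ⁻¹ := by
    rw [ht, ← Real.rpow_natCast, ← Real.rpow_mul (inv_nonneg.2 hτ.le)]
    norm_num
  have htu : MemHper (α / 2) fun x => t * u x := hu.const_mul t
  have hcoef : coef (fun x => t * u x) = fun n => (t : ℂ) * F n := by
    funext n; rw [coef_const_mul, huF]
  refine ⟨fun x => t * u x, ⟨htu, ?_, ?_⟩, ?_⟩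
  · rw [integral_cube hα htu, hcoef, cubeSeq_const_mul, ht3, inv_mul_cancel₀ hτ.ne']
  · refine integral_of_coef_zero ?_
    rw [hcoef]; simp [hFK.2.1]
  · rintro v ⟨hv, hv3, hv0⟩
    simp only [mem_ofPred_eq]
    rw [quadForm_eq hα0.le htu, quadForm_eq hα0.le hv, hcoef, quadSeq_const_mul]
    have hv00 := coef_zero_of_integral hv0
    rw [integral_cube hα hv] at hv3
    have hQ : 0 < quadSeq α c (coef v) := by
      by_contra h
      push Not at h
      have := eq_zero_of_quadSeq_nonpos hα0.le hc1 hv00 hv.2 h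
      rw [this] at hv3
      simp [cubeSeq] at hv3
    set Q := quadSeq α c (coef v)
    have hmem : (fun n => (((√Q)⁻¹ : ℝ) : ℂ) * coef v n) ∈ admSet α c := by
      refine mem_admSet hα0.le hc1 (fun n => ?_) ?_ ?_ ?_
      · simp only [map_mul, Complex.conj_ofReal, coef_neg]
      · simp [hv00]
      · have : Summable fun n => wt α n * ‖coef v n‖ ^ 2 := hv.2
        refine (this.mul_left ((√Q)⁻¹ ^ 2)).congr fun n => ?_
        rw [norm_mul, mul_pow, Complex.norm_real, Real.norm_eq_abs, sq_abs]; ring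
      · rw [quadSeq_const_mul, inv_pow, Real.sq_sqrt hQ.le, inv_mul_cancel₀ hQ.ne']
    -- The competitor at unit energy has cube `Q^{-3/2} ≤ τ = t⁻³`, so `t² ≤ Q`; since `F` has
    -- energy at most one, `t F` does not exceed `Q`.
    have hle : cubeSeq (fun n => (((√Q)⁻¹ : ℝ) : ℂ) * coef v n) ≤ τ := hF hmem
    rw [cubeSeq_const_mul, hv3, mul_one] at hle
    have hsQ : 0 < √Q := Real.sqrt_pos.2 hQ
    have h1 : t ^ 3 ≤ (√Q) ^ 3 := by
      rw [ht3]
      have := inv_anti₀ (by positivity) hle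
      simpa using this
    have h2 : t ≤ √Q := le_of_pow_le_pow_left₀ (by norm_num) hsQ.le h1
    have h3 : t ^ 2 ≤ Q := by
      rw [← Real.sq_sqrt hQ.le]; gcongr
    refine mul_le_mul_of_nonneg_left ?_ hp.le
    nlinarith [quadSeq_nonneg hα0.le hc1 hFK.2.1, sq_nonneg t]

/-! ### Scale-invariant minimality and the Euler-Lagrange equation. -/

lemma quadForm_const_mul {α c : ℝ} (hα : 0 ≤ α) {u : ℝ → ℝ} (hu : MemHper (α / 2) u) (t : ℝ) :
    quadForm α c (fun x => t * u x) = t ^ 2 * quadForm α c u := by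
  rw [quadForm_eq hα (hu.const_mul t), quadForm_eq hα hu]
  rw [show coef (fun x => t * u x) = fun n => (t : ℂ) * coef u n from
    funext fun n => coef_const_mul t u n, quadSeq_const_mul]
  ring

lemma quadForm_nonneg {α c : ℝ} (hα : 0 ≤ α) (hc1 : -1 < c) {u : ℝ → ℝ} (hu : MemHper (α / 2) u)
    (h0 : ∫ x in (-Real.pi)..Real.pi, u x = 0) : 0 ≤ quadForm α c u := by
  rw [quadForm_eq hα hu]
  exact mul_nonneg Real.pi_pos.le (quadSeq_nonneg hα hc1 (coef_zero_of_integral h0))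

/-- The scale-invariant form of minimality. -/
lemma IsGroundState.cube_le {α c : ℝ} (hα : 0 ≤ α) (hc1 : -1 < c) {φ : ℝ → ℝ}
    (hφ : IsGroundState α c φ) {v : ℝ → ℝ} (hv : MemHper (α / 2) v)
    (h0 : ∫ x in (-Real.pi)..Real.pi, v x = 0) :
    quadForm α c φ ^ 3 * (∫ x in (-Real.pi)..Real.pi, v x ^ 3) ^ 2 ≤ quadForm α c v ^ 3 := by
  have hB := quadForm_nonneg hα hc1 hv h0
  have hm := quadForm_nonneg hα hc1 hφ.1.1 hφ.1.2.2
  set I := ∫ x in (-Real.pi)..Real.pi, v x ^ 3 with hI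
  by_cases hI0 : I = 0
  · rw [hI0]; simp; positivity
  -- A real cube root exists for either sign of `I`, so `t v` always satisfies the constraint.
  · obtain ⟨t, ht⟩ : ∃ t : ℝ, t ^ 3 = I⁻¹ := by
      rcases lt_or_gt_of_ne hI0 with h | h
      · refine ⟨-((-I)⁻¹ ^ ((3 : ℝ)⁻¹)), ?_⟩
        rw [Odd.neg_pow (by decide), ← Real.rpow_natCast, ← Real.rpow_mul (by
          rw [inv_nonneg]; linarith)]
        norm_num
      · refine ⟨I⁻¹ ^ ((3 : ℝ)⁻¹), ?_⟩
        rw [← Real.rpow_natCast, ← Real.rpow_mul (inv_nonneg.2 h.le)]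
        norm_num
    have hmem : (fun x => t * v x) ∈ constraintSet α := by
      refine ⟨hv.const_mul t, ?_, ?_⟩
      · simp only [mul_pow]
        rw [intervalIntegral.integral_const_mul, ht, ← hI, inv_mul_cancel₀ hI0]
      · rw [intervalIntegral.integral_const_mul, h0, mul_zero]
    have h1 : quadForm α c φ ≤ quadForm α c (fun x => t * v x) := hφ.2 hmem
    rw [quadForm_const_mul hα hv] at h1
    have h2 := pow_le_pow_left₀ hm h1 3
    have h3 : (t ^ 2 * quadForm α c v) ^ 3 = I⁻¹ ^ 2 * quadForm α c v ^ 3 := by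
      rw [← ht]; ring
    rw [h3] at h2
    calc quadForm α c φ ^ 3 * I ^ 2 ≤ I⁻¹ ^ 2 * quadForm α c v ^ 3 * I ^ 2 := by gcongr
      _ = quadForm α c v ^ 3 := by field_simp

lemma IsGroundState.quadForm_pos {α c : ℝ} (hα : 1 / 2 < α) (hc1 : -1 < c) {φ : ℝ → ℝ}
    (hφ : IsGroundState α c φ) : 0 < quadForm α c φ := by
  have hα0 : 0 ≤ α := by linarith
  obtain ⟨hH, h3, h0⟩ := hφ.1
  by_contra h
  push Not at h
  rw [quadForm_eq hα0 hH] at h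
  have hq : quadSeq α c (coef φ) ≤ 0 := by
    by_contra h'
    push Not at h'
    nlinarith [mul_pos Real.pi_pos h']
  have := eq_zero_of_quadSeq_nonpos hα0 hc1 (coef_zero_of_integral h0) hH.2 hq
  rw [integral_cube hα hH, this] at h3
  simp [cubeSeq] at h3

/-- A Hermitian sequence supported at `±k`. -/
def twoMode (k : ℤ) (z : ℂ) (n : ℤ) : ℂ :=
  if n = k then z else if n = -k then (starRingEnd ℂ) z else 0

lemma twoMode_neg {k : ℤ} (hk : k ≠ 0) (z : ℂ) (n : ℤ) :
    twoMode k z (-n) = (starRingEnd ℂ) (twoMode k z n) := by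
  unfold twoMode
  by_cases h1 : n = k
  · subst h1
    rw [if_neg (by omega), if_pos rfl, if_pos rfl]
  · by_cases h2 : n = -k
    · subst h2
      rw [if_pos (by omega), if_neg h1, if_pos rfl, Complex.conj_conj]
    · rw [if_neg (by omega), if_neg (by omega), if_neg h1, if_neg h2, map_zero]

lemma twoMode_support {k : ℤ} (z : ℂ) {n : ℤ} (hn : n ∉ ({k, -k} : Finset ℤ)) :
    twoMode k z n = 0 := by
  simp only [Finset.mem_insert, Finset.mem_singleton, not_or] at hn
  rw [twoMode, if_neg hn.1, if_neg hn.2]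

lemma tsum_twoMode {k : ℤ} (hk : k ≠ 0) (z : ℂ) {g : ℤ → ℂ} (p : ℤ → ℝ) (hp : p (-k) = p k)
    (hg : ∀ n, g (-n) = (starRingEnd ℂ) (g n)) :
    ∑' n, p n * (g n * (starRingEnd ℂ) (twoMode k z n)).re
      = 2 * (p k * (g k * (starRingEnd ℂ) z).re) := by
  rw [tsum_eq_sum (s := ({k, -k} : Finset ℤ)) fun n hn => by simp [twoMode_support z hn]]
  rw [Finset.sum_pair (by omega), twoMode_neg hk, hg, hp]
  simp only [twoMode, if_true, Complex.conj_conj]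
  rw [show ((starRingEnd ℂ) (g k) * z) = (starRingEnd ℂ) (g k * (starRingEnd ℂ) z) by simp,
    Complex.conj_re]
  ring

/-- The scale-invariant inequality replaces the Lagrange multiplier. Along `φ + t h` with `h`
supported on the modes `±k`, both of its sides are polynomials in `t`; their difference is
nonnegative and vanishes at `t = 0`, so its derivative there is zero. -/
lemma IsGroundState.euler_lagrange {α c : ℝ} (hα : 1 / 2 < α) (hc1 : -1 < c) {φ : ℝ → ℝ}
    (hφ : IsGroundState α c φ) {k : ℤ} (hk : k ≠ 0) :
    ((|(k : ℝ)| ^ α + c : ℝ) : ℂ) * coef φ k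
      = (2 * quadForm α c φ : ℝ) * conv (coef φ) (coef φ) k := by
  have hα0 : 0 ≤ α := by linarith
  have hpi := Real.pi_pos
  obtain ⟨hH, h3, h0⟩ := hφ.1
  set m := quadForm α c φ with hm
  have hmpos : 0 < m := hφ.quadForm_pos hα hc1
  have main : ∀ z : ℂ, (|(k : ℝ)| ^ α + c) * (coef φ k * (starRingEnd ℂ) z).re
      = 2 * m * (conv (coef φ) (coef φ) k * (starRingEnd ℂ) z).re := by
    intro z
    have hws : Summable fun n => wt α n * ‖twoMode k z n‖ ^ 2 :=
      summable_of_ne_finset_zero (s := ({k, -k} : Finset ℤ))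
        fun n hn => by simp [twoMode_support z hn]
    obtain ⟨h, hh, hhc⟩ := exists_memHper hα0 (twoMode_neg hk z) hws
    have hh0 : ∫ x in (-Real.pi)..Real.pi, h x = 0 := by
      refine integral_of_coef_zero ?_
      rw [hhc, twoMode, if_neg (by omega), if_neg (by omega)]
    set A₁ := ∫ x, φ x ^ 2 * h x ∂muPer with hA₁
    set A₂ := ∫ x, h x ^ 2 * φ x ∂muPer with hA₂
    set A₃ := ∫ x, h x ^ 2 * h x ∂muPer with hA₃
    have hA₁v : A₁ = 2 * Real.pi * (2 * (conv (coef φ) (coef φ) k * (starRingEnd ℂ) z).re) := by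
      have hp := (hasSum_parseval (hH.sq_memLp hα) hh.1.2).tsum_eq
      simp only [coef_sq hH.1.2, hhc] at hp
      have := tsum_twoMode hk z (g := conv (coef φ) (coef φ)) (fun _ => 1) rfl
        (conv_neg (coef_neg φ))
      simp only [one_mul] at this
      rw [this, intervalIntegral_eq_muPer] at hp
      rw [hp, ← mul_assoc, mul_inv_cancel₀ (by positivity), one_mul]
    set b := (|(k : ℝ)| ^ α + c) * (coef φ k * (starRingEnd ℂ) z).re with hb
    set Qh := quadSeq α c (twoMode k z)
    have hcube : ∀ t : ℝ, ∫ x in (-Real.pi)..Real.pi, (φ x + t * h x) ^ 3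
        = 1 + 3 * t * A₁ + 3 * t ^ 2 * A₂ + t ^ 3 * A₃ := by
      intro t
      have i1 := integrable_mul_sq hα hH hH
      have i2 := (integrable_mul_sq hα hH hh).const_mul (3 * t)
      have i3 := (integrable_mul_sq hα hh hH).const_mul (3 * t ^ 2)
      have i4 := (integrable_mul_sq hα hh hh).const_mul (t ^ 3)
      have i12 : Integrable (fun x => φ x ^ 2 * φ x + 3 * t * (φ x ^ 2 * h x)) muPer := i1.add i2
      have i123 : Integrable (fun x => φ x ^ 2 * φ x + 3 * t * (φ x ^ 2 * h x)
          + 3 * t ^ 2 * (h x ^ 2 * φ x)) muPer := i12.add i3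
      have e0 : ∫ x, φ x ^ 2 * φ x ∂muPer = 1 := by
        rw [← h3, intervalIntegral_eq_muPer]; rfl
      rw [intervalIntegral_eq_muPer, ← e0, hA₁, hA₂, hA₃, ← integral_const_mul,
        ← integral_const_mul, ← integral_const_mul, ← integral_add i1 i2,
        ← integral_add i12 i3, ← integral_add i123 i4]
      congr 1; funext x; ring
    have hquad : ∀ t : ℝ, quadForm α c (fun x => φ x + t * h x)
        = m + t * (4 * Real.pi * b) + t ^ 2 * (Real.pi * Qh) := by
      intro t
      rw [quadForm_eq hα0 (hH.add (hh.const_mul t)), hm, quadForm_eq hα0 hH]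
      have e1 : coef (fun x => φ x + t * h x) = fun n => coef φ n + t * twoMode k z n := by
        funext n
        rw [coef_add hH.1.integrable (hh.1.const_mul t).integrable, coef_const_mul, hhc]
      rw [e1]
      have e2 : ∀ n : ℤ, (|(n : ℝ)| ^ α + c) * ‖coef φ n + t * twoMode k z n‖ ^ 2
          = (|(n : ℝ)| ^ α + c) * ‖coef φ n‖ ^ 2 + (2 * t * ((|(n : ℝ)| ^ α + c) *
            (coef φ n * (starRingEnd ℂ) (twoMode k z n)).re)
            + t ^ 2 * ((|(n : ℝ)| ^ α + c) * ‖twoMode k z n‖ ^ 2)) := by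
        intro n
        rw [← Complex.normSq_eq_norm_sq, ← Complex.normSq_eq_norm_sq, ← Complex.normSq_eq_norm_sq,
          Complex.normSq_add, Complex.normSq_mul, map_mul (starRingEnd ℂ), Complex.conj_ofReal,
          show coef φ n * ((t : ℂ) * (starRingEnd ℂ) (twoMode k z n))
            = (t : ℂ) * (coef φ n * (starRingEnd ℂ) (twoMode k z n)) by ring,
          Complex.re_ofReal_mul, Complex.normSq_ofReal]
        ring
      have s1 : Summable fun n : ℤ => 2 * t * ((|(n : ℝ)| ^ α + c) *
            (coef φ n * (starRingEnd ℂ) (twoMode k z n)).re) :=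
        summable_of_ne_finset_zero (s := ({k, -k} : Finset ℤ))
          fun n hn => by simp [twoMode_support z hn]
      have s2 := (summable_quad (c := c) hα0 hws).mul_left (t ^ 2)
      have s3 := summable_quad (c := c) hα0 hH.2
      rw [quadSeq]
      simp only [e2]
      rw [s3.tsum_add (s1.add s2), s1.tsum_add s2, tsum_mul_left, tsum_mul_left,
        tsum_twoMode hk z (fun n : ℤ => |(n : ℝ)| ^ α + c) (by simp) (coef_neg φ)]
      simp only [quadSeq, Qh, hb]
      ring
    set P : ℝ → ℝ := fun t => (m + t * (4 * Real.pi * b) + t ^ 2 * (Real.pi * Qh)) ^ 3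
      - m ^ 3 * (1 + 3 * t * A₁ + 3 * t ^ 2 * A₂ + t ^ 3 * A₃) ^ 2 with hP
    have hPnn : ∀ t, 0 ≤ P t := by
      intro t
      have hv0 : ∫ x in (-Real.pi)..Real.pi, (φ x + t * h x) = 0 := by
        refine integral_of_coef_zero ?_
        rw [coef_add hH.1.integrable (hh.1.const_mul t).integrable, coef_const_mul,
          coef_zero_of_integral h0, coef_zero_of_integral hh0]
        simp
      have := hφ.cube_le hα0 hc1 (hH.add (hh.const_mul t)) hv0
      rw [hcube, hquad] at this
      simp only [hP]
      linarith
    have hP0 : P 0 = 0 := by simp [hP]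
    have hmin : IsLocalMin P 0 := Filter.Eventually.of_forall fun t => by rw [hP0]; exact hPnn t
    have hder : HasDerivAt P (3 * m ^ 2 * (4 * Real.pi * b) - m ^ 3 * (2 * (3 * A₁))) 0 := by
      have hid := hasDerivAt_id (0 : ℝ)
      have d1 := ((hid.mul_const (4 * Real.pi * b)).const_add m).add
        ((hid.pow 2).mul_const (Real.pi * Qh))
      have d2 := ((((hid.const_mul 3).mul_const A₁).const_add 1).add
        (((hid.pow 2).const_mul 3).mul_const A₂)).add ((hid.pow 3).mul_const A₃)
      have := (d1.pow 3).sub ((d2.pow 2).const_mul (m ^ 3))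
      refine HasDerivAt.congr_deriv this ?_
      simp
    have hz := hmin.hasDerivAt_eq_zero hder
    rw [hA₁v] at hz
    have hm2 : (12 * Real.pi * m ^ 2) * (b - 2 * m *
        (conv (coef φ) (coef φ) k * (starRingEnd ℂ) z).re) = 0 := by
      rw [← hz]; ring
    have := (mul_eq_zero.1 hm2).resolve_left (by positivity)
    linarith
  -- The test amplitudes `z = 1` and `z = i` give the real and imaginary parts.
  apply Complex.ext
  · have := main 1
    simpa [Complex.re_ofReal_mul] using this
  · have := main Complex.I
    simpa [Complex.im_ofReal_mul] using this

/-- Upper bound for the minimum near `c = -1`. -/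
lemma IsGroundState.quadForm_cube_le {α c : ℝ} (hα : 1 / 2 < α) (hc1 : -1 < c) (hc : c ≤ 0)
    {φ : ℝ → ℝ} (hφ : IsGroundState α c φ) :
    4 * quadForm α c φ ^ 3 ≤ Real.pi * (1 + 2 ^ α) ^ 3 * (1 + c) ^ 2 := by
  have hα0 : 0 ≤ α := by linarith
  have hpi := Real.pi_pos
  -- With this choice both modes contribute order `1 + c` to the energy, while the cube has order
  -- `√(1 + c)`. The quotient of energy cubed by cube squared is then of order `(1 + c)²`.
  set e := √(1 + c) with he
  have he2 : e ^ 2 = 1 + c := Real.sq_sqrt (by linarith)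
  obtain ⟨v, hv, hvc⟩ := exists_memHper hα0 (trial_neg e) (summable_wt_trial α e)
  have hv0 : ∫ x in (-Real.pi)..Real.pi, v x = 0 := by
    refine integral_of_coef_zero ?_
    rw [hvc]; simp [trial]
  have h := hφ.cube_le hα0 hc1 hv hv0
  rw [integral_cube hα hv, quadForm_eq hα0 hv, hvc, cubeSeq_trial, quadSeq_trial, mul_pow, he2] at h
  have hA : (1 : ℝ) ≤ 2 ^ α := Real.one_le_rpow (by norm_num) hα0
  have h1 : Real.pi * (2 * (1 + c) + 2 * (2 ^ α + c) * (1 + c))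
      ≤ Real.pi * (2 * (1 + 2 ^ α) * (1 + c)) := by
    refine mul_le_mul_of_nonneg_left ?_ hpi.le
    nlinarith
  have h2 := pow_le_pow_left₀ (mul_nonneg hpi.le (by nlinarith)) h1 3
  have h3 := h.trans h2
  have h4 : quadForm α c φ ^ 3 * ((12 * Real.pi) ^ 2) ≤
      8 * Real.pi ^ 3 * (1 + 2 ^ α) ^ 3 * (1 + c) ^ 2 := by
    have hc' : 0 < 1 + c := by linarith
    refine le_of_mul_le_mul_right ?_ hc'
    nlinarith
  have h5 : 0 < Real.pi ^ 2 := by positivity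
  refine le_of_mul_le_mul_right (a := Real.pi ^ 2) ?_ h5
  have h6 : 0 ≤ Real.pi ^ 3 * (1 + 2 ^ α) ^ 3 * (1 + c) ^ 2 := by positivity
  nlinarith

/-! ### The reduced system: a priori bounds and comparison of two small solutions. -/

/-- The equations for the amplitude `a`, the speed `c` and the remaining Fourier modes `r` of a
solution `a cos x + ∑ r n e^{inx}`. -/
structure Reduced (α a c : ℝ) (r : ℤ → ℂ) : Prop where
  sq : SqSummable r
  low : ∀ n, |n| ≤ 1 → r n = 0
  one : (((1 + c) * a / 2 : ℝ) : ℂ) = a * r 2 + conv r r 1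
  eqn : ∀ n : ℤ, 2 ≤ |n| → ((|(n : ℝ)| ^ α + c : ℝ) : ℂ) * r n =
    (if |n| = 2 then ((a ^ 2 / 4 : ℝ) : ℂ) else 0) + a * (r (n - 1) + r (n + 1)) + conv r r n

/-- Lower bound for `(|n|^α + c) / |n|^α` on `|n| ≥ 2`. -/
def gap (α : ℝ) : ℝ := 1 - 2 ^ (-α)

lemma gap_pos {α : ℝ} (hα : 0 < α) : 0 < gap α := by
  have : (2 : ℝ) ^ (-α) < 1 := Real.rpow_lt_one_of_one_lt_of_neg (by norm_num) (by linarith)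
  unfold gap; linarith

lemma two_le_abs_cast {n : ℤ} (hn : 2 ≤ |n|) : (2 : ℝ) ≤ |(n : ℝ)| := by
  rw [← Int.cast_abs]; exact_mod_cast hn

lemma gap_mul_le {α c : ℝ} (hα : 0 < α) (hc : -1 < c) {n : ℤ} (hn : 2 ≤ |n|) :
    gap α * |(n : ℝ)| ^ α ≤ |(n : ℝ)| ^ α + c := by
  have h2 := two_le_abs_cast hn
  have h3 : (2 : ℝ) ^ α ≤ |(n : ℝ)| ^ α := Real.rpow_le_rpow (by norm_num) h2 hα.le
  have h4 : (2 : ℝ) ^ (-α) * 2 ^ α = 1 := by rw [← Real.rpow_add (by norm_num)]; simp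
  have h5 : 0 < (2 : ℝ) ^ (-α) := by positivity
  unfold gap
  nlinarith [mul_le_mul_of_nonneg_left h3 h5.le]

lemma norm_le_of_symbol {α c : ℝ} (hα : 0 < α) (hc : -1 < c) {n : ℤ} (hn : 2 ≤ |n|) {z w : ℂ}
    (h : ((|(n : ℝ)| ^ α + c : ℝ) : ℂ) * z = w) :
    |(n : ℝ)| ^ α * ‖z‖ ≤ (gap α)⁻¹ * ‖w‖ := by
  have h1 := gap_mul_le hα hc hn
  have hg := gap_pos hα
  have h0 : 0 ≤ |(n : ℝ)| ^ α := by positivity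
  have h2 : 0 ≤ |(n : ℝ)| ^ α + c := le_trans (mul_nonneg hg.le h0) h1
  rw [← h, norm_mul, Complex.norm_real, Real.norm_of_nonneg h2, inv_mul_eq_div, le_div_iff₀ hg]
  nlinarith [norm_nonneg z, mul_le_mul_of_nonneg_right h1 (norm_nonneg z)]

lemma norm_le_mul_rpow_neg {α : ℝ} {n : ℤ} (hn : 2 ≤ |n|) {x M : ℝ}
    (h : |(n : ℝ)| ^ α * x ≤ M) : x ≤ M * |(n : ℝ)| ^ (-α) := by
  have h2 := two_le_abs_cast hn
  have h0 : 0 < |(n : ℝ)| ^ α := Real.rpow_pos_of_pos (by linarith) _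
  rw [Real.rpow_neg (abs_nonneg _), ← div_eq_mul_inv, le_div_iff₀ h0]
  linarith

/-- A constant controlling the inverse of the linear part on `ℓ²`. -/
def invBound (α : ℝ) : ℝ := (gap α)⁻¹ * √(∑' n : ℤ, (|(n : ℝ)| ^ (-α)) ^ 2) + 1

lemma one_le_invBound {α : ℝ} (hα : 0 < α) : 1 ≤ invBound α := by
  have := inv_nonneg.2 (gap_pos hα).le
  unfold invBound
  nlinarith [mul_nonneg this (Real.sqrt_nonneg (∑' n : ℤ, (|(n : ℝ)| ^ (-α)) ^ 2))]

/-- A supremum bound on the right-hand side suffices, because inverting the symbol gains `|n|^{-α}`,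
which is square summable. Convolutions of `ℓ²` sequences are bounded, so the quadratic term closes
in `ℓ²`, with a constant uniform in `c > -1`. -/
lemma l2_le_invBound {α c : ℝ} (hα : 1 / 2 < α) (hc : -1 < c) {r w : ℤ → ℂ} {M : ℝ} (hM : 0 ≤ M)
    (low : ∀ n, |n| ≤ 1 → r n = 0)
    (h : ∀ n : ℤ, 2 ≤ |n| → ((|(n : ℝ)| ^ α + c : ℝ) : ℂ) * r n = w n)
    (hw : ∀ n : ℤ, 2 ≤ |n| → ‖w n‖ ≤ M) : l2 r ≤ invBound α * M := by
  have hα0 : 0 < α := by linarith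
  have hg := inv_nonneg.2 (gap_pos hα0).le
  have key : ∀ n, ‖r n‖ ≤ ((gap α)⁻¹ * M) * |(n : ℝ)| ^ (-α) := by
    intro n
    by_cases hn : 2 ≤ |n|
    · refine norm_le_mul_rpow_neg hn ((norm_le_of_symbol hα0 hc hn (h n hn)).trans ?_)
      exact mul_le_mul_of_nonneg_left (hw n hn) hg
    · rw [low n (by omega), norm_zero]; positivity
  refine (l2_le_of_le (by positivity) (summable_abs_rpow_sq hα) key).trans ?_
  unfold invBound
  nlinarith

lemma ite_norm_le {n : ℤ} {x : ℝ} (hx : 0 ≤ x) :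
    ‖(if |n| = 2 then ((x : ℝ) : ℂ) else 0)‖ ≤ x := by
  split_ifs
  · rw [Complex.norm_real, Real.norm_of_nonneg hx]
  · simpa using hx

/-- Small solutions of the reduced system are quadratically small. -/
lemma Reduced.l2_le {α : ℝ} (hα : 1 / 2 < α) {a c : ℝ} {r : ℤ → ℂ} (h : Reduced α a c r)
    (hc : -1 < c) (ha : 0 ≤ a) (ha' : a ≤ (6 * invBound α)⁻¹) (hr : l2 r ≤ (6 * invBound α)⁻¹) :
    l2 r ≤ 2 * invBound α * a ^ 2 := by
  have hG := one_le_invBound (by linarith : 0 < α)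
  set G := invBound α
  have hL := l2_nonneg r
  have hb : l2 r ≤ G * (a ^ 2 / 4 + a * (l2 r + l2 r) + l2 r * l2 r) := by
    refine l2_le_invBound hα hc (by positivity) h.low h.eqn fun n hn => ?_
    refine (norm_add_le _ _).trans (add_le_add ((norm_add_le _ _).trans
      (add_le_add (ite_norm_le (by positivity)) ?_)) (norm_conv_le h.sq h.sq n))
    rw [norm_mul, Complex.norm_real, Real.norm_of_nonneg ha]
    exact mul_le_mul_of_nonneg_left ((norm_add_le _ _).trans (add_le_add (norm_le_l2 h.sq _)
      (norm_le_l2 h.sq _))) ha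
  -- The thresholds make the coupling and quadratic terms at most `l2 r / 3` and `l2 r / 6`, so half
  -- of `l2 r` is absorbed and only the source `a² / 4` remains.
  have h1 : G * a ≤ 1 / 6 := by
    calc G * a ≤ G * (6 * G)⁻¹ := by gcongr
      _ = 1 / 6 := by field_simp
  have h2 : G * l2 r ≤ 1 / 6 := by
    calc G * l2 r ≤ G * (6 * G)⁻¹ := by gcongr
      _ = 1 / 6 := by field_simp
  nlinarith [mul_le_mul_of_nonneg_right h1 hL, mul_le_mul_of_nonneg_right h2 hL, sq_nonneg a]

/-- Comparison of two small solutions of the reduced system, `ℓ²` part. -/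
lemma Reduced.exists_l2_sub_le {α : ℝ} (hα : 1 / 2 < α) (C₀ : ℝ) (hC₀ : 0 ≤ C₀) :
    ∃ ε > 0, ε ≤ 1 ∧ ∃ C ≥ 0, ∀ a c r a' c' r', Reduced α a c r → Reduced α a' c' r' → -1 < c →
      0 < a' → a' ≤ a → a ≤ ε → l2 r ≤ C₀ * a ^ 2 → l2 r' ≤ C₀ * a' ^ 2 →
      l2 (fun n => r n - r' n) ≤ C * (|c - c'| * a ^ 2 + a * (a - a')) := by
  have hG := one_le_invBound (by linarith : 0 < α)
  set G := invBound α
  refine ⟨(4 * G * (1 + C₀))⁻¹, by positivity, inv_le_one_of_one_le₀ (by nlinarith),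
    4 * G * (1 + C₀), by positivity, ?_⟩
  intro a c r a' c' r' h h' hc ha' haa ha hr hr'
  have ha0 : 0 < a := by linarith
  have h1 : G * (1 + C₀) * a ≤ 1 / 4 := by
    calc _ ≤ G * (1 + C₀) * (4 * G * (1 + C₀))⁻¹ := by gcongr
      _ = 1 / 4 := by field_simp
  have ha1 : a ≤ 1 := by nlinarith [mul_nonneg (by linarith : (0:ℝ) ≤ G) hC₀]
  set d : ℤ → ℂ := fun n => r n - r' n with hd
  have hds : SqSummable d := h.sq.sub h'.sq
  have hl := l2_nonneg d
  have haa2 : a' ^ 2 ≤ a ^ 2 := by gcongr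
  have hr'2 : l2 r' ≤ C₀ * a ^ 2 := hr'.trans (by gcongr)
  have hb : l2 d ≤ G * (|c - c'| * (C₀ * a ^ 2) + (a ^ 2 - a' ^ 2) / 4 +
      (a * (l2 d + l2 d) + (a - a') * (C₀ * a ^ 2 + C₀ * a ^ 2)) +
      l2 d * (C₀ * a ^ 2 + C₀ * a ^ 2)) := by
    -- The mode equations are subtracted with the symbol taken at `c`. The mismatch in speed appears
    -- as the source `-(c - c') r'`, which carries a factor `a²`.
    have haa0 : 0 ≤ a - a' := by linarith
    have haa3 : 0 ≤ a ^ 2 - a' ^ 2 := by linarith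
    refine l2_le_invBound (c := c) (w := fun n => -((c - c' : ℝ) : ℂ) * r' n
        + (if |n| = 2 then (((a ^ 2 - a' ^ 2) / 4 : ℝ) : ℂ) else 0)
        + (a * (d (n - 1) + d (n + 1)) + ((a - a' : ℝ) : ℂ) * (r' (n - 1) + r' (n + 1)))
        + (conv r r n - conv r' r' n)) hα hc (by positivity)
      (fun n hn => by simp [hd, h.low n hn, h'.low n hn]) (fun n hn => ?_) fun n hn => ?_
    · have e1 := h.eqn n hn
      have e2 := h'.eqn n hn
      simp only [hd]
      have e3 : (if |n| = 2 then (((a ^ 2 - a' ^ 2) / 4 : ℝ) : ℂ) else 0)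
          = (if |n| = 2 then ((a ^ 2 / 4 : ℝ) : ℂ) else 0)
            - (if |n| = 2 then ((a' ^ 2 / 4 : ℝ) : ℂ) else 0) := by
        split_ifs <;> push_cast <;> ring
      rw [e3]
      push_cast at e1 e2 ⊢
      linear_combination e1 - e2
    · refine (norm_add_le _ _).trans (add_le_add ((norm_add_le _ _).trans (add_le_add
        ((norm_add_le _ _).trans (add_le_add ?_ (ite_norm_le (by positivity))))
        ((norm_add_le _ _).trans (add_le_add ?_ ?_)))) ?_)
      · rw [norm_mul, norm_neg, Complex.norm_real, Real.norm_eq_abs]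
        exact mul_le_mul_of_nonneg_left ((norm_le_l2 h'.sq _).trans hr'2) (abs_nonneg _)
      · rw [norm_mul, Complex.norm_real, Real.norm_of_nonneg ha0.le]
        exact mul_le_mul_of_nonneg_left ((norm_add_le _ _).trans (add_le_add (norm_le_l2 hds _)
          (norm_le_l2 hds _))) ha0.le
      · rw [norm_mul, Complex.norm_real, Real.norm_of_nonneg haa0]
        exact mul_le_mul_of_nonneg_left ((norm_add_le _ _).trans (add_le_add
          ((norm_le_l2 h'.sq _).trans hr'2) ((norm_le_l2 h'.sq _).trans hr'2))) haa0
      · exact (norm_conv_self_sub_le h.sq h'.sq n).trans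
          (mul_le_mul_of_nonneg_left (add_le_add hr hr'2) hl)
  -- The terms containing `d` itself are absorbed on the left; this is the purpose of the choice of
  -- `ε`.
  have h3 : G * (a * (l2 d + l2 d) + l2 d * (C₀ * a ^ 2 + C₀ * a ^ 2)) ≤ l2 d / 2 := by
    have : a * (l2 d + l2 d) + l2 d * (C₀ * a ^ 2 + C₀ * a ^ 2) ≤ 2 * ((1 + C₀) * a * l2 d) := by
      have : C₀ * a ^ 2 * l2 d ≤ C₀ * a * l2 d := by
        gcongr; nlinarith
      nlinarith
    nlinarith [mul_le_mul_of_nonneg_left this (by linarith : (0:ℝ) ≤ G),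
      mul_le_mul_of_nonneg_right h1 hl]
  have h4 : |c - c'| * (C₀ * a ^ 2) + (a ^ 2 - a' ^ 2) / 4 + (a - a') * (C₀ * a ^ 2 + C₀ * a ^ 2)
      ≤ 2 * ((1 + C₀) * (|c - c'| * a ^ 2 + a * (a - a'))) := by
    have e1 : 0 ≤ |c - c'| * a ^ 2 := by positivity
    have e2 : 0 ≤ a * (a - a') := mul_nonneg ha0.le (by linarith)
    have e3 : (a ^ 2 - a' ^ 2) / 4 ≤ a * (a - a') := by nlinarith
    have e4 : C₀ * ((a - a') * a ^ 2) ≤ C₀ * (a * (a - a')) := by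
      refine mul_le_mul_of_nonneg_left ?_ hC₀
      have : a ^ 2 ≤ a := by nlinarith
      nlinarith [mul_le_mul_of_nonneg_left this (by linarith : 0 ≤ a - a')]
    nlinarith [mul_nonneg hC₀ e1]
  have h5 := mul_le_mul_of_nonneg_left h4 (by linarith : (0:ℝ) ≤ G)
  nlinarith

-- With `d = r - r'`, mode one divided by the amplitude says `(c - c') / 2 ≈ d 2`, and mode two says
-- `(2^α + c) d 2 ≈ (a² - a'²) / 4`. Eliminating `d 2` leaves the relation between speeds and
-- squared amplitudes, with errors carrying an extra factor `a`.
set_option maxHeartbeats 1000000 in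
lemma Reduced.exists_speed_compare {α : ℝ} (hα : 1 / 2 < α) (C₀ : ℝ) (hC₀ : 0 ≤ C₀) :
    ∃ ε > 0, ε ≤ 1 ∧ ∃ C ≥ 0, ∀ a c r a' c' r', Reduced α a c r → Reduced α a' c' r' →
      -1 < c → c ≤ 0 → 0 < a' → a' ≤ a → a ≤ ε → l2 r ≤ C₀ * a ^ 2 → l2 r' ≤ C₀ * a' ^ 2 →
      |(2 ^ α + c) / 2 * (c - c') - (a ^ 2 - a' ^ 2) / 4|
        ≤ C * a * (|c - c'| + (a ^ 2 - a' ^ 2)) := by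
  obtain ⟨ε₁, hε₁, hε₁1, C₁, hC₁, H⟩ := Reduced.exists_l2_sub_le hα C₀ hC₀
  have hα0 : 0 < α := by linarith
  set A : ℝ := 2 ^ α with hA
  have hA1 : 1 < A := Real.one_lt_rpow (by norm_num) hα0
  refine ⟨ε₁, hε₁, hε₁1, C₀ + (1 + 2 * C₀) * C₁ + C₀ + A * (2 * C₀ * C₁ + C₀ ^ 2), by positivity, ?_⟩
  intro a c r a' c' r' h h' hc hc0 ha' haa ha hr hr'
  have hl := H a c r a' c' r' h h' hc ha' haa ha hr hr'
  set d : ℤ → ℂ := fun n => r n - r' n with hd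
  have hds : SqSummable d := h.sq.sub h'.sq
  have ha0 : 0 < a := by linarith
  have ha1 : a ≤ 1 := by linarith
  have haa0 : 0 ≤ a - a' := by linarith
  have haa2 : a' ^ 2 ≤ a ^ 2 := by gcongr
  have hr'2 : l2 r' ≤ C₀ * a ^ 2 := hr'.trans (by gcongr)
  have hl0 := l2_nonneg d
  set X := |c - c'| + (a ^ 2 - a' ^ 2) with hX
  have hX0 : 0 ≤ X := add_nonneg (abs_nonneg _) (by linarith)
  have hX1 : a * (a - a') ≤ a ^ 2 - a' ^ 2 := by
    have := mul_nonneg ha'.le haa0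
    linarith
  have hsqa : a ^ 2 ≤ a := by
    have := mul_le_mul_of_nonneg_left ha1 ha0.le
    linarith
  have hcX : |c - c'| * a ^ 2 ≤ a * X := by
    have h1 := mul_le_mul_of_nonneg_left hsqa (abs_nonneg (c - c'))
    have h2 := mul_nonneg ha0.le (by linarith : (0:ℝ) ≤ a ^ 2 - a' ^ 2)
    rw [hX]
    linarith
  have haX : a ^ 2 * (a - a') ≤ a * X := by
    have h1 := mul_le_mul_of_nonneg_left hX1 ha0.le
    have h2 := mul_nonneg ha0.le (abs_nonneg (c - c'))
    rw [hX]
    linarith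
  have hlX : l2 d ≤ C₁ * X := by
    refine hl.trans (mul_le_mul_of_nonneg_left ?_ hC₁)
    have h1 := mul_le_mul_of_nonneg_left (hsqa.trans ha1) (abs_nonneg (c - c'))
    rw [hX]
    linarith
  have halX : a * l2 d ≤ C₁ * (a * X) := by
    have h1 := mul_le_mul_of_nonneg_left hlX ha0.le
    linarith
  -- the second mode
  have e2 : ((A + c : ℝ) : ℂ) * d 2 - (((a ^ 2 - a' ^ 2) / 4 : ℝ) : ℂ)
      = -((c - c' : ℝ) : ℂ) * r' 2 + a * d 3 + ((a - a' : ℝ) : ℂ) * r' 3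
        + (conv r r 2 - conv r' r' 2) := by
    have f1 := h.eqn 2 (by norm_num)
    have f2 := h'.eqn 2 (by norm_num)
    have g1 := h.low 1 (by norm_num)
    have g2 := h'.low 1 (by norm_num)
    norm_num [g1, g2] at f1 f2
    simp only [hd, hA]
    push_cast
    linear_combination f1 - f2
  have n2 : ‖((A + c : ℝ) : ℂ) * d 2 - (((a ^ 2 - a' ^ 2) / 4 : ℝ) : ℂ)‖
      ≤ |c - c'| * (C₀ * a ^ 2) + a * l2 d + (a - a') * (C₀ * a ^ 2)
        + l2 d * (C₀ * a ^ 2 + C₀ * a ^ 2) := by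
    rw [e2]
    refine (norm_add_le _ _).trans (add_le_add ((norm_add_le _ _).trans (add_le_add
      ((norm_add_le _ _).trans (add_le_add ?_ ?_)) ?_)) ?_)
    · rw [norm_mul, norm_neg, Complex.norm_real, Real.norm_eq_abs]
      exact mul_le_mul_of_nonneg_left ((norm_le_l2 h'.sq _).trans hr'2) (abs_nonneg _)
    · rw [norm_mul, Complex.norm_real, Real.norm_of_nonneg ha0.le]
      exact mul_le_mul_of_nonneg_left (norm_le_l2 hds _) ha0.le
    · rw [norm_mul, Complex.norm_real, Real.norm_of_nonneg haa0]
      exact mul_le_mul_of_nonneg_left ((norm_le_l2 h'.sq _).trans hr'2) haa0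
    · exact (norm_conv_self_sub_le h.sq h'.sq 2).trans
        (mul_le_mul_of_nonneg_left (add_le_add hr hr'2) hl0)
  -- the first mode
  have e1 : (((c - c') / 2 : ℝ) : ℂ) - d 2 = (a : ℂ)⁻¹ * (conv r r 1 - conv r' r' 1)
      - (((a - a') * (a * a')⁻¹ : ℝ) : ℂ) * conv r' r' 1 := by
    have f1 := h.one
    have f2 := h'.one
    have hac : (a : ℂ) ≠ 0 := by exact_mod_cast ha0.ne'
    have hac' : (a' : ℂ) ≠ 0 := by exact_mod_cast ha'.ne'
    have f1' : conv r r 1 = (a : ℂ) * ((1 + c) / 2 - r 2) := by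
      push_cast at f1; linear_combination -f1
    have f2' : conv r' r' 1 = (a' : ℂ) * ((1 + c') / 2 - r' 2) := by
      push_cast at f2; linear_combination -f2
    rw [f1', f2']
    simp only [hd]
    push_cast
    field_simp
    ring
  have n1 : ‖(((c - c') / 2 : ℝ) : ℂ) - d 2‖ ≤ 2 * C₀ * (a * l2 d)
      + C₀ ^ 2 * (a ^ 2 * (a - a')) := by
    rw [e1]
    refine (norm_sub_le _ _).trans (add_le_add ?_ ?_)
    · rw [norm_mul, norm_inv, Complex.norm_real, Real.norm_of_nonneg ha0.le, inv_mul_eq_div,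
        div_le_iff₀ ha0]
      refine ((norm_conv_self_sub_le h.sq h'.sq 1).trans
        (mul_le_mul_of_nonneg_left (add_le_add hr hr'2) hl0)).trans_eq ?_
      ring
    · rw [norm_mul, Complex.norm_real, Real.norm_of_nonneg (by positivity)]
      have : ‖conv r' r' 1‖ ≤ (C₀ * a' ^ 2) * (C₀ * a' ^ 2) :=
        (norm_conv_le h'.sq h'.sq 1).trans (mul_le_mul hr' hr' (l2_nonneg _) (by positivity))
      -- The singular factor `1 / (a a')` is harmless, since the convolution is of order `a'⁴` and
      -- `a' ≤ a`.
      calc (a - a') * (a * a')⁻¹ * ‖conv r' r' 1‖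
          ≤ (a - a') * (a * a')⁻¹ * ((C₀ * a' ^ 2) * (C₀ * a' ^ 2)) := by gcongr
        _ = C₀ ^ 2 * ((a - a') * (a' ^ 3 / a)) := by field_simp
        _ ≤ C₀ ^ 2 * ((a - a') * a ^ 2) := by
            have : a' ^ 3 / a ≤ a ^ 2 := by
              rw [div_le_iff₀ ha0, ← pow_succ]; gcongr
            gcongr
        _ = _ := by ring
  have hAc : 0 < A + c := by linarith
  have hAc' : A + c ≤ A := by linarith
  have ht : |(A + c) / 2 * (c - c') - (a ^ 2 - a' ^ 2) / 4|
      ≤ (A + c) * ‖(((c - c') / 2 : ℝ) : ℂ) - d 2‖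
        + ‖((A + c : ℝ) : ℂ) * d 2 - (((a ^ 2 - a' ^ 2) / 4 : ℝ) : ℂ)‖ := by
    rw [← Real.norm_eq_abs, ← Complex.norm_real]
    have : (((A + c) / 2 * (c - c') - (a ^ 2 - a' ^ 2) / 4 : ℝ) : ℂ)
        = ((A + c : ℝ) : ℂ) * ((((c - c') / 2 : ℝ) : ℂ) - d 2)
          + (((A + c : ℝ) : ℂ) * d 2 - (((a ^ 2 - a' ^ 2) / 4 : ℝ) : ℂ)) := by
      push_cast; ring
    rw [this]
    refine (norm_add_le _ _).trans (add_le_add ?_ le_rfl)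
    rw [norm_mul, Complex.norm_real, Real.norm_of_nonneg hAc.le]
  have n1' : ‖(((c - c') / 2 : ℝ) : ℂ) - d 2‖ ≤ (2 * C₀ * C₁ + C₀ ^ 2) * (a * X) := by
    have := mul_le_mul_of_nonneg_left halX (by positivity : (0:ℝ) ≤ 2 * C₀)
    have := mul_le_mul_of_nonneg_left haX (by positivity : (0:ℝ) ≤ C₀ ^ 2)
    linarith
  have n2' : ‖((A + c : ℝ) : ℂ) * d 2 - (((a ^ 2 - a' ^ 2) / 4 : ℝ) : ℂ)‖
      ≤ (C₀ + (1 + 2 * C₀) * C₁ + C₀) * (a * X) := by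
    have f1 := mul_le_mul_of_nonneg_left hcX hC₀
    have f2 := mul_le_mul_of_nonneg_left haX hC₀
    have f3 : l2 d * (C₀ * a ^ 2 + C₀ * a ^ 2) ≤ 2 * C₀ * (a * l2 d) := by
      have := mul_le_mul_of_nonneg_left hsqa (mul_nonneg hC₀ hl0)
      linarith
    have f4 := mul_le_mul_of_nonneg_left halX (by positivity : (0:ℝ) ≤ 1 + 2 * C₀)
    linarith
  have n1'' := mul_le_mul hAc' n1' (norm_nonneg _) (by linarith : (0:ℝ) ≤ A)
  linarith
/-- Two small solutions: the speed is a bi-Lipschitz increasing function of the squared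
amplitude. -/
lemma Reduced.exists_compare {α : ℝ} (hα : 1 / 2 < α) (C₀ : ℝ) (hC₀ : 0 ≤ C₀) :
    ∃ ε > 0, ε ≤ 1 ∧ ∃ C ≥ 0, ∀ a c r a' c' r', Reduced α a c r → Reduced α a' c' r' → -1 < c →
      c ≤ 0 → 0 < a' → a' ≤ a → a ≤ ε → l2 r ≤ C₀ * a ^ 2 → l2 r' ≤ C₀ * a' ^ 2 →
      0 ≤ c - c' ∧ c - c' ≤ C * (a ^ 2 - a' ^ 2) ∧ a ^ 2 - a' ^ 2 ≤ C * (c - c') ∧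
      l2 (fun n => r n - r' n) ≤ C * ((c - c') + (a - a')) := by
  obtain ⟨ε₁, hε₁, hε₁1, C₁, hC₁, H⟩ := Reduced.exists_l2_sub_le hα C₀ hC₀
  obtain ⟨ε₂, hε₂, -, C₃, hC₃, key⟩ := Reduced.exists_speed_compare hα C₀ hC₀
  have hα0 : 0 < α := by linarith
  set A : ℝ := 2 ^ α with hA
  have hA1 : 1 < A := Real.one_lt_rpow (by norm_num) hα0
  have hg : 0 < A - 1 := by linarith
  -- The last two thresholds keep the error below half of each principal coefficient, namely `1 / 4`
  -- for the squared amplitudes and `(A - 1) / 2 ≤ (A + c) / 2` for the speeds.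
  refine ⟨min (min ε₁ ε₂) (min (8 * (C₃ + 1))⁻¹ ((A - 1) / (4 * (C₃ + 1)))), by positivity,
    ((min_le_left _ _).trans (min_le_left _ _)).trans hε₁1, 2 / (A - 1) + 6 * A + C₁, by positivity, ?_⟩
  intro a c r a' c' r' h h' hc hc0 ha' haa ha hr hr'
  have ha1 : a ≤ ε₁ := ha.trans ((min_le_left _ _).trans (min_le_left _ _))
  have ha1' : a ≤ ε₂ := ha.trans ((min_le_left _ _).trans (min_le_right _ _))
  have ha2 : C₃ * a ≤ 1 / 8 := by
    have h1 : a ≤ (8 * (C₃ + 1))⁻¹ := ha.trans ((min_le_right _ _).trans (min_le_left _ _))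
    calc C₃ * a ≤ (C₃ + 1) * (8 * (C₃ + 1))⁻¹ := by gcongr <;> linarith
      _ = 1 / 8 := by field_simp
  have ha3 : C₃ * a ≤ (A - 1) / 4 := by
    have h1 : a ≤ (A - 1) / (4 * (C₃ + 1)) := ha.trans ((min_le_right _ _).trans (min_le_right _ _))
    calc C₃ * a ≤ (C₃ + 1) * ((A - 1) / (4 * (C₃ + 1))) := by gcongr <;> linarith
      _ = (A - 1) / 4 := by field_simp
  have hk := key a c r a' c' r' h h' hc hc0 ha' haa ha1' hr hr'
  have hl := H a c r a' c' r' h h' hc ha' haa ha1 hr hr'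
  have ha0 : 0 < a := by linarith
  have haa2 : a' ^ 2 ≤ a ^ 2 := by gcongr
  set s := a ^ 2 - a' ^ 2 with hs
  have hs0 : 0 ≤ s := by linarith
  have hx0 := abs_nonneg (c - c')
  have hk2 : C₃ * a * (|c - c'| + s) ≤ (A - 1) / 4 * |c - c'| + 1 / 8 * s := by
    have h1 := mul_le_mul_of_nonneg_right ha3 hx0
    have h2 := mul_le_mul_of_nonneg_right ha2 hs0
    linarith
  have hk3 := abs_le.1 (hk.trans hk2)
  have hx : 0 ≤ c - c' := by
    by_contra hneg
    push Not at hneg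
    rw [abs_of_neg hneg] at hk3
    have : (A - 1) / 2 * (c' - c) ≤ (A + c) / 2 * (c' - c) := by
      have : 0 ≤ c' - c := by linarith
      gcongr
      linarith
    nlinarith [hk3.1, mul_pos hg (by linarith : 0 < c' - c)]
  rw [abs_of_nonneg hx] at hk3 hl
  have hq1 : (A - 1) / 2 * (c - c') ≤ (A + c) / 2 * (c - c') := by
    gcongr; linarith
  have hq2 : (A + c) / 2 * (c - c') ≤ A / 2 * (c - c') := by
    gcongr; linarith
  have hr1 : (A - 1) * (c - c') ≤ 2 * s := by linarith [hk3.2]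
  have hr2 : s ≤ (4 * A + 2 * (A - 1)) * (c - c') := by linarith [hk3.1]
  refine ⟨hx, ?_, ?_, ?_⟩
  · have h1 : c - c' ≤ 2 / (A - 1) * s := by
      rw [div_mul_eq_mul_div, le_div_iff₀ hg]; linarith
    have h2 := mul_nonneg (by positivity : (0:ℝ) ≤ 6 * A + C₁) hs0
    linarith
  · have h0 : 0 ≤ 2 / (A - 1) + C₁ := by positivity
    have h1 := mul_nonneg h0 hx
    linarith
  · refine hl.trans ?_
    have h1 : (c - c') * a ^ 2 + a * (a - a') ≤ (c - c') + (a - a') := by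
      have : a ≤ 1 := by linarith
      have : a ^ 2 ≤ 1 := pow_le_one₀ ha0.le this
      have h4 := mul_le_mul_of_nonneg_left this hx
      have h5 := mul_le_mul_of_nonneg_right ‹a ≤ 1› (by linarith : 0 ≤ a - a')
      linarith
    have h2 : 0 ≤ (c - c') + (a - a') := by linarith
    have h3 : (0:ℝ) ≤ 2 / (A - 1) + 6 * A := by positivity
    have h4 := mul_le_mul_of_nonneg_left h1 hC₁
    have h5 := mul_nonneg h3 h2
    linarith

/-! ### Regularity bootstrap and expansion of the modes. -/

/-- The sequence `|n|^s r n`. -/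
def wseq (s : ℝ) (r : ℤ → ℂ) (n : ℤ) : ℂ := ((|(n : ℝ)| ^ s : ℝ) : ℂ) * r n

lemma norm_wseq (s : ℝ) (r : ℤ → ℂ) (n : ℤ) : ‖wseq s r n‖ = |(n : ℝ)| ^ s * ‖r n‖ := by
  rw [wseq, norm_mul, Complex.norm_real, Real.norm_of_nonneg (by positivity)]

lemma abs_rpow_add_le {s : ℝ} (hs : 0 ≤ s) (x y : ℝ) :
    |x + y| ^ s ≤ 2 ^ s * (|x| ^ s + |y| ^ s) := by
  have h1 : |x + y| ≤ 2 * max |x| |y| :=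
    (abs_add_le x y).trans (by linarith [le_max_left |x| |y|, le_max_right |x| |y|])
  have h2 : (max |x| |y|) ^ s ≤ |x| ^ s + |y| ^ s := by
    rcases max_choice |x| |y| with h | h <;> rw [h]
    · linarith [Real.rpow_nonneg (abs_nonneg y) s]
    · linarith [Real.rpow_nonneg (abs_nonneg x) s]
  calc |x + y| ^ s ≤ (2 * max |x| |y|) ^ s := Real.rpow_le_rpow (abs_nonneg _) h1 hs
    _ = 2 ^ s * (max |x| |y|) ^ s := Real.mul_rpow (by norm_num) (by positivity)
    _ ≤ _ := by gcongr

/-- By `|n|^s ≤ 2^s (|k|^s + |n - k|^s)` the weight always falls on one of the two factors. -/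
lemma norm_conv_weight_le {s : ℝ} (hs : 0 ≤ s) {r : ℤ → ℂ} (hr : SqSummable r)
    (hw : SqSummable (wseq s r)) (n : ℤ) :
    |(n : ℝ)| ^ s * ‖conv r r n‖ ≤ 2 ^ s * (2 * (l2 (wseq s r) * l2 r)) := by
  have s1 := hw.summable_mul (hr.reflect n)
  have s2 := hr.summable_mul (hw.reflect n)
  have b1 := tsum_norm_mul_le hw (hr.reflect n)
  have b2 := tsum_norm_mul_le hr (hw.reflect n)
  rw [l2_reflect] at b1 b2
  have s0 : Summable fun k => ‖r k * r (n - k)‖ := by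
    simpa only [norm_mul] using hr.summable_mul (hr.reflect n)
  calc |(n : ℝ)| ^ s * ‖conv r r n‖ ≤ |(n : ℝ)| ^ s * ∑' k, ‖r k * r (n - k)‖ :=
        mul_le_mul_of_nonneg_left (norm_tsum_le_tsum_norm s0) (by positivity)
    _ = ∑' k, |(n : ℝ)| ^ s * ‖r k * r (n - k)‖ := tsum_mul_left.symm
    _ ≤ ∑' k, 2 ^ s * (‖wseq s r k‖ * ‖r (n - k)‖ + ‖r k‖ * ‖wseq s r (n - k)‖) := by
        refine (s0.mul_left _).tsum_le_tsum (fun k => ?_) ((s1.add s2).mul_left _)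
        have := abs_rpow_add_le hs (k : ℝ) ((n - k : ℤ) : ℝ)
        rw [show (k : ℝ) + ((n - k : ℤ) : ℝ) = n by push_cast; ring] at this
        rw [norm_wseq, norm_wseq, norm_mul]
        calc _ ≤ (2 ^ s * (|(k : ℝ)| ^ s + |((n - k : ℤ) : ℝ)| ^ s)) * (‖r k‖ * ‖r (n - k)‖) := by
              gcongr
          _ = _ := by ring
    _ = 2 ^ s * (∑' k, ‖wseq s r k‖ * ‖r (n - k)‖ + ∑' k, ‖r k‖ * ‖wseq s r (n - k)‖) := by
        rw [tsum_mul_left, s1.tsum_add s2]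
    _ ≤ _ := by
        gcongr
        linarith

lemma weight_shift_le {s : ℝ} (hs : 0 ≤ s) {n m : ℤ} (hn : 2 ≤ |n|) (hm : m = n - 1 ∨ m = n + 1) :
    |(n : ℝ)| ^ s ≤ 2 ^ s * |(m : ℝ)| ^ s := by
  rw [← Real.mul_rpow (by norm_num) (abs_nonneg _)]
  refine Real.rpow_le_rpow (abs_nonneg _) ?_ hs
  have : |n| ≤ 2 * |m| := by
    rcases abs_cases n with ⟨h1, _⟩ | ⟨h1, _⟩ <;> rcases abs_cases m with ⟨h2, _⟩ | ⟨h2, _⟩ <;>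
      rcases hm with h | h <;> omega
  rw [← Int.cast_abs, ← Int.cast_abs]
  exact_mod_cast this

lemma weight_shift_norm_le {s : ℝ} (hs : 0 ≤ s) {n m : ℤ} (hn : 2 ≤ |n|)
    (hm : m = n - 1 ∨ m = n + 1) {r : ℤ → ℂ} {M : ℝ} (hM : |(m : ℝ)| ^ s * ‖r m‖ ≤ M) :
    |(n : ℝ)| ^ s * ‖r m‖ ≤ 2 ^ s * M := by
  calc _ ≤ (2 ^ s * |(m : ℝ)| ^ s) * ‖r m‖ :=
        mul_le_mul_of_nonneg_right (weight_shift_le hs hn hm) (norm_nonneg _)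
    _ = 2 ^ s * (|(m : ℝ)| ^ s * ‖r m‖) := by ring
    _ ≤ _ := by gcongr

lemma weight_eqn_le {α s a c : ℝ} (hα : 0 < α) (hs : 0 ≤ s) (ha : 0 ≤ a) (hc : -1 < c)
    {r : ℤ → ℂ} (h : Reduced α a c r) {n : ℤ} (hn : 2 ≤ |n|) {B M Q : ℝ}
    (hB : |(n : ℝ)| ^ s * ‖(if |n| = 2 then ((a ^ 2 / 4 : ℝ) : ℂ) else 0)‖ ≤ B)
    (h1 : |((n - 1 : ℤ) : ℝ)| ^ s * ‖r (n - 1)‖ ≤ M)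
    (h2 : |((n + 1 : ℤ) : ℝ)| ^ s * ‖r (n + 1)‖ ≤ M)
    (hQ : |(n : ℝ)| ^ s * ‖conv r r n‖ ≤ Q) :
    |(n : ℝ)| ^ α * (|(n : ℝ)| ^ s * ‖r n‖) ≤ (gap α)⁻¹ * (B + a * (2 ^ s * (2 * M)) + Q) := by
  have h0 : 0 ≤ |(n : ℝ)| ^ s := by positivity
  have e1 := weight_shift_norm_le hs hn (Or.inl rfl) h1
  have e2 := weight_shift_norm_le hs hn (Or.inr rfl) h2
  have e3 := norm_le_of_symbol hα hc hn (h.eqn n hn)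
  have hg := inv_nonneg.2 (gap_pos hα).le
  have e4 : ‖(if |n| = 2 then ((a ^ 2 / 4 : ℝ) : ℂ) else 0) + a * (r (n - 1) + r (n + 1))
      + conv r r n‖ ≤ ‖(if |n| = 2 then ((a ^ 2 / 4 : ℝ) : ℂ) else 0)‖
        + a * (‖r (n - 1)‖ + ‖r (n + 1)‖) + ‖conv r r n‖ := by
    refine (norm_add_le _ _).trans (add_le_add ((norm_add_le _ _).trans
      (add_le_add le_rfl ?_)) le_rfl)
    rw [norm_mul, Complex.norm_real, Real.norm_of_nonneg ha]
    exact mul_le_mul_of_nonneg_left (norm_add_le _ _) ha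
  calc |(n : ℝ)| ^ α * (|(n : ℝ)| ^ s * ‖r n‖) = |(n : ℝ)| ^ s * (|(n : ℝ)| ^ α * ‖r n‖) := by ring
    _ ≤ |(n : ℝ)| ^ s * ((gap α)⁻¹ * (‖(if |n| = 2 then ((a ^ 2 / 4 : ℝ) : ℂ) else 0)‖
        + a * (‖r (n - 1)‖ + ‖r (n + 1)‖) + ‖conv r r n‖)) :=
        mul_le_mul_of_nonneg_left (e3.trans (mul_le_mul_of_nonneg_left e4 hg)) h0
    _ = (gap α)⁻¹ * (|(n : ℝ)| ^ s * ‖(if |n| = 2 then ((a ^ 2 / 4 : ℝ) : ℂ) else 0)‖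
        + a * (|(n : ℝ)| ^ s * ‖r (n - 1)‖ + |(n : ℝ)| ^ s * ‖r (n + 1)‖)
        + |(n : ℝ)| ^ s * ‖conv r r n‖) := by ring
    _ ≤ _ := by
        refine mul_le_mul_of_nonneg_left (add_le_add (add_le_add hB
          (mul_le_mul_of_nonneg_left ?_ ha)) hQ) hg
        linarith

/-- If `|n|^s r` is in `ℓ²`, the right-hand side times `|n|^s` is bounded, so `|n|^(s + α) r` is
bounded. With `δ = (α - 1/2) / 2` the exponent `α - δ` still exceeds `1/2`, hence `|n|^(s + δ) r` is
in `ℓ²`: every step gains `δ`, and the factor `a²` survives. -/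
lemma Reduced.exists_wseq_bound_nat {α : ℝ} (hα : 1 / 2 < α) (C₀ : ℝ) (hC₀ : 0 ≤ C₀) (j : ℕ) :
    ∃ C ≥ 0, ∀ a c r, Reduced α a c r → -1 < c → 0 < a → a ≤ 1 → l2 r ≤ C₀ * a ^ 2 →
      SqSummable (wseq (j * ((α - 1 / 2) / 2)) r) ∧
      l2 (wseq (j * ((α - 1 / 2) / 2)) r) ≤ C * a ^ 2 := by
  have hα0 : 0 < α := by linarith
  induction j with
  | zero =>
    refine ⟨C₀, hC₀, fun a c r h _ _ _ hr => ?_⟩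
    have e : wseq (((0 : ℕ) : ℝ) * ((α - 1 / 2) / 2)) r = r := by
      funext n; simp [wseq]
    rw [e]
    exact ⟨h.sq, hr⟩
  | succ j ih =>
    obtain ⟨C, hC, H⟩ := ih
    set s : ℝ := j * ((α - 1 / 2) / 2) with hs
    have hs0 : 0 ≤ s := mul_nonneg (by positivity) (by linarith)
    set δ : ℝ := (α - 1 / 2) / 2 with hδ
    have hsj : ((j + 1 : ℕ) : ℝ) * δ = s + δ := by rw [hs]; push_cast; ring
    have hg := inv_nonneg.2 (gap_pos hα0).le
    set M : ℝ := (gap α)⁻¹ * (2 ^ s * (1 + 2 * C + 2 * (C * C₀))) with hM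
    have hM0 : 0 ≤ M := by positivity
    have hsum := summable_abs_rpow_sq (β := α - δ) (by rw [hδ]; linarith)
    refine ⟨M * √(∑' n : ℤ, (|(n : ℝ)| ^ (-(α - δ))) ^ 2), by positivity, ?_⟩
    intro a c r h hc ha ha1 hr
    obtain ⟨hw, hwl⟩ := H a c r h hc ha ha1 hr
    have key : ∀ n, ‖wseq (s + δ) r n‖ ≤ (M * a ^ 2) * |(n : ℝ)| ^ (-(α - δ)) := by
      intro n
      by_cases hn : 2 ≤ |n|
      · have hb : ∀ m : ℤ, |(m : ℝ)| ^ s * ‖r m‖ ≤ C * a ^ 2 := fun m => by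
          rw [← norm_wseq]; exact (norm_le_l2 hw m).trans hwl
        have hB : |(n : ℝ)| ^ s * ‖(if |n| = 2 then ((a ^ 2 / 4 : ℝ) : ℂ) else 0)‖
            ≤ 2 ^ s * a ^ 2 := by
          split_ifs with h2
          · have : |(n : ℝ)| = 2 := by rw [← Int.cast_abs, h2]; norm_num
            rw [this, Complex.norm_real, Real.norm_of_nonneg (by positivity)]
            gcongr
            nlinarith
          · rw [norm_zero, mul_zero]; positivity
        have hQ : |(n : ℝ)| ^ s * ‖conv r r n‖ ≤ 2 ^ s * (2 * (C * C₀)) * a ^ 2 := by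
          refine (norm_conv_weight_le hs0 h.sq hw n).trans ?_
          have e1 : l2 (wseq s r) * l2 r ≤ (C * a ^ 2) * (C₀ * a ^ 2) :=
            mul_le_mul hwl hr (l2_nonneg _) (by positivity)
          have e2 : (C * a ^ 2) * (C₀ * a ^ 2) ≤ (C * C₀) * a ^ 2 := by
            have : a ^ 2 ≤ 1 := pow_le_one₀ ha.le ha1
            have := mul_le_mul_of_nonneg_left this (by positivity : 0 ≤ C * C₀ * a ^ 2)
            linarith
          have e3 := e1.trans e2
          calc _ ≤ 2 ^ s * (2 * ((C * C₀) * a ^ 2)) := by gcongr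
            _ = _ := by ring
        have main := weight_eqn_le hα0 hs0 ha.le hc h hn hB (hb _) (hb _) hQ
        have hn2 := two_le_abs_cast hn
        have hbd : (gap α)⁻¹ * (2 ^ s * a ^ 2 + a * (2 ^ s * (2 * (C * a ^ 2)))
            + 2 ^ s * (2 * (C * C₀)) * a ^ 2) ≤ M * a ^ 2 := by
          have : a * (2 ^ s * (2 * (C * a ^ 2))) ≤ 2 ^ s * (2 * C) * a ^ 2 := by
            have := mul_le_mul_of_nonneg_right ha1 (by positivity : 0 ≤ 2 ^ s * (2 * (C * a ^ 2)))
            linarith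
          calc _ ≤ (gap α)⁻¹ * (2 ^ s * a ^ 2 + 2 ^ s * (2 * C) * a ^ 2
                + 2 ^ s * (2 * (C * C₀)) * a ^ 2) := by gcongr
            _ = _ := by rw [hM]; ring
        refine norm_le_mul_rpow_neg hn (le_trans (le_of_eq ?_) (main.trans hbd))
        rw [norm_wseq, ← mul_assoc, ← mul_assoc, ← Real.rpow_add (by linarith),
          ← Real.rpow_add (by linarith)]
        congr 2; ring
      · rw [norm_wseq, h.low n (by omega), norm_zero, mul_zero]
        positivity
    rw [hsj]
    refine ⟨sqSummable_of_le hsum key, (l2_le_of_le (by positivity) hsum key).trans_eq ?_⟩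
    ring

lemma wseq_norm_mono {s t : ℝ} (hst : s ≤ t) {r : ℤ → ℂ} (h0 : r 0 = 0) (n : ℤ) :
    ‖wseq s r n‖ ≤ ‖wseq t r n‖ := by
  rw [norm_wseq, norm_wseq]
  by_cases hn : n = 0
  · subst hn; simp [h0]
  · exact mul_le_mul_of_nonneg_right (Real.rpow_le_rpow_of_exponent_le (one_le_abs_cast hn) hst)
      (norm_nonneg _)

lemma Reduced.exists_wseq_bound {α : ℝ} (hα : 1 / 2 < α) (C₀ : ℝ) (hC₀ : 0 ≤ C₀) (s : ℝ) :
    ∃ C ≥ 0, ∀ a c r, Reduced α a c r → -1 < c → 0 < a → a ≤ 1 → l2 r ≤ C₀ * a ^ 2 →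
      SqSummable (wseq s r) ∧ l2 (wseq s r) ≤ C * a ^ 2 := by
  have hδ : 0 < (α - 1 / 2) / 2 := by linarith
  obtain ⟨j, hj⟩ := exists_nat_ge (s / ((α - 1 / 2) / 2))
  rw [div_le_iff₀ hδ] at hj
  obtain ⟨C, hC, H⟩ := Reduced.exists_wseq_bound_nat hα C₀ hC₀ j
  refine ⟨C, hC, fun a c r h hc ha ha1 hr => ?_⟩
  obtain ⟨h1, h2⟩ := H a c r h hc ha ha1 hr
  have hm := wseq_norm_mono hj (h.low 0 (by norm_num))
  refine ⟨sqSummable_of_le (M := 1) h1 fun n => by rw [one_mul]; exact hm n, ?_⟩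
  exact ((l2_le_mul h1 zero_le_one fun n => by rw [one_mul]; exact hm n).trans_eq
    (one_mul _)).trans h2

/-- Decay and expansion of small solutions of the reduced system. -/
lemma Reduced.exists_expansion {α : ℝ} (hα : 1 / 2 < α) (C₀ : ℝ) (hC₀ : 0 ≤ C₀) :
    ∃ C ≥ 0, ∀ a c r, Reduced α a c r → -1 < c → 0 < a → a ≤ 1 → l2 r ≤ C₀ * a ^ 2 →
      (∀ n : ℤ, |(n : ℝ)| ^ (4 : ℝ) * ‖r n‖ ≤ C * a ^ 2) ∧
      (∀ n : ℤ, 4 ≤ |n| → |(n : ℝ)| ^ (4 : ℝ) * ‖r n‖ ≤ C * a ^ 4) ∧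
      ‖((2 ^ α + c : ℝ) : ℂ) * r 2 - ((a ^ 2 / 4 : ℝ) : ℂ)‖ ≤ C * a ^ 4 ∧
      ‖((3 ^ α + c : ℝ) : ℂ) * r 3 - a * r 2‖ ≤ C * a ^ 4 ∧
      ‖((1 + c : ℝ) : ℂ) - 2 * r 2‖ ≤ C * a ^ 4 := by
  have hα0 : 0 < α := by linarith
  obtain ⟨C₁, hC₁, H⟩ := Reduced.exists_wseq_bound hα C₀ hC₀ 4
  have hg := inv_nonneg.2 (gap_pos hα0).le
  set W : ℝ := 2 ^ (4 : ℝ) with hW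
  have hW0 : 0 ≤ W := by positivity
  set C₂ : ℝ := (gap α)⁻¹ * (W * (2 * C₁) + W * (2 * (C₁ * C₀))) with hC₂
  have hC₂0 : 0 ≤ C₂ := by positivity
  set C₃ : ℝ := (gap α)⁻¹ * (W * (2 * C₂) + W * (2 * (C₁ * C₀))) with hC₃
  have hC₃0 : 0 ≤ C₃ := by positivity
  have hsum := summable_abs_rpow_sq (β := 4) (by norm_num)
  set S : ℝ := √(∑' n : ℤ, (|(n : ℝ)| ^ (-(4 : ℝ))) ^ 2)
  have hS0 : 0 ≤ S := Real.sqrt_nonneg _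
  refine ⟨C₁ + C₃ + (C₂ + C₀ ^ 2) + 4 * (C₂ * S * C₀), by positivity, ?_⟩
  intro a c r h hc ha ha1 hr
  obtain ⟨hw, hwl⟩ := H a c r h hc ha ha1 hr
  have ha2 : a ^ 2 ≤ 1 := pow_le_one₀ ha.le ha1
  have h43 : a ^ 4 ≤ a ^ 3 := pow_le_pow_of_le_one ha.le ha1 (by norm_num)
  have hb1 : ∀ n : ℤ, |(n : ℝ)| ^ (4 : ℝ) * ‖r n‖ ≤ C₁ * a ^ 2 := fun n => by
    rw [← norm_wseq]; exact (norm_le_l2 hw n).trans hwl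
  have hQ : ∀ n : ℤ, |(n : ℝ)| ^ (4 : ℝ) * ‖conv r r n‖ ≤ W * (2 * (C₁ * C₀)) * a ^ 4 := by
    intro n
    refine (norm_conv_weight_le (by norm_num) h.sq hw n).trans ?_
    have e1 : l2 (wseq 4 r) * l2 r ≤ (C₁ * a ^ 2) * (C₀ * a ^ 2) :=
      mul_le_mul hwl hr (l2_nonneg _) (by positivity)
    calc _ ≤ W * (2 * ((C₁ * a ^ 2) * (C₀ * a ^ 2))) := by gcongr
      _ = _ := by ring
  have hdrop : ∀ (n : ℤ) {x M : ℝ}, 2 ≤ |n| → 0 ≤ x → |(n : ℝ)| ^ α * x ≤ M → x ≤ M := by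
    intro n x M hn hx hM
    have : (1 : ℝ) ≤ |(n : ℝ)| ^ α :=
      Real.one_le_rpow (by linarith [two_le_abs_cast hn]) hα0.le
    nlinarith
  have hsrc : ∀ n : ℤ, 3 ≤ |n| →
      |(n : ℝ)| ^ (4 : ℝ) * ‖(if |n| = 2 then ((a ^ 2 / 4 : ℝ) : ℂ) else 0)‖ ≤ 0 := by
    intro n hn
    rw [if_neg (by omega), norm_zero, mul_zero]
  -- From the third mode on the source is absent, and the neighbouring modes enter with a factor
  -- `a`, so one order is gained. The same argument gains another order from the fourth mode on.
  have hb2 : ∀ n : ℤ, 3 ≤ |n| → |(n : ℝ)| ^ (4 : ℝ) * ‖r n‖ ≤ C₂ * a ^ 3 := by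
    intro n hn
    refine hdrop n (by omega) (by positivity) ((weight_eqn_le hα0 (by norm_num) ha.le hc h
      (by omega) (hsrc n hn) (hb1 _) (hb1 _) (hQ n)).trans ?_)
    calc _ ≤ (gap α)⁻¹ * (0 + a * (W * (2 * (C₁ * a ^ 2))) + W * (2 * (C₁ * C₀)) * a ^ 3) := by
          gcongr
      _ = _ := by rw [hC₂]; ring
  have hb3 : ∀ n : ℤ, 4 ≤ |n| → |(n : ℝ)| ^ (4 : ℝ) * ‖r n‖ ≤ C₃ * a ^ 4 := by
    intro n hn
    have hn1 : 3 ≤ |n - 1| := by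
      rcases abs_cases n with ⟨h1, _⟩ | ⟨h1, _⟩ <;>
        rcases abs_cases (n - 1) with ⟨h2, _⟩ | ⟨h2, _⟩ <;> omega
    have hn2 : 3 ≤ |n + 1| := by
      rcases abs_cases n with ⟨h1, _⟩ | ⟨h1, _⟩ <;>
        rcases abs_cases (n + 1) with ⟨h2, _⟩ | ⟨h2, _⟩ <;> omega
    refine hdrop n (by omega) (by positivity) ((weight_eqn_le hα0 (by norm_num) ha.le hc h
      (by omega) (hsrc n (by omega)) (hb2 _ hn1) (hb2 _ hn2) (hQ n)).trans ?_)
    apply le_of_eq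
    rw [hC₃]; ring
  have hrb : ∀ n : ℤ, 3 ≤ |n| → ‖r n‖ ≤ C₂ * a ^ 3 := by
    intro n hn
    have h1 : (1 : ℝ) ≤ |(n : ℝ)| ^ (4 : ℝ) :=
      Real.one_le_rpow (by linarith [two_le_abs_cast (by omega : 2 ≤ |n|)]) (by norm_num)
    nlinarith [hb2 n hn, norm_nonneg (r n)]
  have hcv : ∀ n, ‖conv r r n‖ ≤ C₀ ^ 2 * a ^ 4 := by
    intro n
    calc _ ≤ (C₀ * a ^ 2) * (C₀ * a ^ 2) :=
          (norm_conv_le h.sq h.sq n).trans (mul_le_mul hr hr (l2_nonneg _) (by positivity))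
      _ = _ := by ring
  have ha4 : 0 ≤ a ^ 4 := by positivity
  -- the part of `r` beyond the second mode
  set t : ℤ → ℂ := fun n => if 3 ≤ |n| then r n else 0 with ht
  have htb : ∀ n, ‖t n‖ ≤ (C₂ * a ^ 3) * |(n : ℝ)| ^ (-(4 : ℝ)) := by
    intro n
    simp only [ht]
    split_ifs with hn
    · exact norm_le_mul_rpow_neg (by omega) (hb2 n hn)
    · rw [norm_zero]; positivity
  have hts : SqSummable t := sqSummable_of_le hsum htb
  have htl : l2 t ≤ C₂ * a ^ 3 * S := l2_le_of_le (by positivity) hsum htb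
  -- The indices `k` and `1 - k` cannot both have absolute value two, so every nonzero product
  -- contains a mode of order at least three, which is `O(a³)`. The fifth power leaves `a⁴` after
  -- mode one is divided by `a`.
  have hR : ‖conv r r 1‖ ≤ 2 * (C₂ * S * C₀) * a ^ 5 := by
    have s1 := hts.summable_mul (h.sq.reflect 1)
    have s2 := h.sq.summable_mul (hts.reflect 1)
    have b1 := tsum_norm_mul_le hts (h.sq.reflect 1)
    have b2 := tsum_norm_mul_le h.sq (hts.reflect 1)
    rw [l2_reflect] at b1 b2
    have b3 : l2 t * l2 r ≤ (C₂ * a ^ 3 * S) * (C₀ * a ^ 2) :=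
      mul_le_mul htl hr (l2_nonneg _) (by positivity)
    have s0 : Summable fun k => ‖r k * r (1 - k)‖ := by
      simpa only [norm_mul] using h.sq.summable_mul (h.sq.reflect 1)
    calc ‖conv r r 1‖ ≤ ∑' k, ‖r k * r (1 - k)‖ := norm_tsum_le_tsum_norm s0
      _ ≤ ∑' k, (‖t k‖ * ‖r (1 - k)‖ + ‖r k‖ * ‖t (1 - k)‖) := by
          refine s0.tsum_le_tsum (fun k => ?_) (s1.add s2)
          rw [norm_mul]
          by_cases hk : 3 ≤ |k|
          · have : t k = r k := if_pos hk
            rw [this]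
            have : 0 ≤ ‖r k‖ * ‖t (1 - k)‖ := by positivity
            linarith
          · by_cases hk' : 3 ≤ |1 - k|
            · have : t (1 - k) = r (1 - k) := if_pos hk'
              rw [this]
              have : 0 ≤ ‖t k‖ * ‖r (1 - k)‖ := by positivity
              linarith
            · have : r k = 0 ∨ r (1 - k) = 0 := by
                by_cases hk2 : |k| ≤ 1
                · exact Or.inl (h.low k hk2)
                · refine Or.inr (h.low _ ?_)
                  rcases abs_cases k with ⟨h1, _⟩ | ⟨h1, _⟩ <;>
                    rcases abs_cases (1 - k) with ⟨h2, _⟩ | ⟨h2, _⟩ <;> omega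
              have h0 : ‖r k‖ * ‖r (1 - k)‖ = 0 := by
                rcases this with h' | h' <;> simp [h']
              rw [h0]
              positivity
      _ = ∑' k, ‖t k‖ * ‖r (1 - k)‖ + ∑' k, ‖r k‖ * ‖t (1 - k)‖ := s1.tsum_add s2
      _ ≤ 2 * ((C₂ * a ^ 3 * S) * (C₀ * a ^ 2)) := by linarith
      _ = _ := by ring
  refine ⟨fun n => (hb1 n).trans ?_, fun n hn => (hb3 n hn).trans ?_, ?_, ?_, ?_⟩
  · gcongr
    have : 0 ≤ C₃ + (C₂ + C₀ ^ 2) + 4 * (C₂ * S * C₀) := by positivity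
    linarith
  · gcongr
    have : 0 ≤ C₁ + (C₂ + C₀ ^ 2) + 4 * (C₂ * S * C₀) := by positivity
    linarith
  · have e : ((2 ^ α + c : ℝ) : ℂ) * r 2 - ((a ^ 2 / 4 : ℝ) : ℂ) = a * r 3 + conv r r 2 := by
      have f1 := h.eqn 2 (by norm_num)
      norm_num [h.low 1 (by norm_num)] at f1
      push_cast
      linear_combination f1
    have e2 : a * ‖r 3‖ ≤ C₂ * a ^ 4 := by
      have := mul_le_mul_of_nonneg_left (hrb 3 (by norm_num)) ha.le
      linarith
    have e3 : ‖(a : ℂ) * r 3 + conv r r 2‖ ≤ a * ‖r 3‖ + ‖conv r r 2‖ := by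
      refine (norm_add_le _ _).trans_eq ?_
      rw [norm_mul, Complex.norm_real, Real.norm_of_nonneg ha.le]
    rw [e]
    have e4 := hcv 2
    have : 0 ≤ (C₁ + C₃ + 4 * (C₂ * S * C₀)) * a ^ 4 := by positivity
    linarith
  · have e : ((3 ^ α + c : ℝ) : ℂ) * r 3 - a * r 2 = a * r 4 + conv r r 3 := by
      have f1 := h.eqn 3 (by norm_num)
      norm_num at f1
      push_cast
      linear_combination f1
    have e2 : a * ‖r 4‖ ≤ C₂ * a ^ 4 := by
      have := mul_le_mul_of_nonneg_left (hrb 4 (by norm_num)) ha.le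
      linarith
    have e3 : ‖(a : ℂ) * r 4 + conv r r 3‖ ≤ a * ‖r 4‖ + ‖conv r r 3‖ := by
      refine (norm_add_le _ _).trans_eq ?_
      rw [norm_mul, Complex.norm_real, Real.norm_of_nonneg ha.le]
    rw [e]
    have e4 := hcv 3
    have : 0 ≤ (C₁ + C₃ + 4 * (C₂ * S * C₀)) * a ^ 4 := by positivity
    linarith
  · have hac : (a : ℂ) ≠ 0 := by exact_mod_cast ha.ne'
    have e : ((1 + c : ℝ) : ℂ) - 2 * r 2 = 2 * ((a : ℂ)⁻¹ * conv r r 1) := by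
      have f1 := h.one
      have f1' : conv r r 1 = (a : ℂ) * ((1 + c) / 2 - r 2) := by
        push_cast at f1; linear_combination -f1
      rw [f1', ← mul_assoc (a : ℂ)⁻¹, inv_mul_cancel₀ hac]
      push_cast; ring
    have e2 : ‖(2 : ℂ) * ((a : ℂ)⁻¹ * conv r r 1)‖ ≤ 4 * (C₂ * S * C₀) * a ^ 4 := by
      rw [norm_mul, norm_mul, norm_inv, Complex.norm_real, Real.norm_of_nonneg ha.le,
        inv_mul_eq_div, Complex.norm_ofNat, ← le_div_iff₀' (by norm_num), div_le_iff₀ ha]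
      refine hR.trans_eq ?_
      ring
    rw [e]
    have : 0 ≤ (C₁ + C₃ + (C₂ + C₀ ^ 2)) * a ^ 4 := by positivity
    linarith

/-! ### Ground states as small solutions of the reduced system. -/

/-- The Fourier coefficients of `2 B_c(φ) φ` for a ground state `φ`. -/
def IsWaveSeq (α c : ℝ) (f : ℤ → ℂ) : Prop :=
  ∃ φ, IsGroundState α c φ ∧ ∀ n, f n = ((2 * quadForm α c φ : ℝ) : ℂ) * coef φ n

lemma IsWaveSeq.neg {α c : ℝ} {f : ℤ → ℂ} (hf : IsWaveSeq α c f) (n : ℤ) :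
    f (-n) = (starRingEnd ℂ) (f n) := by
  obtain ⟨φ, -, h⟩ := hf
  rw [h, h, coef_neg, map_mul, Complex.conj_ofReal]

lemma IsWaveSeq.zero {α c : ℝ} {f : ℤ → ℂ} (hf : IsWaveSeq α c f) : f 0 = 0 := by
  obtain ⟨φ, hφ, h⟩ := hf
  rw [h, coef_zero_of_integral hφ.1.2.2, mul_zero]

lemma IsWaveSeq.summable_wt {α c : ℝ} {f : ℤ → ℂ} (hf : IsWaveSeq α c f) :
    Summable fun n => wt α n * ‖f n‖ ^ 2 := by
  obtain ⟨φ, hφ, h⟩ := hf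
  have : Summable fun n => wt α n * ‖coef φ n‖ ^ 2 := hφ.1.1.2
  refine (this.mul_left ((2 * quadForm α c φ) ^ 2)).congr fun n => ?_
  rw [h, norm_mul, Complex.norm_real, Real.norm_eq_abs, mul_pow |2 * quadForm α c φ|, sq_abs]; ring

/-- The factor `2 B_c(φ)` in the wave normalises the quadratic term of the Euler-Lagrange equation
to coefficient one. -/
lemma IsWaveSeq.equation {α c : ℝ} (hα : 1 / 2 < α) (hc1 : -1 < c) {f : ℤ → ℂ}
    (hf : IsWaveSeq α c f) {n : ℤ} (hn : n ≠ 0) :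
    ((|(n : ℝ)| ^ α + c : ℝ) : ℂ) * f n = conv f f n := by
  obtain ⟨φ, hφ, h⟩ := hf
  have h1 := hφ.euler_lagrange hα hc1 hn
  rw [show f = fun n => ((2 * quadForm α c φ : ℝ) : ℂ) * coef φ n from funext h,
    conv_const_mul_left, conv_const_mul_right, ← h1]
  ring

/-- With `m = B_c(φ)` the energy of the wave is `4 m³ / π`, exactly the quantity controlled by the
trial function. -/
lemma IsWaveSeq.quadSeq_le {α c : ℝ} (hα : 1 / 2 < α) (hc1 : -1 < c) (hc : c ≤ 0) {f : ℤ → ℂ}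
    (hf : IsWaveSeq α c f) : quadSeq α c f ≤ (1 + 2 ^ α) ^ 3 * (1 + c) ^ 2 := by
  obtain ⟨φ, hφ, h⟩ := hf
  have h1 := hφ.quadForm_cube_le hα hc1 hc
  have hpi := Real.pi_pos
  rw [show f = fun n => ((2 * quadForm α c φ : ℝ) : ℂ) * coef φ n from funext h,
    quadSeq_const_mul]
  have h2 := quadForm_eq (c := c) (by linarith : 0 ≤ α) hφ.1.1
  refine le_of_mul_le_mul_left ?_ hpi
  calc _ = 4 * quadForm α c φ ^ 3 := by rw [h2]; ring
    _ ≤ _ := by linarith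

lemma IsWaveSeq.ne_zero {α c : ℝ} (hα : 1 / 2 < α) (hc1 : -1 < c) {f : ℤ → ℂ}
    (hf : IsWaveSeq α c f) : f ≠ 0 := by
  obtain ⟨φ, hφ, h⟩ := hf
  intro h0
  have hm := hφ.quadForm_pos hα hc1
  have hz : coef φ = 0 := by
    funext n
    have := h n
    rw [h0, Pi.zero_apply, eq_comm, mul_eq_zero] at this
    refine this.resolve_left ?_
    exact_mod_cast (by positivity : 2 * quadForm α c φ ≠ 0)
  have h3 := hφ.1.2.1
  rw [integral_cube hα hφ.1.1, hz] at h3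
  simp [cubeSeq] at h3

/-- The coefficients of a translate. -/
def rot (θ : ℝ) (f : ℤ → ℂ) (n : ℤ) : ℂ := Complex.exp ((n * θ : ℝ) * Complex.I) * f n

lemma norm_rot (θ : ℝ) (f : ℤ → ℂ) (n : ℤ) : ‖rot θ f n‖ = ‖f n‖ := by
  rw [rot, norm_mul, Complex.norm_exp_ofReal_mul_I, one_mul]

lemma conv_rot (θ : ℝ) (f g : ℤ → ℂ) (n : ℤ) :
    conv (rot θ f) (rot θ g) n = rot θ (conv f g) n := by
  unfold rot conv
  rw [← tsum_mul_left]
  refine tsum_congr fun k => ?_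
  rw [mul_mul_mul_comm, ← Complex.exp_add]
  congr 2
  push_cast; ring

lemma cubeSeq_rot (θ : ℝ) (f : ℤ → ℂ) : cubeSeq (rot θ f) = cubeSeq f := by
  unfold cubeSeq
  congr 1
  refine tsum_congr fun n => ?_
  rw [conv_rot, rot, rot, map_mul, mul_mul_mul_comm, Complex.mul_conj, Complex.normSq_eq_norm_sq,
    Complex.norm_exp_ofReal_mul_I]
  simp

lemma IsWaveSeq.rot {α c : ℝ} (hα : 1 / 2 < α) {f : ℤ → ℂ} (hf : IsWaveSeq α c f) (θ : ℝ) :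
    IsWaveSeq α c (rot θ f) := by
  have hα0 : 0 ≤ α := by linarith
  obtain ⟨φ, hφ, h⟩ := hf
  have hneg : ∀ n, FracKdV.rot θ (coef φ) (-n) = (starRingEnd ℂ) (FracKdV.rot θ (coef φ) n) := by
    intro n
    rw [FracKdV.rot, FracKdV.rot, coef_neg, map_mul, ← Complex.exp_conj]
    congr 2
    rw [map_mul, Complex.conj_ofReal, Complex.conj_I]
    push_cast; ring
  obtain ⟨φ', hφ', hc'⟩ := exists_memHper hα0 hneg (by
    simp only [norm_rot]
    exact hφ.1.1.2)
  have hQ : quadForm α c φ' = quadForm α c φ := by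
    rw [quadForm_eq hα0 hφ', quadForm_eq hα0 hφ.1.1, hc']
    simp only [quadSeq, norm_rot]
  refine ⟨φ', ⟨⟨hφ', ?_, ?_⟩, ?_⟩, ?_⟩
  · rw [integral_cube hα hφ', hc', cubeSeq_rot, ← integral_cube hα hφ.1.1]
    exact hφ.1.2.1
  · refine integral_of_coef_zero ?_
    rw [hc', FracKdV.rot, coef_zero_of_integral hφ.1.2.2, mul_zero]
  · intro v hv
    change quadForm α c φ' ≤ quadForm α c v
    rw [hQ]; exact hφ.2 hv
  · intro n
    rw [hQ, hc', FracKdV.rot, FracKdV.rot, h]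
    ring

/-- The coefficient sequence with first mode `a / 2` and remainder `r`. -/
def modes (a : ℝ) (r : ℤ → ℂ) (n : ℤ) : ℂ := if |n| = 1 then ((a / 2 : ℝ) : ℂ) else r n

/-- The part of a sequence in the modes `|n| ≥ 2`. -/
def highPart (f : ℤ → ℂ) (n : ℤ) : ℂ := if |n| ≤ 1 then 0 else f n

lemma IsWaveSeq.eq_modes {α c a : ℝ} {f : ℤ → ℂ} (hf : IsWaveSeq α c f)
    (h1 : f 1 = ((a / 2 : ℝ) : ℂ)) : f = modes a (highPart f) := by
  funext n
  unfold modes highPart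
  by_cases hn : |n| = 1
  · rw [if_pos hn]
    rcases (abs_eq (by norm_num)).1 hn with h | h
    · rw [h, h1]
    · rw [h, hf.neg, h1, Complex.conj_ofReal]
  · rw [if_neg hn]
    by_cases h0 : |n| ≤ 1
    · rw [if_pos h0]
      have : n = 0 := by
        have := abs_nonneg n
        have h2 : |n| = 0 := by omega
        exact abs_eq_zero.1 h2
      rw [this, hf.zero]
    · rw [if_neg h0]

lemma conv_modes {a : ℝ} {r : ℤ → ℂ} (hr : SqSummable r) (hlow : ∀ n, |n| ≤ 1 → r n = 0) (n : ℤ) :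
    conv (modes a r) (modes a r) n = ((a / 2 : ℝ) : ℂ) * (modes a 0 (n - 1) + modes a 0 (n + 1))
      + a * (r (n - 1) + r (n + 1)) + conv r r n := by
  have hsup : ∀ k, k ∉ ({1, -1} : Finset ℤ) → modes a 0 k = 0 := by
    intro k hk
    simp only [Finset.mem_insert, Finset.mem_singleton, not_or] at hk
    rw [modes, if_neg (by rw [abs_eq (by norm_num)]; omega), Pi.zero_apply]
  have hp : SqSummable (modes a 0) :=
    summable_of_ne_finset_zero (s := ({1, -1} : Finset ℤ)) fun k hk => by simp [hsup k hk]
  have hcp : ∀ g : ℤ → ℂ, conv (modes a 0) g n = ((a / 2 : ℝ) : ℂ) * (g (n - 1) + g (n + 1)) := by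
    intro g
    rw [conv, tsum_eq_sum (s := ({1, -1} : Finset ℤ)) fun k hk => by simp [hsup k hk],
      Finset.sum_pair (by norm_num)]
    simp [modes]
    ring
  have hsplit : modes a r = fun n => modes a 0 n + r n := by
    funext k
    unfold modes
    by_cases hk : |k| = 1
    · simp [hk, hlow k hk.le]
    · simp [hk]
  rw [hsplit, conv_add_left hp hr (hp.add hr), conv_add_right hp hr hp, conv_add_right hp hr hr,
    conv_comm r (modes a 0), hcp, hcp]
  push_cast
  ring

lemma IsWaveSeq.reduced {α c a : ℝ} (hα : 1 / 2 < α) (hc1 : -1 < c) {f : ℤ → ℂ}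
    (hf : IsWaveSeq α c f) (h1 : f 1 = ((a / 2 : ℝ) : ℂ)) : Reduced α a c (highPart f) := by
  have hfs : SqSummable f := SqSummable.of_wt (by linarith) hf.summable_wt
  have hs : SqSummable (highPart f) := by
    refine sqSummable_of_le (M := 1) hfs fun n => ?_
    unfold highPart
    split_ifs <;> simp
  have hlow : ∀ n, |n| ≤ 1 → highPart f n = 0 := fun n hn => if_pos hn
  have heq : ∀ n : ℤ, n ≠ 0 → ((|(n : ℝ)| ^ α + c : ℝ) : ℂ) * f n =
      ((a / 2 : ℝ) : ℂ) * (modes a 0 (n - 1) + modes a 0 (n + 1))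
      + a * (highPart f (n - 1) + highPart f (n + 1)) + conv (highPart f) (highPart f) n := by
    intro n hn
    rw [hf.equation hα hc1 hn, ← conv_modes hs hlow, ← hf.eq_modes h1]
  refine ⟨hs, hlow, ?_, fun n hn => ?_⟩
  · have := heq 1 one_ne_zero
    rw [h1] at this
    norm_num [modes, hlow 0] at this
    push_cast
    linear_combination this
  · have h2 : highPart f n = f n := if_neg (by omega)
    rw [h2, heq n (by rintro rfl; simp at hn)]
    congr 2
    -- The product of the first modes with themselves reaches only `n = 0` and `n = ±2`; at `±2` it
    -- gives `a² / 4`.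
    unfold modes
    by_cases hn2 : |n| = 2
    · rw [if_pos hn2]
      rcases (abs_eq (by norm_num)).1 hn2 with h | h <;> subst h <;> norm_num <;> ring
    · rw [if_neg hn2, if_neg, if_neg]
      · simp
      · rw [abs_eq (by norm_num)]; rw [abs_eq (by norm_num)] at hn2
        rintro (h | h)
        · have : n = 0 := by omega
          subst this; simp at hn
        · omega
      · rw [abs_eq (by norm_num)]; rw [abs_eq (by norm_num)] at hn2
        rintro (h | h)
        · omega
        · have : n = 0 := by omega
          subst this; simp at hn

/-- Near `c = -1` the waves are small solutions of the reduced system. -/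
lemma IsWaveSeq.exists_small {α : ℝ} (hα : 1 / 2 < α) :
    ∃ ε > 0, ε ≤ 1 ∧ ∃ D ≥ 0, ∀ c a f, -1 < c → 1 + c ≤ ε → 0 ≤ a → IsWaveSeq α c f →
      f 1 = ((a / 2 : ℝ) : ℂ) → Reduced α a c (highPart f) ∧ 0 < a ∧ a ^ 2 ≤ D * (1 + c) ∧
        l2 (highPart f) ≤ 2 * invBound α * a ^ 2 := by
  have hα0 : 0 < α := by linarith
  have hG := one_le_invBound hα0
  set G := invBound α
  have hg := gap_pos hα0
  set D : ℝ := (1 + 2 ^ α) ^ 3 with hD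
  have hD0 : 0 < D := by positivity
  set η : ℝ := (6 * G)⁻¹ with hη
  have hη0 : 0 < η := by positivity
  -- The second entry forces `a ≤ η` and the third forces the high modes below `η`, with `η` the
  -- threshold of `Reduced.l2_le`.
  refine ⟨min 1 (min (η ^ 2 / (4 * D)) (√(gap α * η ^ 2 / D))), by positivity, min_le_left _ _,
    4 * D, by positivity, ?_⟩
  intro c a f hc1 hcε ha hf h1
  have hR := hf.reduced hα hc1 h1
  have hc0 : c ≤ 0 := by linarith [hcε.trans (min_le_left _ _)]
  have hε1 : 1 + c ≤ η ^ 2 / (4 * D) := hcε.trans ((min_le_right _ _).trans (min_le_left _ _))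
  have hε2 : 1 + c ≤ √(gap α * η ^ 2 / D) := hcε.trans ((min_le_right _ _).trans (min_le_right _ _))
  have hcp : 0 < 1 + c := by linarith
  have hQ := hf.quadSeq_le hα hc1 hc0
  have hsum := summable_quad (c := c) hα0.le hf.summable_wt
  -- Mode one has energy `(1 + c) a² / 4`, which is at most `D (1 + c)²`; dividing by `1 + c` gives
  -- the bound on the amplitude.
  have ha2 : a ^ 2 ≤ 4 * D * (1 + c) := by
    have h2 := hsum.le_tsum 1 fun k _ => symbol_mul_nonneg hα0.le hc1 hf.zero k
    rw [h1, Complex.norm_real, Real.norm_of_nonneg (by positivity)] at h2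
    have h3 : (1 + c) * (a / 2) ^ 2 ≤ D * (1 + c) ^ 2 := by
      refine le_trans (le_of_eq ?_) (h2.trans hQ)
      simp
    have h4 : (1 + c) * (a ^ 2) ≤ (1 + c) * (4 * D * (1 + c)) := by linarith
    exact le_of_mul_le_mul_left h4 hcp
  have haη : a ≤ η := by
    have h2 : a ^ 2 ≤ η ^ 2 := by
      refine ha2.trans ?_
      rw [le_div_iff₀ (by positivity)] at hε1
      linarith
    exact (abs_le_of_sq_le_sq' h2 hη0.le).2
  have hlη : l2 (highPart f) ≤ η := by
    refine (abs_le_of_sq_le_sq' ?_ hη0.le).2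
    rw [l2_sq]
    have h2 : ∀ n, ‖highPart f n‖ ^ 2 ≤ (gap α)⁻¹ * ((|(n : ℝ)| ^ α + c) * ‖f n‖ ^ 2) := by
      intro n
      unfold highPart
      split_ifs with hn
      · rw [norm_zero]
        have := mul_nonneg (inv_nonneg.2 hg.le) (symbol_mul_nonneg hα0.le hc1 hf.zero n)
        simpa using this
      · have hn2 : 2 ≤ |n| := by omega
        have h3 := gap_mul_le hα0 hc1 hn2
        have h4 : (1 : ℝ) ≤ |(n : ℝ)| ^ α :=
          Real.one_le_rpow (by linarith [two_le_abs_cast hn2]) hα0.le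
        have h5 : gap α ≤ |(n : ℝ)| ^ α + c := by nlinarith
        rw [inv_mul_eq_div, le_div_iff₀ hg]
        nlinarith [sq_nonneg ‖f n‖]
    have h3 := hR.sq.tsum_le_tsum h2 (hsum.mul_left _)
    rw [tsum_mul_left] at h3
    refine h3.trans ?_
    rw [inv_mul_eq_div, div_le_iff₀ hg]
    refine hQ.trans ?_
    have h4 : (1 + c) ^ 2 ≤ gap α * η ^ 2 / D := by
      rw [← Real.sq_sqrt (by positivity : 0 ≤ gap α * η ^ 2 / D)]
      gcongr
    rw [le_div_iff₀ hD0] at h4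
    linarith
  have hl := hR.l2_le hα hc1 ha haη hlη
  refine ⟨hR, lt_of_le_of_ne ha ?_, ha2, hl⟩
  -- Zero amplitude would make the high part vanish as well, and a wave is not zero.
  rintro rfl
  refine hf.ne_zero hα hc1 ?_
  rw [hf.eq_modes h1]
  funext n
  have h5 : ‖highPart f n‖ ≤ 0 := by
    refine (norm_le_l2 hR.sq n).trans (hl.trans_eq ?_)
    ring
  have h6 : highPart f n = 0 := norm_le_zero_iff.1 h5
  simp [modes, h6]

/-- After translation the first mode is real and nonnegative. -/
lemma exists_isWaveSeq {α c : ℝ} (hα : 1 / 2 < α) (hc1 : -1 < c) (hc : c ≤ 0) :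
    ∃ a f, 0 ≤ a ∧ IsWaveSeq α c f ∧ f 1 = ((a / 2 : ℝ) : ℂ) := by
  obtain ⟨φ, hφ⟩ := exists_isGroundState hα hc1 hc
  set f : ℤ → ℂ := fun n => ((2 * quadForm α c φ : ℝ) : ℂ) * coef φ n with hf
  have hw : IsWaveSeq α c f := ⟨φ, hφ, fun n => rfl⟩
  refine ⟨2 * ‖f 1‖, rot (-(f 1).arg) f, by positivity, hw.rot hα _, ?_⟩
  rw [rot, mul_div_cancel_left₀ _ (two_ne_zero)]
  nth_rewrite 2 [← Complex.norm_mul_exp_arg_mul_I (f 1)]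
  rw [mul_left_comm, ← Complex.exp_add]
  push_cast
  rw [show (((1 : ℂ) * -((f 1).arg : ℂ)) * Complex.I + (f 1).arg * Complex.I) = 0 by ring]
  simp

lemma eq_of_l2_sub_le_zero {f g : ℤ → ℂ} (hf : SqSummable f) (hg : SqSummable g)
    (h : l2 (fun n => f n - g n) ≤ 0) : f = g := by
  funext n
  have := (norm_le_l2 (hf.sub hg) n).trans h
  exact sub_eq_zero.1 (norm_le_zero_iff.1 this)

/-! ### The branch of waves near `c = -1`. -/

/-- The branch of waves bifurcating from zero at `c = -1`, with amplitude `A c` and higher modes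
`R c`. -/
structure IsBranch (α c₁ C₀ : ℝ) (A : ℝ → ℝ) (R : ℝ → ℤ → ℂ) : Prop where
  wave : ∀ c ∈ Ioo (-1) c₁, IsWaveSeq α c (modes (A c) (R c))
  reduced : ∀ c ∈ Ioo (-1) c₁, Reduced α (A c) c (R c)
  pos : ∀ c ∈ Ioo (-1) c₁, 0 < A c
  real : ∀ c ∈ Ioo (-1) c₁, ∀ n, (starRingEnd ℂ) (R c n) = R c n
  l2_le : ∀ c ∈ Ioo (-1) c₁, l2 (R c) ≤ C₀ * A c ^ 2
  unique : ∀ c ∈ Ioo (-1) c₁, ∀ a f, 0 ≤ a → IsWaveSeq α c f → f 1 = ((a / 2 : ℝ) : ℂ) →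
    f = modes (A c) (R c)
  mono : StrictMonoOn A (Ioo (-1) c₁)
  cont : ContinuousOn A (Ioo (-1) c₁)
  lim : ∀ δ > 0, ∃ c ∈ Ioo (-1) c₁, A c < δ

/-- Conjugating the coefficients is the reflection `x ↦ -x` of the wave. Combined with uniqueness it
forces real coefficients, so that no rearrangement argument is needed for evenness. -/
lemma Reduced.conj {α a c : ℝ} {r : ℤ → ℂ} (h : Reduced α a c r) :
    Reduced α a c fun n => (starRingEnd ℂ) (r n) := by
  refine ⟨by simpa only [SqSummable, Complex.norm_conj] using h.sq,
    fun n hn => by simp only [h.low n hn, map_zero], ?_, fun n hn => ?_⟩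
  · have := congrArg (starRingEnd ℂ) h.one
    rw [map_add, map_mul, Complex.conj_ofReal, Complex.conj_ofReal] at this
    rw [conv_conj, ← this]
  · have := congrArg (starRingEnd ℂ) (h.eqn n hn)
    rw [map_mul, Complex.conj_ofReal, map_add, map_add, map_mul, map_add, Complex.conj_ofReal]
      at this
    rw [conv_conj, this]
    congr 2
    split_ifs
    · exact Complex.conj_ofReal _
    · exact map_zero _

/-- The branch is not continued from its endpoint: at each speed a wave is chosen from a ground
state. Uniqueness, reality, monotonicity and continuity all come from comparing two reduced
solutions. -/
lemma exists_isBranch {α : ℝ} (hα : 1 / 2 < α) (ε : ℝ) (hε : 0 < ε) :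
    ∃ c₁, -1 < c₁ ∧ c₁ ≤ 0 ∧ ∃ A R, IsBranch α c₁ (2 * invBound α) A R ∧
      ∀ c ∈ Ioo (-1) c₁, A c ≤ ε := by
  have hG := one_le_invBound (by linarith : 0 < α)
  set C₀ := 2 * invBound α with hC₀
  obtain ⟨ε₁, hε₁, hε₁1, D, hD, small⟩ := IsWaveSeq.exists_small hα
  obtain ⟨ε₂, hε₂, hε₂1, C, hC, comp⟩ := Reduced.exists_compare hα C₀ (by linarith)
  set μ := min ε ε₂ with hμ
  have hμ0 : 0 < μ := lt_min hε hε₂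
  -- The amplitude bound `a² ≤ D (1 + c)` then gives `a ≤ μ` for every wave at these speeds, not
  -- only for the chosen one.
  set κ := min ε₁ (μ ^ 2 / (D + 1)) with hκ
  have hκ0 : 0 < κ := lt_min hε₁ (by positivity)
  have hκ1 : κ ≤ 1 := (min_le_left _ _).trans hε₁1
  have hsm : ∀ c ∈ Ioo (-1) (-1 + κ), ∀ a f, 0 ≤ a → IsWaveSeq α c f →
      f 1 = ((a / 2 : ℝ) : ℂ) → Reduced α a c (highPart f) ∧ 0 < a ∧ a ^ 2 ≤ D * (1 + c) ∧
        l2 (highPart f) ≤ C₀ * a ^ 2 ∧ a ≤ μ := by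
    intro c hc a f ha hf h1
    have hcκ : 1 + c ≤ κ := by linarith [hc.2]
    obtain ⟨h2, h3, h4, h5⟩ := small c a f hc.1 (hcκ.trans (min_le_left _ _)) ha hf h1
    refine ⟨h2, h3, h4, h5, ?_⟩
    have h6 : 1 + c ≤ μ ^ 2 / (D + 1) := hcκ.trans (min_le_right _ _)
    rw [le_div_iff₀ (by positivity)] at h6
    refine (abs_le_of_sq_le_sq' (h4.trans ?_) hμ0.le).2
    nlinarith [hc.1]
  have hcmp : ∀ a c r a' c' r', Reduced α a c r → Reduced α a' c' r' → c ∈ Ioo (-1) (-1 + κ) →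
      0 < a' → a' ≤ a → a ≤ μ → l2 r ≤ C₀ * a ^ 2 → l2 r' ≤ C₀ * a' ^ 2 →
      0 ≤ c - c' ∧ c - c' ≤ C * (a ^ 2 - a' ^ 2) ∧ a ^ 2 - a' ^ 2 ≤ C * (c - c') ∧
      l2 (fun n => r n - r' n) ≤ C * ((c - c') + (a - a')) :=
    fun a c r a' c' r' h h' hc ha' haa ha => comp a c r a' c' r' h h' hc.1 (by linarith [hc.2])
      ha' haa (ha.trans (min_le_right _ _))
  have huniq1 : ∀ c ∈ Ioo (-1) (-1 + κ), ∀ a r a' r', Reduced α a c r → Reduced α a' c r' →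
      0 < a' → a' ≤ a → a ≤ μ → l2 r ≤ C₀ * a ^ 2 → l2 r' ≤ C₀ * a' ^ 2 → a = a' ∧ r = r' := by
    intro c hc a r a' r' h h' ha' haa ha hr hr'
    obtain ⟨-, -, h3, h4⟩ := hcmp a c r a' c r' h h' hc ha' haa ha hr hr'
    rw [sub_self, mul_zero] at h3
    have haa' : a = a' := le_antisymm
      ((abs_le_of_sq_le_sq' (by linarith : a ^ 2 ≤ a' ^ 2) ha'.le).2) haa
    refine ⟨haa', eq_of_l2_sub_le_zero h.sq h'.sq (h4.trans_eq ?_)⟩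
    rw [haa']; ring
  have huniq : ∀ c ∈ Ioo (-1) (-1 + κ), ∀ a r a' r', Reduced α a c r → Reduced α a' c r' →
      0 < a → 0 < a' → a ≤ μ → a' ≤ μ → l2 r ≤ C₀ * a ^ 2 → l2 r' ≤ C₀ * a' ^ 2 →
      a = a' ∧ r = r' := by
    intro c hc a r a' r' h h' ha ha' haμ haμ' hr hr'
    rcases le_total a' a with hle | hle
    · exact huniq1 c hc a r a' r' h h' ha' hle haμ hr hr'
    · obtain ⟨e1, e2⟩ := huniq1 c hc a' r' a r h' h ha hle haμ' hr' hr
      exact ⟨e1.symm, e2.symm⟩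
  have hex : ∀ c, ∃ a f, c ∈ Ioo (-1) (-1 + κ) →
      0 ≤ a ∧ IsWaveSeq α c f ∧ f 1 = ((a / 2 : ℝ) : ℂ) := by
    intro c
    by_cases hc : c ∈ Ioo (-1) (-1 + κ)
    · obtain ⟨a, f, h⟩ := exists_isWaveSeq hα hc.1 (by linarith [hc.2])
      exact ⟨a, f, fun _ => h⟩
    · exact ⟨0, 0, fun h => absurd h hc⟩
  choose A F hAF using hex
  have hprop : ∀ c (hc : c ∈ Ioo (-1) (-1 + κ)), Reduced α (A c) c (highPart (F c)) ∧ 0 < A c ∧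
      A c ^ 2 ≤ D * (1 + c) ∧ l2 (highPart (F c)) ≤ C₀ * A c ^ 2 ∧ A c ≤ μ :=
    fun c hc => hsm c hc _ _ (hAF c hc).1 (hAF c hc).2.1 (hAF c hc).2.2
  -- If the larger speed had the smaller amplitude, the comparison would give the reverse order of
  -- speeds.
  have hmono : StrictMonoOn A (Ioo (-1) (-1 + κ)) := by
    intro c hc c' hc' hlt
    by_contra hle
    push Not at hle
    obtain ⟨p1, p2, -, p3, p4⟩ := hprop c hc
    obtain ⟨q1, q2, -, q3, q4⟩ := hprop c' hc'
    have := (hcmp _ _ _ _ _ _ p1 q1 hc q2 hle p4 p3 q3).1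
    linarith
  have hsq : ∀ c ∈ Ioo (-1) (-1 + κ), ∀ c' ∈ Ioo (-1) (-1 + κ), c' ≤ c →
      |A c ^ 2 - A c' ^ 2| ≤ C * |c - c'| := by
    intro c hc c' hc' hle
    obtain ⟨p1, p2, -, p3, p4⟩ := hprop c hc
    obtain ⟨q1, q2, -, q3, q4⟩ := hprop c' hc'
    have hA : A c' ≤ A c := hmono.monotoneOn hc' hc hle
    have := (hcmp _ _ _ _ _ _ p1 q1 hc q2 hA p4 p3 q3).2.2.1
    rw [abs_of_nonneg (by nlinarith), abs_of_nonneg (by linarith)]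
    exact this
  refine ⟨-1 + κ, by linarith, by linarith, A, fun c => highPart (F c), ⟨?_, ?_, ?_, ?_, ?_, ?_,
    hmono, ?_, ?_⟩, fun c hc => (hprop c hc).2.2.2.2.trans (min_le_left _ _)⟩
  · intro c hc
    rw [← (hAF c hc).2.1.eq_modes (hAF c hc).2.2]
    exact (hAF c hc).2.1
  · exact fun c hc => (hprop c hc).1
  · exact fun c hc => (hprop c hc).2.1
  · intro c hc n
    obtain ⟨p1, p2, -, p3, p4⟩ := hprop c hc
    exact congrFun (huniq c hc _ _ _ _ p1.conj p1 p2 p2 p4 p4 (by rwa [l2_conj]) p3).2 n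
  · exact fun c hc => (hprop c hc).2.2.2.1
  · intro c hc a f ha hf h1
    obtain ⟨p1, p2, -, p3, p4⟩ := hprop c hc
    obtain ⟨q1, q2, -, q3, q4⟩ := hsm c hc a f ha hf h1
    obtain ⟨e1, e2⟩ := huniq c hc _ _ _ _ q1 p1 q2 p2 q4 p4 q3 p3
    rw [hf.eq_modes h1, e1, e2]
  · have h1 : ContinuousOn (fun c => A c ^ 2) (Ioo (-1) (-1 + κ)) := by
      have hL : LipschitzOnWith (Real.toNNReal C) (fun c => A c ^ 2) (Ioo (-1) (-1 + κ)) := by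
        refine LipschitzOnWith.of_dist_le_mul fun c hc c' hc' => ?_
        rw [Real.dist_eq, Real.dist_eq, Real.coe_toNNReal _ hC]
        rcases le_total c' c with hle | hle
        · exact hsq c hc c' hc' hle
        · rw [abs_sub_comm, abs_sub_comm c]
          exact hsq c' hc' c hc hle
      exact hL.continuousOn
    refine (h1.sqrt).congr fun c hc => ?_
    exact (Real.sqrt_sq (hprop c hc).2.1.le).symm
  · intro δ hδ
    set t := min (κ / 2) (δ ^ 2 / (2 * (D + 1))) with ht
    have ht0 : 0 < t := lt_min (by linarith) (by positivity)
    have htm : -1 + t ∈ Ioo (-1) (-1 + κ) :=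
      ⟨by linarith, by linarith [min_le_left (κ / 2) (δ ^ 2 / (2 * (D + 1)))]⟩
    refine ⟨-1 + t, htm, ?_⟩
    have h1 := (hprop _ htm).2.2.1
    have h2 : t ≤ δ ^ 2 / (2 * (D + 1)) := min_le_right _ _
    rw [le_div_iff₀ (by positivity)] at h2
    refine lt_of_pow_lt_pow_left₀ 2 hδ.le (h1.trans_lt ?_)
    nlinarith [sq_nonneg δ, mul_pos hδ hδ]

/-! ### Cosine series, shape of the waves and uniqueness of minimizer waves. -/

/-- The cosine series with (even, real) coefficient sequence `f`. -/
def waveFun (f : ℤ → ℂ) (x : ℝ) : ℝ := ∑' n : ℤ, (f n).re * Real.cos (n * x)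

lemma ccoef_exp (k n : ℤ) :
    ccoef (fun x : ℝ => Complex.exp (k * x * Complex.I)) n = if n = k then 1 else 0 := by
  have h := congrFun (fourierCoeff_fourier (T := Real.pi - -Real.pi) k) n
  rw [Pi.single_apply] at h
  rw [← h]
  unfold ccoef
  rw [fourierCoeffOn_eq_integral, fourierCoeff_eq_intervalIntegral _ _ (-Real.pi),
    show -Real.pi + (Real.pi - -Real.pi) = Real.pi by ring]
  congr 1
  refine intervalIntegral.integral_congr fun x _ => ?_
  congr 1
  rw [fourier_coe_apply]
  congr 1
  have : (Real.pi : ℂ) ≠ 0 := by exact_mod_cast Real.pi_ne_zero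
  push_cast
  field_simp
  ring

lemma coef_cos (k n : ℤ) : coef (fun x => Real.cos (k * x)) n
    = ((if n = k then 1 else 0) + if n = -k then 1 else 0) / 2 := by
  have hi : ∀ k : ℤ, Integrable (fun x : ℝ => Complex.exp (k * x * Complex.I)) muPer := by
    intro k
    have hc : Continuous fun x : ℝ => Complex.exp (k * x * Complex.I) := by fun_prop
    exact (hc.integrableOn_Icc (a := -Real.pi) (b := Real.pi)).mono_set Ioc_subset_Icc_self
  have e : (fun x : ℝ => ((Real.cos (k * x) : ℝ) : ℂ)) = fun x : ℝ => (1 / 2 : ℂ) *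
      (Complex.exp (k * x * Complex.I) + Complex.exp (((-k : ℤ) : ℂ) * x * Complex.I)) := by
    funext x
    rw [Complex.ofReal_cos, Complex.cos]
    push_cast
    ring_nf
  rw [coef_eq_ccoef, e, ccoef_const_mul, ccoef_add (hi k) (hi (-k)), ccoef_exp, ccoef_exp]
  ring

lemma summable_waveFun {f : ℤ → ℂ} (hf : Summable fun n => ‖f n‖) (x : ℝ) :
    Summable fun n : ℤ => (f n).re * Real.cos (n * x) := by
  refine Summable.of_norm_bounded hf fun n => ?_
  rw [norm_mul]
  calc _ ≤ ‖f n‖ * 1 := mul_le_mul (Complex.abs_re_le_norm _) (Real.abs_cos_le_one _)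
        (abs_nonneg _) (norm_nonneg _)
    _ = _ := mul_one _

lemma continuous_waveFun {f : ℤ → ℂ} (hf : Summable fun n => ‖f n‖) : Continuous (waveFun f) := by
  refine continuous_tsum (fun n => by fun_prop) hf fun n x => ?_
  rw [norm_mul]
  calc _ ≤ ‖f n‖ * 1 := mul_le_mul (Complex.abs_re_le_norm _) (Real.abs_cos_le_one _)
        (abs_nonneg _) (norm_nonneg _)
    _ = _ := mul_one _

lemma periodic_waveFun (f : ℤ → ℂ) : Function.Periodic (waveFun f) (2 * Real.pi) := by
  intro x
  refine tsum_congr fun n => ?_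
  rw [mul_add, Real.cos_add_int_mul_two_pi]

lemma even_waveFun (f : ℤ → ℂ) : Function.Even (waveFun f) := by
  intro x
  refine tsum_congr fun n => ?_
  rw [mul_neg, Real.cos_neg]

lemma memL2per_waveFun {f : ℤ → ℂ} (hf : Summable fun n => ‖f n‖) : MemL2per (waveFun f) :=
  MemL2per.of_continuous (periodic_waveFun f) (continuous_waveFun hf)

lemma coef_waveFun {f : ℤ → ℂ} (hf : Summable fun n => ‖f n‖)
    (hreal : ∀ n, (starRingEnd ℂ) (f n) = f n) (heven : ∀ n, f (-n) = f n) :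
    coef (waveFun f) = f := by
  funext n
  set F : ℤ → ℝ → ℂ := fun k x =>
    Complex.exp (-(n * x * Complex.I)) * (((f k).re * Real.cos (k * x) : ℝ) : ℂ) with hF
  have hFc : ∀ k, Continuous (F k) := fun k => by simp only [hF]; fun_prop
  have hFb : ∀ k x, ‖F k x‖ ≤ ‖f k‖ := by
    intro k x
    simp only [hF]
    rw [norm_mul, show -((n : ℂ) * x * Complex.I) = ((-(n * x) : ℝ) : ℂ) * Complex.I by
      push_cast; ring, Complex.norm_exp_ofReal_mul_I, one_mul, Complex.norm_real, norm_mul]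
    calc _ ≤ ‖f k‖ * 1 := mul_le_mul (Complex.abs_re_le_norm _) (Real.abs_cos_le_one _)
          (abs_nonneg _) (norm_nonneg _)
      _ = _ := mul_one _
  have hFi : ∀ k, Integrable (F k) muPer := fun k =>
    ((hFc k).integrableOn_Icc (a := -Real.pi) (b := Real.pi)).mono_set Ioc_subset_Icc_self
  have hFs : Summable fun k => ∫ x, ‖F k x‖ ∂muPer := by
    refine Summable.of_nonneg_of_le (fun k => integral_nonneg fun x => norm_nonneg _)
      (fun k => ?_) (hf.mul_left (muPer.real univ))
    calc ∫ x, ‖F k x‖ ∂muPer ≤ ∫ _, ‖f k‖ ∂muPer :=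
          integral_mono (hFi k).norm (integrable_const _) (hFb k)
      _ = _ := by rw [integral_const, smul_eq_mul]
  have hsw := integral_tsum_of_summable_integral_norm hFi hFs
  rw [coef_eq_ccoef, ccoef_eq]
  have e1 : ∀ x : ℝ, Complex.exp (-(n * x * Complex.I)) * (waveFun f x : ℂ) = ∑' k, F k x := by
    intro x
    rw [waveFun, Complex.ofReal_tsum, ← tsum_mul_left]
  simp only [e1]
  rw [← hsw, ← tsum_mul_left]
  have e2 : ∀ k, (2 * Real.pi : ℂ)⁻¹ * ∫ x, F k x ∂muPer
      = f k * (((if n = k then 1 else 0) + if n = -k then 1 else 0) / 2) := by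
    intro k
    have hre : (((f k).re : ℝ) : ℂ) = f k := Complex.conj_eq_iff_re.1 (hreal k)
    rw [← coef_cos k n, ← hre]
    rw [← coef_const_mul, coef_eq_ccoef, ccoef_eq]
  simp only [e2]
  have e3 : ∀ k, f k * (((if n = k then 1 else 0) + if n = -k then 1 else 0) / 2)
      = (if k = n then f n / 2 else 0) + if k = -n then f n / 2 else 0 := by
    intro k
    by_cases h1 : k = n
    · subst h1
      simp only [if_true]
      split_ifs <;> ring
    · rw [if_neg (Ne.symm h1), if_neg h1]
      by_cases h2 : k = -n
      · subst h2
        rw [if_pos (by ring), if_pos rfl, heven]; ring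
      · rw [if_neg (by omega), if_neg h2]; ring
  simp only [e3]
  rw [((hasSum_ite_eq n (f n / 2)).add (hasSum_ite_eq (-n) (f n / 2))).tsum_eq]
  ring

lemma abs_sin_nat_mul_le (n : ℕ) (x : ℝ) : |Real.sin (n * x)| ≤ n * |Real.sin x| := by
  induction n with
  | zero => simp
  | succ k ih =>
    push_cast
    rw [add_mul, one_mul, Real.sin_add]
    refine (abs_add_le _ _).trans ?_
    rw [abs_mul, abs_mul]
    have h1 := mul_le_mul ih (Real.abs_cos_le_one x) (abs_nonneg _) (by positivity)
    have h2 := mul_le_mul_of_nonneg_right (Real.abs_cos_le_one (k * x)) (abs_nonneg (Real.sin x))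
    linarith

lemma abs_sin_int_mul_le (n : ℤ) (x : ℝ) : |Real.sin (n * x)| ≤ |(n : ℝ)| * |Real.sin x| := by
  obtain ⟨k, rfl | rfl⟩ := n.eq_nat_or_neg
  · simpa using abs_sin_nat_mul_le k x
  · simpa using abs_sin_nat_mul_le k x

/-- A difference of cosines is a product of two sines, and `|sin (n t)| ≤ |n| |sin t|` applies to
each. Measuring the variation against `cos` rather than `x` keeps control near the extrema. -/
lemma abs_cos_sub_le (n : ℤ) (x y : ℝ) :
    |Real.cos (n * x) - Real.cos (n * y)| ≤ (n : ℝ) ^ 2 * |Real.cos x - Real.cos y| := by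
  rw [Real.cos_sub_cos, Real.cos_sub_cos, abs_mul, abs_mul, abs_mul, abs_mul,
    show ((n : ℝ) * x + n * y) / 2 = n * ((x + y) / 2) by ring,
    show ((n : ℝ) * x - n * y) / 2 = n * ((x - y) / 2) by ring]
  have h1 := abs_sin_int_mul_le n ((x + y) / 2)
  have h2 := abs_sin_int_mul_le n ((x - y) / 2)
  have h3 := mul_le_mul h1 h2 (abs_nonneg _) (by positivity)
  have h4 : (n : ℝ) ^ 2 = |(n : ℝ)| * |(n : ℝ)| := by rw [abs_mul_abs_self, sq]
  rw [h4]
  nlinarith [abs_nonneg (-2 : ℝ)]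

/-- A cosine series dominated by its first mode is a monotone function of the cosine. -/
lemma waveFun_modes_sub {a : ℝ} {r : ℤ → ℂ} (h0 : r 0 = 0)
    (hr : Summable fun n : ℤ => (n : ℝ) ^ 2 * ‖r n‖)
    (hra : ∑' n : ℤ, (n : ℝ) ^ 2 * ‖r n‖ ≤ |a| / 2) (h1 : r 1 = 0) (h1' : r (-1) = 0) (x y : ℝ) :
    |waveFun (modes a r) x - waveFun (modes a r) y - a * (Real.cos x - Real.cos y)|
      ≤ |a| / 2 * |Real.cos x - Real.cos y| := by
  have hrn : Summable fun n => ‖r n‖ := by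
    refine Summable.of_nonneg_of_le (fun n => norm_nonneg _) (fun n => ?_) hr
    by_cases hn : n = 0
    · subst hn; simp [h0]
    · have : (1 : ℝ) ≤ (n : ℝ) ^ 2 := by
        have : 0 < n ^ 2 := by positivity
        exact_mod_cast this
      nlinarith [norm_nonneg (r n)]
  have hsp : ∀ x, waveFun (modes a r) x = a * Real.cos x + waveFun r x := by
    intro x
    have e : ∀ n : ℤ, (modes a r n).re * Real.cos (n * x) =
        ((if n = 1 then a / 2 * Real.cos x else 0) + (if n = -1 then a / 2 * Real.cos x else 0))
        + (r n).re * Real.cos (n * x) := by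
      intro n
      unfold modes
      by_cases hn : n = 1
      · subst hn; simp [h1]
      · by_cases hn' : n = -1
        · subst hn'; simp [h1']
        · rw [if_neg (by rw [abs_eq (by norm_num)]; omega), if_neg hn, if_neg hn']
          simp
    unfold waveFun
    simp only [e]
    have hs := (hasSum_ite_eq (1 : ℤ) (a / 2 * Real.cos x)).add
      (hasSum_ite_eq (-1 : ℤ) (a / 2 * Real.cos x))
    rw [(hs.add (summable_waveFun hrn x).hasSum).tsum_eq]
    ring
  rw [hsp, hsp]
  have hd : waveFun r x - waveFun r y
      = ∑' n : ℤ, (r n).re * (Real.cos (n * x) - Real.cos (n * y)) := by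
    unfold waveFun
    rw [← (summable_waveFun hrn x).tsum_sub (summable_waveFun hrn y)]
    simp only [mul_sub]
  rw [show a * Real.cos x + waveFun r x - (a * Real.cos y + waveFun r y)
    - a * (Real.cos x - Real.cos y) = waveFun r x - waveFun r y by ring, hd]
  have hb : ∀ n : ℤ, ‖(r n).re * (Real.cos (n * x) - Real.cos (n * y))‖
      ≤ (n : ℝ) ^ 2 * ‖r n‖ * |Real.cos x - Real.cos y| := by
    intro n
    rw [norm_mul, Real.norm_eq_abs, Real.norm_eq_abs]
    calc _ ≤ ‖r n‖ * ((n : ℝ) ^ 2 * |Real.cos x - Real.cos y|) :=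
          mul_le_mul (Complex.abs_re_le_norm _) (abs_cos_sub_le n x y) (abs_nonneg _)
            (norm_nonneg _)
      _ = _ := by ring
  have := tsum_of_norm_bounded (hr.mul_right |Real.cos x - Real.cos y|).hasSum hb
  rw [tsum_mul_right] at this
  exact this.trans (mul_le_mul_of_nonneg_right hra (abs_nonneg _))

lemma isLocalMax_cos_iff (x : ℝ) : IsLocalMax Real.cos x ↔ ∃ n : ℤ, x = 2 * Real.pi * n := by
  constructor
  · intro h
    have hs : Real.sin x = 0 := by simpa using h.deriv_eq_zero
    obtain ⟨k, hk⟩ := Real.sin_eq_zero_iff.1 hs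
    rcases Int.even_or_odd k with ⟨m, hm⟩ | ⟨m, hm⟩
    · exact ⟨m, by rw [← hk, hm]; push_cast; ring⟩
    · exfalso
      have hc : Real.cos x = -1 := by
        rw [← hk, hm]; push_cast
        rw [show (2 * (m : ℝ) + 1) * Real.pi = Real.pi + m * (2 * Real.pi) by ring,
          Real.cos_add_int_mul_two_pi, Real.cos_pi]
      -- A local maximum at the global minimum value would make `cos` locally constant, but its
      -- second derivative there is `1`.
      have h1 : Real.cos =ᶠ[nhds x] fun _ => -1 := by
        filter_upwards [h] with y hy
        rw [hc] at hy
        exact le_antisymm hy (Real.neg_one_le_cos y)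
      have h2 := h1.deriv
      have h3 : deriv Real.cos = fun y => -Real.sin y := by funext y; simp
      rw [h3] at h2
      have h4 : deriv (fun y => -Real.sin y) x = 0 := by
        rw [h2.deriv_eq]; simp
      simp [hc] at h4
  · rintro ⟨n, rfl⟩
    refine Filter.Eventually.of_forall fun y => ?_
    rw [show 2 * Real.pi * (n : ℝ) = 0 + n * (2 * Real.pi) by ring, Real.cos_add_int_mul_two_pi,
      Real.cos_zero]
    exact Real.cos_le_one y

lemma isLocalMin_cos_iff (x : ℝ) :
    IsLocalMin Real.cos x ↔ ∃ n : ℤ, x = Real.pi + 2 * Real.pi * n := by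
  have e : IsLocalMin Real.cos x ↔ IsLocalMax Real.cos (x - Real.pi) := by
    constructor
    · intro h
      have h1 : Filter.Tendsto (fun y => y + Real.pi) (nhds (x - Real.pi)) (nhds x) := by
        have : Continuous fun y : ℝ => y + Real.pi := by fun_prop
        simpa using this.tendsto (x - Real.pi)
      filter_upwards [h1.eventually h] with y hy
      rw [Real.cos_add_pi] at hy
      rw [Real.cos_sub_pi]; linarith
    · intro h
      have h1 : Filter.Tendsto (fun y => y - Real.pi) (nhds x) (nhds (x - Real.pi)) := by
        have : Continuous fun y : ℝ => y - Real.pi := by fun_prop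
        exact this.tendsto x
      filter_upwards [h1.eventually h] with y hy
      rw [Real.cos_sub_pi, Real.cos_sub_pi] at hy
      linarith
  rw [e, isLocalMax_cos_iff]
  exact exists_congr fun n => by constructor <;> intro h <;> linarith

lemma isSingleLobe_of_cos {ψ : ℝ → ℝ} (h : ∀ x y, ψ x ≤ ψ y ↔ Real.cos x ≤ Real.cos y) :
    IsSingleLobe ψ := by
  refine ⟨fun x => ?_, Real.pi, fun x => ?_⟩
  · rw [← isLocalMax_cos_iff]
    exact Filter.eventually_congr (Filter.Eventually.of_forall fun y => h y x)
  · rw [← isLocalMin_cos_iff]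
    exact Filter.eventually_congr (Filter.Eventually.of_forall fun y => h x y)

/-- The sum `∑ 1 / n²` over the nonzero integers. -/
def invSqSum : ℝ := ∑' n : ℤ, 1 / (n : ℝ) ^ 2

lemma summable_invSq : Summable fun n : ℤ => 1 / (n : ℝ) ^ 2 :=
  Real.summable_one_div_int_pow.2 (by norm_num)

lemma invSqSum_nonneg : 0 ≤ invSqSum := tsum_nonneg fun _ => by positivity

lemma abs_rpow_four (n : ℤ) : |(n : ℝ)| ^ (4 : ℝ) = ((n : ℝ) ^ 2) ^ 2 := by
  rw [show (4 : ℝ) = ((4 : ℕ) : ℝ) by norm_num, Real.rpow_natCast, ← sq_abs (n : ℝ), ← pow_mul]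

lemma sq_mul_norm_le {r : ℤ → ℂ} {M : ℝ} (hd : ∀ n : ℤ, |(n : ℝ)| ^ (4 : ℝ) * ‖r n‖ ≤ M) (n : ℤ) :
    (n : ℝ) ^ 2 * ‖r n‖ ≤ M * (1 / (n : ℝ) ^ 2) := by
  by_cases hn : n = 0
  -- Here `1 / 0 = 0`, and both sides vanish.
  · subst hn; simp
  · have h2 : 0 < (n : ℝ) ^ 2 := by positivity
    rw [mul_one_div, le_div_iff₀ h2]
    have := hd n
    rw [abs_rpow_four] at this
    linarith

lemma summable_sq_mul_norm {r : ℤ → ℂ} {M : ℝ}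
    (hd : ∀ n : ℤ, |(n : ℝ)| ^ (4 : ℝ) * ‖r n‖ ≤ M) : Summable fun n : ℤ => (n : ℝ) ^ 2 * ‖r n‖ :=
  Summable.of_nonneg_of_le (fun _ => by positivity) (sq_mul_norm_le hd) (summable_invSq.mul_left M)

lemma tsum_sq_mul_norm_le {r : ℤ → ℂ} {M : ℝ}
    (hd : ∀ n : ℤ, |(n : ℝ)| ^ (4 : ℝ) * ‖r n‖ ≤ M) :
    ∑' n : ℤ, (n : ℝ) ^ 2 * ‖r n‖ ≤ M * invSqSum := by
  rw [invSqSum, ← tsum_mul_left]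
  exact (summable_sq_mul_norm hd).tsum_le_tsum (sq_mul_norm_le hd) (summable_invSq.mul_left M)

lemma summable_norm_of_decay {r : ℤ → ℂ} {M : ℝ} (h0 : r 0 = 0)
    (hd : ∀ n : ℤ, |(n : ℝ)| ^ (4 : ℝ) * ‖r n‖ ≤ M) : Summable fun n => ‖r n‖ := by
  refine Summable.of_nonneg_of_le (fun n => norm_nonneg _) (fun n => ?_) (summable_sq_mul_norm hd)
  by_cases hn : n = 0
  · subst hn; simp [h0]
  · have h1 := one_le_abs_cast hn
    have : 1 ≤ (n : ℝ) ^ 2 := by rw [← sq_abs]; nlinarith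
    nlinarith [norm_nonneg (r n)]

/-- For `α ≤ 2` and `n ≠ 0` the weight is at most `4 n⁴`, so decay of order four leaves a summable
bound with room to spare. -/
lemma wt_mul_sq_le {α M : ℝ} (hα2 : α ≤ 2) {f : ℤ → ℂ} (h0 : f 0 = 0)
    (hd : ∀ n : ℤ, |(n : ℝ)| ^ (4 : ℝ) * ‖f n‖ ≤ M) (n : ℤ) :
    (1 + (n : ℝ) ^ 2) ^ α * ‖f n‖ ^ 2 ≤ 4 * M ^ 2 * (1 / (n : ℝ) ^ 2) := by
  by_cases hn : n = 0
  · subst hn; simp [h0]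
  · have h1 := one_le_abs_cast hn
    have h2 : 1 ≤ (n : ℝ) ^ 2 := by rw [← sq_abs]; nlinarith
    have h3 : (1 + (n : ℝ) ^ 2) ^ α ≤ 4 * ((n : ℝ) ^ 2) ^ 2 := by
      calc (1 + (n : ℝ) ^ 2) ^ α ≤ (1 + (n : ℝ) ^ 2) ^ (2 : ℝ) :=
            Real.rpow_le_rpow_of_exponent_le (by linarith) hα2
        _ = (1 + (n : ℝ) ^ 2) ^ 2 := by
            rw [show (2 : ℝ) = ((2 : ℕ) : ℝ) by norm_num, Real.rpow_natCast]
        _ ≤ _ := by nlinarith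
    have h4 := hd n
    rw [abs_rpow_four] at h4
    set m := (n : ℝ) ^ 2
    rw [mul_one_div, le_div_iff₀ (by linarith)]
    have h5 : (m ^ 2 * ‖f n‖) ^ 2 ≤ M ^ 2 := pow_le_pow_left₀ (by positivity) h4 2
    calc (1 + m) ^ α * ‖f n‖ ^ 2 * m ≤ 4 * m ^ 2 * ‖f n‖ ^ 2 * m := by gcongr
      _ ≤ 4 * m ^ 2 * ‖f n‖ ^ 2 * m ^ 2 := by
          gcongr; nlinarith
      _ = 4 * (m ^ 2 * ‖f n‖) ^ 2 := by ring
      _ ≤ _ := by linarith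

lemma memHper_of_decay {α M : ℝ} (hα2 : α ≤ 2) {u : ℝ → ℝ} (hu : MemL2per u)
    (h0 : coef u 0 = 0) (hd : ∀ n : ℤ, |(n : ℝ)| ^ (4 : ℝ) * ‖coef u n‖ ≤ M) : MemHper α u :=
  ⟨hu, Summable.of_nonneg_of_le (fun _ => by positivity) (wt_mul_sq_le hα2 h0 hd)
    (summable_invSq.mul_left _)⟩

lemma hperNorm_le_of_decay {α M : ℝ} (hα2 : α ≤ 2) {u : ℝ → ℝ} (hu : MemL2per u)
    (h0 : coef u 0 = 0) (hd : ∀ n : ℤ, |(n : ℝ)| ^ (4 : ℝ) * ‖coef u n‖ ≤ M) :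
    hperNorm α u ≤ 2 * √invSqSum * M := by
  have hM : 0 ≤ M := le_trans (by positivity) (hd 1)
  have h1 : ∑' n : ℤ, (1 + (n : ℝ) ^ 2) ^ α * ‖coef u n‖ ^ 2 ≤ 4 * M ^ 2 * invSqSum := by
    rw [invSqSum, ← tsum_mul_left]
    exact (memHper_of_decay hα2 hu h0 hd).2.tsum_le_tsum (wt_mul_sq_le hα2 h0 hd)
      (summable_invSq.mul_left _)
  refine (Real.sqrt_le_sqrt h1).trans (le_of_eq ?_)
  rw [Real.sqrt_mul (by positivity), show 4 * M ^ 2 = (2 * M) ^ 2 by ring,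
    Real.sqrt_sq (by positivity)]
  ring

lemma coef_const (m : ℝ) (n : ℤ) : coef (fun _ => m) n = if n = 0 then (m : ℂ) else 0 := by
  have h := coef_const_mul m (fun x => Real.cos ((0 : ℤ) * x)) n
  rw [coef_cos] at h
  simp only [Int.cast_zero, zero_mul, Real.cos_zero, mul_one, neg_zero] at h
  rw [h]
  split_ifs <;> ring

/-- A continuous function whose Fourier coefficients are real and even and absolutely summable is
the sum of its cosine series. -/
lemma eq_waveFun_of_coef {u : ℝ → ℝ} (hc : Continuous u) {v : ℝ → ℝ} (hv : MemL2per v)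
    (huv : ∀ᵐ x, u x = v x) {f : ℤ → ℂ} (hf : Summable fun n => ‖f n‖)
    (hreal : ∀ n, (starRingEnd ℂ) (f n) = f n) (heven : ∀ n, f (-n) = f n)
    (h : coef v = f) : u = waveFun f := by
  refine (hc.ae_eq_iff_eq volume (continuous_waveFun hf)).1 ?_
  filter_upwards [huv, hv.ae_eq (memL2per_waveFun hf) (by rw [h, coef_waveFun hf hreal heven])]
    with x h1 h2
  rw [h1, h2]

lemma isSolution_waveFun {α c M : ℝ} (hα : 1 / 2 < α) (hα2 : α ≤ 2) (hc1 : -1 < c) {f : ℤ → ℂ}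
    (hf : IsWaveSeq α c f) (hreal : ∀ n, (starRingEnd ℂ) (f n) = f n)
    (hd : ∀ n : ℤ, |(n : ℝ)| ^ (4 : ℝ) * ‖f n‖ ≤ M) : IsSolution α c (waveFun f) := by
  have hα0 : 0 < α := by linarith
  have hs := summable_norm_of_decay hf.zero hd
  have hcoef := coef_waveFun hs hreal fun n => by rw [hf.neg, hreal]
  have hu := memL2per_waveFun hs
  have hcont := continuous_waveFun hs
  have hH : MemHper α (waveFun f) := memHper_of_decay hα2 hu (by rw [hcoef, hf.zero])
    (by rw [hcoef]; exact hd)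
  refine ⟨hH, ?_, ?_⟩
  · rw [mean, integral_of_coef_zero (by rw [hcoef, hf.zero]), mul_zero]
  · obtain ⟨hD, hDc⟩ := fracDeriv_spec hα0.le hH
    have hq : MemL2per fun x => waveFun f x ^ 2 := MemL2per.of_continuous
      (fun x => by simp only [periodic_waveFun f x]) (hcont.pow 2)
    have hm : MemL2per fun _ => mean fun y => waveFun f y ^ 2 := MemL2per.of_continuous
      (fun x => rfl) continuous_const
    have hv : MemL2per fun x => waveFun f x ^ 2 - mean fun y => waveFun f y ^ 2 :=
      MemL2per.of_continuous (fun x => by simp only [periodic_waveFun f x])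
        ((hcont.pow 2).sub continuous_const)
    refine (hD.add (hu.const_mul c)).ae_eq hv (funext fun n => ?_)
    rw [coef_add hD.integrable (hu.const_mul c).integrable, hDc, coef_const_mul,
      coef_sub hq.integrable hm.integrable, coef_const]
    by_cases hn : n = 0
    · subst hn
      rw [hcoef, hf.zero, if_pos rfl, coef_zero_eq, mean]
      simp
    · rw [if_neg hn, coef_sq hu.2, hcoef, ← hf.equation hα hc1 hn]
      push_cast; ring

/-- The higher modes change a difference of values by at most half of what the first mode produces,
so they cannot change its sign. Negative `a` is allowed because the half-period translate of a
branch wave is needed too. -/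
lemma waveFun_modes_le_iff {a : ℝ} {r : ℤ → ℂ} (hlow : ∀ n, |n| ≤ 1 → r n = 0)
    (hr : Summable fun n : ℤ => (n : ℝ) ^ 2 * ‖r n‖)
    (hra : ∑' n : ℤ, (n : ℝ) ^ 2 * ‖r n‖ ≤ |a| / 2) (x y : ℝ) :
    waveFun (modes a r) x ≤ waveFun (modes a r) y ↔ a * Real.cos x ≤ a * Real.cos y := by
  have h := abs_le.1 (waveFun_modes_sub (hlow 0 (by norm_num)) hr hra (hlow 1 (by norm_num))
    (hlow (-1) (by norm_num)) x y)
  have h2 : |a| / 2 * |Real.cos x - Real.cos y| = |a * (Real.cos x - Real.cos y)| / 2 := by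
    rw [abs_mul]; ring
  rw [h2, mul_sub] at h
  constructor
  · intro h3
    by_contra! h4
    rw [abs_of_pos (by linarith)] at h
    linarith [h.1]
  · intro h3
    rw [abs_of_nonpos (by linarith)] at h
    linarith [h.2]

lemma isMinimizerWave_waveFun {α c a : ℝ} {r : ℤ → ℂ} (ha : 0 < a)
    (hf : IsWaveSeq α c (modes a r)) (hs : Summable fun n => ‖modes a r n‖)
    (hreal : ∀ n, (starRingEnd ℂ) (modes a r n) = modes a r n) (hlow : ∀ n, |n| ≤ 1 → r n = 0)
    (hr : Summable fun n : ℤ => (n : ℝ) ^ 2 * ‖r n‖)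
    (hra : ∑' n : ℤ, (n : ℝ) ^ 2 * ‖r n‖ ≤ a / 2) :
    IsMinimizerWave α c (waveFun (modes a r)) := by
  have hcoef := coef_waveFun hs hreal fun n => by rw [hf.neg, hreal]
  refine ⟨continuous_waveFun hs, even_waveFun _, isSingleLobe_of_cos fun x y => ?_, ?_⟩
  · rw [waveFun_modes_le_iff hlow hr (by rwa [abs_of_pos ha]),
      mul_le_mul_iff_right₀ ha]
  · obtain ⟨φ, hφ, h⟩ := hf
    refine ⟨φ, hφ, (memL2per_waveFun hs).ae_eq (hφ.1.1.1.const_mul _) (funext fun n => ?_)⟩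
    rw [hcoef, h, coef_const_mul]

lemma rot_pi_modes (a : ℝ) (r : ℤ → ℂ) : rot Real.pi (modes a r) = modes (-a) (rot Real.pi r) := by
  funext n
  unfold modes
  by_cases hn : |n| = 1
  · rw [rot, if_pos hn, if_pos hn]
    rcases (abs_eq (by norm_num)).1 hn with h | h
    · rw [h]; simp [Complex.exp_pi_mul_I, neg_div]
    · rw [h]; simp [Complex.exp_neg, Complex.exp_pi_mul_I, neg_div]
  · rw [rot, if_neg hn, if_neg hn, rot]

lemma rot_rot (θ η : ℝ) (f : ℤ → ℂ) : rot θ (rot η f) = rot (θ + η) f := by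
  funext n
  rw [rot, rot, rot, ← mul_assoc, ← Complex.exp_add]
  congr 2
  push_cast; ring

lemma rot_two_pi (f : ℤ → ℂ) : rot (Real.pi + Real.pi) f = f := by
  funext n
  have h := Complex.exp_int_mul_two_pi_mul_I n
  rw [rot, show (((n * (Real.pi + Real.pi) : ℝ)) : ℂ) * Complex.I
    = n * (2 * Real.pi * Complex.I) by push_cast; ring, h, one_mul]

/-- Evenness makes all coefficients real, so the first one is normalised up to sign. The negative
sign is excluded by the position of the maximum: after a half-period translation the wave would be
the branch wave, so the wave itself would be ordered as `-cos x`. -/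
lemma IsMinimizerWave.eq_waveFun {α c a M : ℝ} (hα : 1 / 2 < α) {r : ℤ → ℂ} (ha : 0 < a)
    (huniq : ∀ a' f, 0 ≤ a' → IsWaveSeq α c f → f 1 = ((a' / 2 : ℝ) : ℂ) → f = modes a r)
    (hlow : ∀ n, |n| ≤ 1 → r n = 0)
    (hd : ∀ n : ℤ, |(n : ℝ)| ^ (4 : ℝ) * ‖r n‖ ≤ M) (hM : M * invSqSum ≤ a / 2)
    (hdm : ∀ n : ℤ, |(n : ℝ)| ^ (4 : ℝ) * ‖modes a r n‖ ≤ M + a / 2)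
    {ψ : ℝ → ℝ} (hψ : IsMinimizerWave α c ψ) : ψ = waveFun (modes a r) := by
  obtain ⟨φ, hφ, hae⟩ := hψ.minimizer
  set v : ℝ → ℝ := fun x => 2 * quadForm α c φ * φ x with hv
  have hvL : MemL2per v := hφ.1.1.1.const_mul _
  have hw : IsWaveSeq α c (coef v) := ⟨φ, hφ, fun n => coef_const_mul _ _ n⟩
  have heven : ∀ n, coef v (-n) = coef v n := by
    intro n
    have hve : v =ᵐ[muPer] fun x => v (-x) := by
      refine ae_restrict_of_ae ?_
      have h2 : ∀ᵐ x : ℝ, ψ (-x) = v (-x) :=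
        (Measure.measurePreserving_neg (volume : Measure ℝ)).quasiMeasurePreserving.ae hae
      filter_upwards [hae, h2] with x h1 h2
      rw [← h2, hψ.even, h1]
    rw [congrFun (coef_congr hve) n]
    rw [coef_eq_ccoef, coef_eq_ccoef, ccoef_eq, ccoef_eq, ← intervalIntegral_eq_muPer,
      ← intervalIntegral_eq_muPer]
    congr 1
    have := intervalIntegral.integral_comp_neg (a := -Real.pi) (b := Real.pi)
      fun x : ℝ => Complex.exp (-((((-n : ℤ) : ℂ)) * x * Complex.I)) * (v x : ℂ)
    rw [neg_neg] at this
    rw [← this]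
    refine intervalIntegral.integral_congr fun x _ => ?_
    simp
  have hreal : ∀ n, (starRingEnd ℂ) (coef v n) = coef v n := fun n => by rw [← hw.neg, heven]
  have h1re : coef v 1 = ((2 * (coef v 1).re / 2 : ℝ) : ℂ) := by
    rw [mul_div_cancel_left₀ _ two_ne_zero]
    exact (Complex.conj_eq_iff_re.1 (hreal 1)).symm
  have hsum : ∀ f : ℤ → ℂ, f 0 = 0 → (∀ n, ‖f n‖ = ‖modes a r n‖) → Summable fun n => ‖f n‖ :=
    fun f h0 h => summable_norm_of_decay h0 fun n => by rw [h]; exact hdm n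
  rcases le_or_gt 0 (coef v 1).re with hs | hs
  · have he := huniq _ _ (by positivity) hw h1re
    rw [← he]
    exact eq_waveFun_of_coef hψ.cont hvL hae (hsum _ hw.zero fun n => by rw [he]) hreal heven rfl
  · exfalso
    have he := huniq (2 * -(coef v 1).re) _ (by linarith) (hw.rot hα Real.pi) (by
      rw [rot, h1re]
      simp [Complex.exp_pi_mul_I]
      ring)
    have he2 : coef v = modes (-a) (rot Real.pi r) := by
      rw [← rot_pi_modes, ← he, rot_rot, rot_two_pi]
    have hnorm : ∀ n, ‖coef v n‖ = ‖modes a r n‖ := by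
      intro n
      rw [← he, norm_rot]
    have hψe := eq_waveFun_of_coef hψ.cont hvL hae (hsum _ hw.zero hnorm) hreal heven rfl
    have hmax : IsLocalMax ψ 0 := (hψ.lobe.1 0).2 ⟨0, by simp⟩
    have hle : ∀ x y, ψ x ≤ ψ y ↔ -a * Real.cos x ≤ -a * Real.cos y := by
      intro x y
      rw [hψe, he2]
      refine waveFun_modes_le_iff (fun n hn => by rw [rot, hlow n hn, mul_zero]) ?_ ?_ x y
      · simp only [norm_rot]; exact summable_sq_mul_norm hd
      · simp only [norm_rot, abs_neg, abs_of_pos ha]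
        exact (tsum_sq_mul_norm_le hd).trans hM
    have hmin : IsLocalMin Real.cos 0 := by
      filter_upwards [hmax] with x hx
      have := (hle x 0).1 hx
      nlinarith
    obtain ⟨n, hn⟩ := (isLocalMin_cos_iff 0).1 hmin
    have h3 : Real.pi * (1 + 2 * (n : ℝ)) = 0 := by linarith
    have h4 := (mul_eq_zero.1 h3).resolve_left Real.pi_ne_zero
    have h5 : 1 + 2 * n = 0 := by exact_mod_cast h4
    omega

/-! ### The Stokes expansion and the bijection between speed and amplitude. -/

lemma stokes_algebra {C c a D₂ D₃ : ℝ} {z₂ z₃ : ℂ} (hC : 0 ≤ C) (hD₂ : 0 < D₂) (hD₃ : 0 < D₃)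
    (hc : -1 < c) (ha : 0 < a) (ha1 : a ≤ 1) (hz₂ : ‖z₂‖ ≤ C * a ^ 2) (hz₃ : ‖z₃‖ ≤ C * a ^ 2)
    (h₂ : ‖((D₂ + (1 + c) : ℝ) : ℂ) * z₂ - ((a ^ 2 / 4 : ℝ) : ℂ)‖ ≤ C * a ^ 4)
    (h₃ : ‖((D₃ + (1 + c) : ℝ) : ℂ) * z₃ - a * z₂‖ ≤ C * a ^ 4)
    (h₁ : ‖((1 + c : ℝ) : ℂ) - 2 * z₂‖ ≤ C * a ^ 4) :
    ‖z₂ - ((a ^ 2 / (4 * D₂) : ℝ) : ℂ)‖ ≤ (C + 3 * C ^ 2) / D₂ * a ^ 4 ∧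
    ‖z₃ - ((a ^ 3 / (4 * D₂ * D₃) : ℝ) : ℂ)‖
      ≤ (C + 3 * C ^ 2 + (C + 3 * C ^ 2) / D₂) / D₃ * a ^ 4 ∧
    |c - (-1 + a ^ 2 / (2 * D₂))| ≤ (C + 2 * ((C + 3 * C ^ 2) / D₂)) * a ^ 4 := by
  set e : ℝ := 1 + c with he
  set K := (C + 3 * C ^ 2) / D₂ with hK
  have hK0 : 0 ≤ K := by positivity
  have hKD : K * D₂ = C + 3 * C ^ 2 := by rw [hK]; field_simp
  have he0 : 0 < e := by linarith
  have ha4 : a ^ 4 ≤ a ^ 2 := pow_le_pow_of_le_one ha.le ha1 (by norm_num)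
  -- Since `1 + c` is itself `O(a²)`, replacing the symbols `D₂ + (1 + c)` and `D₃ + (1 + c)` by
  -- `D₂` and `D₃` costs only `O(a⁴)`.
  have hne : ‖(e : ℂ)‖ ≤ 3 * C * a ^ 2 := by
    calc ‖(e : ℂ)‖ = ‖((e : ℂ) - 2 * z₂) + 2 * z₂‖ := by rw [sub_add_cancel]
      _ ≤ C * a ^ 4 + 2 * (C * a ^ 2) := by
          refine (norm_add_le _ _).trans (add_le_add h₁ ?_)
          rw [norm_mul, Complex.norm_ofNat]
          linarith
      _ ≤ _ := by nlinarith
  have hez : ∀ z : ℂ, ‖z‖ ≤ C * a ^ 2 → ‖(e : ℂ) * z‖ ≤ 3 * C ^ 2 * a ^ 4 := by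
    intro z hz
    rw [norm_mul]
    calc _ ≤ 3 * C * a ^ 2 * (C * a ^ 2) := mul_le_mul hne hz (norm_nonneg _) (by positivity)
      _ = _ := by ring
  have hD₂c : (D₂ : ℂ) ≠ 0 := by exact_mod_cast hD₂.ne'
  have hD₃c : (D₃ : ℂ) ≠ 0 := by exact_mod_cast hD₃.ne'
  have r₂ : ‖z₂ - ((a ^ 2 / (4 * D₂) : ℝ) : ℂ)‖ ≤ K * a ^ 4 := by
    have e1 : (D₂ : ℂ) * (z₂ - ((a ^ 2 / (4 * D₂) : ℝ) : ℂ))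
        = (((D₂ + e : ℝ) : ℂ) * z₂ - ((a ^ 2 / 4 : ℝ) : ℂ)) - e * z₂ := by
      push_cast; field_simp; ring
    have e2 := (norm_sub_le _ _).trans (add_le_add h₂ (hez z₂ hz₂))
    rw [← e1, norm_mul, Complex.norm_real, Real.norm_eq_abs, abs_of_pos hD₂] at e2
    refine le_of_mul_le_mul_left ?_ hD₂
    calc _ ≤ _ := e2
      _ = K * D₂ * a ^ 4 := by rw [hKD]; ring
      _ = _ := by ring
  refine ⟨r₂, ?_, ?_⟩
  · have e1 : (D₃ : ℂ) * (z₃ - ((a ^ 3 / (4 * D₂ * D₃) : ℝ) : ℂ))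
        = (((D₃ + e : ℝ) : ℂ) * z₃ - a * z₂) - e * z₃
          + a * (z₂ - ((a ^ 2 / (4 * D₂) : ℝ) : ℂ)) := by
      push_cast; field_simp; ring
    have e3 : ‖(a : ℂ) * (z₂ - ((a ^ 2 / (4 * D₂) : ℝ) : ℂ))‖ ≤ K * a ^ 4 := by
      rw [norm_mul, Complex.norm_real, Real.norm_eq_abs, abs_of_pos ha]
      calc _ ≤ 1 * (K * a ^ 4) := mul_le_mul ha1 r₂ (norm_nonneg _) zero_le_one
        _ = _ := one_mul _
    have e2 := (norm_add_le _ _).trans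
      (add_le_add ((norm_sub_le _ _).trans (add_le_add h₃ (hez z₃ hz₃))) e3)
    rw [← e1, norm_mul, Complex.norm_real, Real.norm_eq_abs, abs_of_pos hD₃] at e2
    refine le_of_mul_le_mul_left ?_ hD₃
    calc _ ≤ _ := e2
      _ = D₃ * ((C + 3 * C ^ 2 + K) / D₃ * a ^ 4) := by field_simp
  · have e1 : ((c - (-1 + a ^ 2 / (2 * D₂)) : ℝ) : ℂ)
        = ((e : ℂ) - 2 * z₂) + 2 * (z₂ - ((a ^ 2 / (4 * D₂) : ℝ) : ℂ)) := by
      rw [he]; push_cast; field_simp; ring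
    have e2 : ‖(2 : ℂ) * (z₂ - ((a ^ 2 / (4 * D₂) : ℝ) : ℂ))‖ ≤ 2 * (K * a ^ 4) := by
      rw [norm_mul, Complex.norm_ofNat]; linarith
    have e3 := (norm_add_le _ _).trans (add_le_add h₁ e2)
    rw [← e1, Complex.norm_real, Real.norm_eq_abs] at e3
    linarith

lemma continuous_stokes (α a : ℝ) : Continuous (stokes α a) := by
  unfold stokes; fun_prop

lemma memL2per_cos (k : ℤ) : MemL2per fun x => Real.cos (k * x) :=
  MemL2per.of_continuous (fun x => by simp only [mul_add, Real.cos_add_int_mul_two_pi])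
    (by fun_prop)

lemma stokes_eq (α a : ℝ) : stokes α a = fun x => a * Real.cos ((1 : ℤ) * x)
    + a ^ 2 / (2 * (2 ^ α - 1)) * Real.cos ((2 : ℤ) * x)
    + a ^ 3 / (2 * (2 ^ α - 1) * (3 ^ α - 1)) * Real.cos ((3 : ℤ) * x) := by
  funext x; simp [stokes]

lemma memL2per_stokes (α a : ℝ) : MemL2per (stokes α a) := by
  rw [stokes_eq]
  exact (((memL2per_cos 1).const_mul a).add ((memL2per_cos 2).const_mul _)).add
    ((memL2per_cos 3).const_mul _)

lemma coef_stokes (α a : ℝ) (n : ℤ) : coef (stokes α a) n =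
    if |n| = 1 then ((a / 2 : ℝ) : ℂ) else if |n| = 2 then ((a ^ 2 / (4 * (2 ^ α - 1)) : ℝ) : ℂ)
    else if |n| = 3 then ((a ^ 3 / (4 * (2 ^ α - 1) * (3 ^ α - 1)) : ℝ) : ℂ) else 0 := by
  have h1 := (memL2per_cos 1).const_mul a
  have h2 := (memL2per_cos 2).const_mul (a ^ 2 / (2 * (2 ^ α - 1)))
  have h3 := (memL2per_cos 3).const_mul (a ^ 3 / (2 * (2 ^ α - 1) * (3 ^ α - 1)))
  rw [show a ^ 2 / (4 * (2 ^ α - 1)) = a ^ 2 / (2 * (2 ^ α - 1)) / 2 by rw [div_div]; congr 1; ring,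
    show a ^ 3 / (4 * (2 ^ α - 1) * (3 ^ α - 1)) = a ^ 3 / (2 * (2 ^ α - 1) * (3 ^ α - 1)) / 2 by
      rw [div_div]; congr 1; ring]
  rw [stokes_eq, coef_add (h1.add h2).integrable h3.integrable, coef_add h1.integrable h2.integrable,
    coef_const_mul, coef_const_mul, coef_const_mul, coef_cos, coef_cos, coef_cos]
  generalize a ^ 2 / (2 * (2 ^ α - 1)) = b₂
  generalize a ^ 3 / (2 * (2 ^ α - 1) * (3 ^ α - 1)) = b₃
  simp only [abs_eq (by norm_num : (0 : ℤ) ≤ 1), abs_eq (by norm_num : (0 : ℤ) ≤ 2),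
    abs_eq (by norm_num : (0 : ℤ) ≤ 3)]
  by_cases n1 : n = 1 ∨ n = -1
  · rw [if_pos n1]
    rcases n1 with rfl | rfl <;> norm_num <;> ring
  rw [if_neg n1]
  by_cases n2 : n = 2 ∨ n = -2
  · rw [if_pos n2]
    rcases n2 with rfl | rfl <;> norm_num <;> ring
  rw [if_neg n2]
  by_cases n3 : n = 3 ∨ n = -3
  · rw [if_pos n3]
    rcases n3 with rfl | rfl <;> norm_num <;> ring
  rw [if_neg n3]
  push Not at n1 n2 n3
  simp [n1, n2, n3]

/-- The amplitude of the `cos x` mode, read off from the first Fourier coefficient. -/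
lemma integral_mul_cos {u : ℝ → ℝ} (hu : MemL2per u) {a : ℝ} (h1 : coef u 1 = ((a / 2 : ℝ) : ℂ)) :
    Real.pi⁻¹ * (∫ x in (-Real.pi)..Real.pi, u x * Real.cos x) = a := by
  have h := (hasSum_parseval hu.2 (memL2per_cos 1).2).tsum_eq
  have hm1 : coef u (-1) = ((a / 2 : ℝ) : ℂ) := by rw [coef_neg, h1, Complex.conj_ofReal]
  have e : ∀ n : ℤ, (coef u n * (starRingEnd ℂ) (coef (fun x => Real.cos ((1 : ℤ) * x)) n)).re
      = (if n = 1 then a / 4 else 0) + if n = -1 then a / 4 else 0 := by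
    intro n
    rw [coef_cos]
    by_cases h1' : n = 1
    · subst h1'
      rw [h1]; norm_num; ring
    · by_cases h2' : n = -1
      · subst h2'
        rw [hm1]; norm_num; ring
      · simp [h1', h2']
  simp only [e] at h
  rw [((hasSum_ite_eq (1 : ℤ) (a / 4)).add (hasSum_ite_eq (-1 : ℤ) (a / 4))).tsum_eq] at h
  simp only [Int.cast_one, one_mul] at h
  have hp := Real.pi_ne_zero
  rw [mul_inv] at h
  linear_combination -2 * h

lemma mean_sq {u : ℝ → ℝ} (hu : MemL2per u) : mean (fun x => u x ^ 2) = ∑' n, ‖coef u n‖ ^ 2 := by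
  rw [mean, intervalIntegral_eq_muPer, integral_sq hu.2, ← mul_assoc,
    inv_mul_cancel₀ (by have := Real.pi_pos; positivity), one_mul]

lemma tsum_modes_sq {a : ℝ} {r : ℤ → ℂ} (hr : SqSummable r) (hlow : ∀ n, |n| ≤ 1 → r n = 0) :
    ∑' n, ‖modes a r n‖ ^ 2 = a ^ 2 / 2 + l2 r ^ 2 := by
  have e : ∀ n : ℤ, ‖modes a r n‖ ^ 2 =
      ((if n = 1 then a ^ 2 / 4 else 0) + (if n = -1 then a ^ 2 / 4 else 0)) + ‖r n‖ ^ 2 := by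
    intro n
    by_cases hn : |n| = 1
    · rw [modes, if_pos hn, hlow n hn.le, Complex.norm_real, Real.norm_eq_abs, sq_abs]
      rcases (abs_eq (by norm_num)).1 hn with rfl | rfl <;> norm_num <;> ring
    · rw [modes, if_neg hn]
      rw [abs_eq (by norm_num)] at hn
      push Not at hn
      simp [hn]
  simp only [e]
  have hs := (hasSum_ite_eq (1 : ℤ) (a ^ 2 / 4)).add (hasSum_ite_eq (-1 : ℤ) (a ^ 2 / 4))
  rw [(hs.add hr.hasSum).tsum_eq, l2_sq]
  ring

/-- The Fourier coefficients of the remainder of the Stokes expansion. -/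
lemma norm_modes_sub_stokes_le {α a K : ℝ} {r : ℤ → ℂ} (hlow : ∀ n, |n| ≤ 1 → r n = 0)
    (hneg : ∀ n, r (-n) = (starRingEnd ℂ) (r n)) (hK : 0 ≤ K)
    (h₂ : ‖r 2 - ((a ^ 2 / (4 * (2 ^ α - 1)) : ℝ) : ℂ)‖ ≤ K * a ^ 4)
    (h₃ : ‖r 3 - ((a ^ 3 / (4 * (2 ^ α - 1) * (3 ^ α - 1)) : ℝ) : ℂ)‖ ≤ K * a ^ 4)
    (h₄ : ∀ n : ℤ, 4 ≤ |n| → |(n : ℝ)| ^ (4 : ℝ) * ‖r n‖ ≤ K * a ^ 4) (n : ℤ) :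
    |(n : ℝ)| ^ (4 : ℝ) * ‖modes a r n - coef (stokes α a) n‖ ≤ 81 * K * a ^ 4 := by
  have hKa : 0 ≤ K * a ^ 4 := by positivity
  have hnn : ∀ m : ℤ, 0 ≤ m → |(m : ℝ)| ^ (4 : ℝ) * ‖modes a r m - coef (stokes α a) m‖
      ≤ 81 * K * a ^ 4 := by
    intro m hm
    rw [coef_stokes, modes]
    have hma := abs_of_nonneg hm
    by_cases m1 : |m| = 1
    · rw [if_pos m1, if_pos m1]; simp; linarith
    rw [if_neg m1, if_neg m1]
    by_cases m2 : |m| = 2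
    · rw [if_pos m2, abs_rpow_four]
      have : m = 2 := by omega
      subst this
      norm_num at h₂ ⊢
      linarith
    rw [if_neg m2]
    -- The weight `3⁴ = 81` of this mode fixes the constant in the bound.
    by_cases m3 : |m| = 3
    · rw [if_pos m3, abs_rpow_four]
      have : m = 3 := by omega
      subst this
      norm_num at h₃ ⊢
      linarith
    rw [if_neg m3, sub_zero]
    by_cases m4 : 4 ≤ |m|
    · linarith [h₄ m m4]
    · rw [hlow m (by omega), norm_zero, mul_zero]; linarith
  rcases le_or_gt 0 n with hn | hn
  · exact hnn n hn
  · have h := hnn (-n) (by omega)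
    have hmn : modes a r (-n) = (starRingEnd ℂ) (modes a r n) := by
      unfold modes
      rw [abs_neg]
      split_ifs
      · rw [Complex.conj_ofReal]
      · exact hneg n
    rw [coef_neg, hmn, ← map_sub, Complex.norm_conj] at h
    simpa using h

/-- The amplitude maps an initial part of the branch onto an interval `(0, a₀)`. -/
lemma IsBranch.bijOn {α c₁ c₀ C₀ : ℝ} {A : ℝ → ℝ} {R : ℝ → ℤ → ℂ} (h : IsBranch α c₁ C₀ A R)
    (hc₀ : c₀ ∈ Ioo (-1) c₁) : BijOn A (Ioo (-1) c₀) (Ioo 0 (A c₀)) := by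
  have hsub : Ioo (-1) c₀ ⊆ Ioo (-1) c₁ := Ioo_subset_Ioo_right hc₀.2.le
  refine ⟨fun c hc => ⟨h.pos c (hsub hc), h.mono (hsub hc) hc₀ hc.2⟩,
    h.mono.injOn.mono hsub, fun a ha => ?_⟩
  -- A speed with amplitude below `a` starts the interval for the intermediate value theorem; no
  -- limit at the excluded endpoint `-1` is needed.
  obtain ⟨c, hc, hca⟩ := h.lim a ha.1
  have hcc : c < c₀ := by
    by_contra! hle
    exact absurd (h.mono.monotoneOn hc₀ hc hle) (by linarith [ha.2])
  have hI : Icc c c₀ ⊆ Ioo (-1) c₁ := fun x hx => ⟨hc.1.trans_le hx.1, hx.2.trans_lt hc₀.2⟩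
  obtain ⟨x, hx, rfl⟩ := intermediate_value_Ioo hcc.le (h.cont.mono hI) ⟨hca, ha.2⟩
  exact ⟨x, ⟨hc.1.trans hx.1, hx.2⟩, rfl⟩

end

end FracKdV

set_option maxHeartbeats 800000 in
open FracKdV in
theorem corollary2p6 (α : ℝ) (hα : α ∈ Set.Ioc (1 / 2 : ℝ) 2) :
    ∃ c₀ : ℝ, -1 < c₀ ∧ ∃ a₀ : ℝ, 0 < a₀ ∧ ∃ K : ℝ, ∃ γ : ℝ → ℝ, ∃ Ψ : ℝ → ℝ → ℝ,
      Set.BijOn γ (Set.Ioo 0 a₀) (Set.Ioo (-1) c₀) ∧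
      ∀ a ∈ Set.Ioo 0 a₀,
        FracKdV.IsSolution α (γ a) (Ψ a) ∧
        (∀ ψ : ℝ → ℝ, FracKdV.IsMinimizerWave α (γ a) ψ ↔ ψ = Ψ a) ∧
        Real.pi⁻¹ * (∫ x in (-Real.pi)..Real.pi, Ψ a x * Real.cos x) = a ∧
        FracKdV.MemHper α (fun x => Ψ a x - FracKdV.stokes α a x) ∧
        FracKdV.hperNorm α (fun x => Ψ a x - FracKdV.stokes α a x) ≤ K * a ^ 4 ∧
        |γ a - (-1 + a ^ 2 / (2 * (2 ^ α - 1)))| ≤ K * a ^ 4 ∧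
        |FracKdV.mean (fun x => Ψ a x ^ 2) - a ^ 2 / 2| ≤ K * a ^ 4 := by
  obtain ⟨hα1, hα2⟩ := hα
  have hα0 : 0 < α := by linarith
  have hG := one_le_invBound hα0
  set C₀ := 2 * invBound α with hC₀
  obtain ⟨C, hC, expand⟩ := Reduced.exists_expansion hα1 C₀ (by linarith)
  have hS := invSqSum_nonneg
  -- The amplitude bound ensures both `a ≤ 1` and `C a² invSqSum ≤ a / 2`, the dominance of the
  -- first mode required for the shape.
  obtain ⟨c₁, hc₁, -, A, R, hB, hAε⟩ :=
    exists_isBranch hα1 (min 1 (2 * (C * invSqSum + 1))⁻¹) (by positivity)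
  -- An interior speed is taken so that its own amplitude `A c₀` is available as the end of the
  -- amplitude interval.
  set c₀ := (-1 + c₁) / 2 with hc₀
  have hc₀m : c₀ ∈ Ioo (-1) c₁ := ⟨by rw [hc₀]; linarith, by rw [hc₀]; linarith⟩
  have hbij := hB.bijOn hc₀m
  have hinv := hbij.invOn_invFunOn
  set γ := Function.invFunOn A (Ioo (-1) c₀) with hγ
  have hγbij : BijOn γ (Ioo 0 (A c₀)) (Ioo (-1) c₀) := hbij.symm hinv.symm
  have hD₂ : 0 < (2 : ℝ) ^ α - 1 :=
    sub_pos.2 (Real.one_lt_rpow (by norm_num) hα0)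
  have hD₃ : 0 < (3 : ℝ) ^ α - 1 :=
    sub_pos.2 (Real.one_lt_rpow (by norm_num) hα0)
  set D₂ := (2 : ℝ) ^ α - 1 with hD₂e
  set D₃ := (3 : ℝ) ^ α - 1 with hD₃e
  set K₂ := (C + 3 * C ^ 2) / D₂ with hK₂
  set K₃ := (C + 3 * C ^ 2 + K₂) / D₃ with hK₃
  have hK₂0 : 0 ≤ K₂ := by positivity
  have hK₃0 : 0 ≤ K₃ := by positivity
  set L := C + K₂ + K₃ with hL
  -- The three summands serve the profile, the speed and the mean of the square, respectively.
  set K := 2 * √invSqSum * (81 * L) + (C + 2 * K₂) + C₀ ^ 2 with hK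
  refine ⟨c₀, hc₀m.1, A c₀, hB.pos c₀ hc₀m, K, γ, fun a => waveFun (modes a (R (γ a))), hγbij,
    fun a ha => ?_⟩
  have hcm : γ a ∈ Ioo (-1) c₁ := Ioo_subset_Ioo_right hc₀m.2.le (hγbij.mapsTo ha)
  have hAa : A (γ a) = a := hinv.2 ha
  have hw := hB.wave _ hcm
  have hred := hB.reduced _ hcm
  have hl2 := hB.l2_le _ hcm
  have huniq := hB.unique _ hcm
  have hreal := hB.real _ hcm
  have haε := hAε _ hcm
  rw [hAa] at hw hred hl2 huniq haε
  set c := γ a with hc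
  set r := R c with hr
  have ha0 : 0 < a := ha.1
  have ha1 : a ≤ 1 := haε.trans (min_le_left _ _)
  obtain ⟨dec, dec₄, h₂, h₃, h₁⟩ := expand a c r hred hcm.1 ha0 ha1 hl2
  have hlow := hred.low
  have hM : C * a ^ 2 * invSqSum ≤ a / 2 := by
    have h := haε.trans (min_le_right _ _)
    rw [← one_div, le_div_iff₀ (by positivity)] at h
    nlinarith
  have hmreal : ∀ n, (starRingEnd ℂ) (modes a r n) = modes a r n := by
    intro n
    unfold modes
    split_ifs
    · exact Complex.conj_ofReal _
    · exact hreal n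
  have hmdec : ∀ n : ℤ, |(n : ℝ)| ^ (4 : ℝ) * ‖modes a r n‖ ≤ C * a ^ 2 + a / 2 := by
    intro n
    unfold modes
    split_ifs with hn
    · rw [← Int.cast_abs, hn, Complex.norm_real, Real.norm_eq_abs, abs_of_pos (by positivity)]
      simp only [Int.cast_one, Real.one_rpow, one_mul]
      nlinarith [mul_nonneg hC (sq_nonneg a)]
    · linarith [dec n]
  have hsum := summable_norm_of_decay hw.zero hmdec
  have hcoef := coef_waveFun hsum hmreal fun n => by rw [hw.neg, hmreal]
  have hmem := memL2per_waveFun hsum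
  have hz : ∀ n : ℤ, n ≠ 0 → ‖r n‖ ≤ C * a ^ 2 := by
    intro n hn
    refine le_trans ?_ (dec n)
    exact le_mul_of_one_le_left (norm_nonneg _)
      (Real.one_le_rpow (one_le_abs_cast hn) (by norm_num))
  rw [show (2 : ℝ) ^ α + c = D₂ + (1 + c) by rw [hD₂e]; ring] at h₂
  rw [show (3 : ℝ) ^ α + c = D₃ + (1 + c) by rw [hD₃e]; ring] at h₃
  obtain ⟨e₂, e₃, e₁⟩ := stokes_algebra hC hD₂ hD₃ hcm.1 ha0 ha1 (hz 2 (by norm_num))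
    (hz 3 (by norm_num)) h₂ h₃ h₁
  have ha4 : 0 ≤ a ^ 4 := by positivity
  have hneg : ∀ n, r (-n) = (starRingEnd ℂ) (r n) := by
    intro n
    have h := hw.neg n
    by_cases hn : |n| ≤ 1
    · rw [hlow n hn, hlow (-n) (by rwa [abs_neg]), map_zero]
    · rwa [modes, modes, if_neg (by rw [abs_neg]; omega), if_neg (by omega)] at h
  have hrem := norm_modes_sub_stokes_le (K := L) hlow hneg (by positivity)
    (e₂.trans (mul_le_mul_of_nonneg_right (by linarith) ha4))
    (e₃.trans (mul_le_mul_of_nonneg_right (by linarith) ha4))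
    fun n hn => (dec₄ n hn).trans (mul_le_mul_of_nonneg_right (by linarith) ha4)
  have hdiff : MemL2per fun x => waveFun (modes a r) x - stokes α a x :=
    MemL2per.of_continuous
      (fun x => by simp only [periodic_waveFun _ x, (memL2per_stokes α a).1 x])
      ((continuous_waveFun hsum).sub (continuous_stokes α a))
  have hdcoef : ∀ n, coef (fun x => waveFun (modes a r) x - stokes α a x) n
      = modes a r n - coef (stokes α a) n := by
    intro n
    rw [coef_sub hmem.integrable (memL2per_stokes α a).integrable, hcoef]
  have hd0 : coef (fun x => waveFun (modes a r) x - stokes α a x) 0 = 0 := by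
    rw [hdcoef, hw.zero, coef_stokes]; norm_num
  have hddec : ∀ n : ℤ, |(n : ℝ)| ^ (4 : ℝ) *
      ‖coef (fun x => waveFun (modes a r) x - stokes α a x) n‖ ≤ 81 * L * a ^ 4 := by
    intro n; rw [hdcoef]; exact hrem n
  have hsq := Real.sqrt_nonneg invSqSum
  have hL0 : 0 ≤ L := by positivity
  have hKs := mul_nonneg (mul_nonneg (zero_le_two (α := ℝ)) hsq)
    (by positivity : (0 : ℝ) ≤ 81 * L)
  refine ⟨isSolution_waveFun hα1 hα2 hcm.1 hw hmreal hmdec, fun ψ => ⟨fun hψ => ?_, ?_⟩,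
    integral_mul_cos hmem (by rw [hcoef]; simp [modes]), memHper_of_decay hα2 hdiff hd0 hddec,
    (hperNorm_le_of_decay hα2 hdiff hd0 hddec).trans ?_, e₁.trans ?_, ?_⟩
  · exact hψ.eq_waveFun hα1 ha0 huniq hlow dec hM hmdec
  · rintro rfl
    exact isMinimizerWave_waveFun ha0 hw hsum hmreal hlow (summable_sq_mul_norm dec)
      ((tsum_sq_mul_norm_le dec).trans hM)
  · rw [← mul_assoc]
    refine mul_le_mul_of_nonneg_right ?_ ha4
    linarith [sq_nonneg C₀]
  · refine mul_le_mul_of_nonneg_right ?_ ha4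
    linarith [sq_nonneg C₀]
  · rw [mean_sq hmem, hcoef, tsum_modes_sq hred.sq hlow, add_sub_cancel_left,
      abs_of_nonneg (sq_nonneg _)]
    calc l2 r ^ 2 ≤ (C₀ * a ^ 2) ^ 2 := pow_le_pow_left₀ (l2_nonneg r) hl2 2
      _ = C₀ ^ 2 * a ^ 4 := by ring
      _ ≤ _ := mul_le_mul_of_nonneg_right (by linarith) ha4
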